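/- Let $\hbar\in\mathbb C\setminus\{0\}$. Consider solutions $(L,M,\bar L,\bar M)$ of the $\hbar$-dependent Toda lattice hierarchy, with formal power series in the times $t=(t_1,t_2,\dots)$, $\bar t=(\bar t_1,\bar t_2,\dots)$ as coefficients, on the lattice $s\in\hbar\mathbb Z$: $$L=e^{\hbar\partial_s}+\sum_{n\ge0}u_{n+1}e^{-n\hbar\partial_s},\quad M=\sum_{n\ge1} nt_nL^n+s+\sum_{n\ge1}v_nL^{-n},$$ $$\bar L=\tilde u_0e^{\hbar\partial_s}+\sum_{n\ge0}\tilde u_{n+1}e^{(n+2)\hbar\partial_s},\quad \bar M=-\sum_{n\ge1} n\bar t_n\bar L^{-n}+s+\sum_{n\ge1}\bar v_n\bar L^{n}$$ ($\tilde u_0$ invertible), $[L,M]=\hbar L$, $[\bar L,\bar M]=\hbar\bar L$, and $\hbar\,\partial X/\partial t_n=[(L^n)_{\ge0},X]$, $\hbar\,\partial X/\partial\bar t_n=[(\bar L^{-n})_{<0},X]$ for $X=L,M,\bar L,\bar M$. Difference operators are identified with $\mathbb Z\times\mathbb Z$ matrices, $e^{\hbar\partial_s}\leftrightarrow\Lambda=(\delta_{i,j-1})$,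 $s\leftrightarrow\hbar\Delta=(\hbar i\,\delta_{ij})$. The solution determined by a matrix $U=(u_{ij})_{i,j\in\mathbb Z}$ is given by the factorization $W(t,\bar t)^{-1}\bar W(t,\bar t)=e^{\hbar^{-1}\sum t_n\Lambda^n}\,U\,e^{-\hbar^{-1}\sum\bar t_n\Lambda^{-n}}$ ($W$ lower triangular with unit diagonal, $\bar W$ upper triangular with invertible diagonal) and $L=W\Lambda W^{-1}$, $M=W(\hbar\Delta+\sum nt_n\Lambda^n)W^{-1}$, $\bar L=\bar W\Lambda\bar W^{-1}$, $\bar M=\bar W(\hbar\Delta-\sum n\bar t_n\Lambda^{-n})\bar W^{-1}$. The string equations of the $p$-th generalized Kontsevich model are $L^p=\bar M\bar L^{-1}+\bar L^p$, $\bar L=-\frac1pML^{-p}+\hbar\frac{p-1}{2p}L^{-p}+L$; those of the compactified $c=1$ string theory with parameter $\beta$ are $$L^\beta=\Bigl(-\tfrac1\beta\bar M-\hbar\tfrac{\beta+1}{2\beta}+1\Bigr)\bar L^\beta,\qquad \bar L^{-\beta}=\Bigl(-\tfrac1\beta M+\hbar\tfrac{\beta-1}{2\beta}+1\Bigr)L^{-\beta}.$$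 The $c=1$ theory has the matrix $U^{(\beta)}$ with $u_{ij}=(-\hbar)^{(i+1/2)/\beta}\,\Gamma\bigl(\tfrac12-\tfrac1\hbar+\tfrac{i+1/2}\beta\bigr)\Gamma\bigl(\tfrac12-\tfrac1\hbar\bigr)^{-1}\delta_{ij}$; call $\hbar$ *regular for* $\beta$ if no Gamma function here is evaluated at a pole. The generalized Kontsevich model at $p=-1$ has the lower triangular matrix $U^{\rm GKM}$ with $u_j(\lambda)\sim\sum_{i\ge j}\lambda^{-i-1}u_{ij}$ as $\lambda\to+\infty$, where $u_j(\lambda)=\lambda^{-1}e^{\hbar^{-1}\log\lambda}\int d\mu\,\mu^{-j-1}\exp\hbar^{-1}(\lambda^{-1}\mu-\log\mu)$ along the path $\mu=\hbar\lambda(1+iy)^2$, $y$ from $-\infty$ to $\infty$, with the continuous branch $\log\mu=\log\hbar+\log\lambda+2\log(1+iy)$ (principal logarithms). Then: 1. At $p=-1$ the string equations of the generalized Kontsevich model read $L^{-1}=\bar M\bar L^{-1}+\bar L^{-1}$, $\bar L=ML+\hbar L+L$. 2. They agree with none of the $c=1$ string equations for $\beta\ge1$: no solution of the Toda lattice hierarchy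 satisfies both systems. 3. They coincide with the $c=1$ string equations for $\beta=-1$, and this is the only possible value: for every integer $\beta\ne0,-1$ no solution of the Toda lattice hierarchy satisfies both systems. 4. If $\beta\neq0$ is an integer and $\hbar$ is regular for $\beta$, then $U^{(\beta)}$ determines exactly one quadruple $(L,M,\bar L,\bar M)$; it is a solution of the Toda lattice hierarchy, it satisfies the $c=1$ string equations with parameter $\beta$, and it satisfies the string equations of the generalized Kontsevich model at $p=-1$ if and only if $\beta=-1$. 5. $U^{\rm GKM}$ exists and is unique. If $\hbar$ is regular for $\beta=-1$, then $U^{\rm GKM}=\kappa\,U^{(-1)}$ with a constant $\kappa\ne0$, and $U^{\rm GKM}$ determines exactly one quadruple; it is a solution of the Toda lattice hierarchy, satisfies the string equations of 1, and is the solution determined by $U^{(-1)}$. For $\beta\ge1$ it does not satisfy the $c=1$ string equations with parameter $\beta$ and, when $\hbar$ is regular for $\beta$, it is not determined by $U^{(\beta)}$. 6. (Relation with the Penner model.) Let $\hbar<0$ be real, $N\ge0$, $\Lambda=\operatorname{diag}(\lambda_1,\dots,\lambda_N)$ with $\lambda_i>0$, and $I(\Lambda)=\int_{M>0}dM\,\exp\hbar^{-1}\operatorname{Tr}(\Lambda^{-1}M-\log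 M)$ over positive definite Hermitian $N\times N$ matrices. Then $I(\Lambda)$ converges absolutely and $I(\Lambda)=(\det\Lambda)^{N-1/\hbar}I(1)$. For distinct $\lambda_i$ the normalization factor of the model, $C(\Lambda)=\prod_{i>j}\frac{\lambda_i^{-1}-\lambda_j^{-1}}{\lambda_i-\lambda_j}\,(\det\Lambda)^{-1}e^{\hbar^{-1}\operatorname{Tr}\log\Lambda}$, equals $(-1)^{N(N-1)/2}(\det\Lambda)^{1/\hbar-N}$. Moreover $I(1)=e^{N/\hbar}Z_{\rm Penner}$, where $Z_{\rm Penner}=\int_{1-\Phi>0}d\Phi\,\exp\bigl(-\hbar^{-1}\operatorname{Tr}(\log(1-\Phi)+\Phi)\bigr)$ is an absolutely convergent positive integral over Hermitian $N\times N$ matrices, the partition function of the Penner model. -/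

import Mathlib

namespace TodaString

/-- Index set of the time variables: `Sum.inl n` stands for `t_n` and `Sum.inr n` for `tbar_n`,
`n = 1, 2, …`. -/
abbrev Time : Type := ℕ+ ⊕ ℕ+
/-- Formal power series in all the times, expanded at `t = tbar = 0`. -/
abbrev Coeffs : Type := MvPowerSeries Time ℂ
/-- `ℤ × ℤ` matrices over `Coeffs`. The difference operator `∑ aₙ(s) exp(n ħ ∂_s)` on the lattice
`s = ħ i`, `i ∈ ℤ`, is the matrix whose `(i, i + n)` entry is `aₙ(ħ i)`. -/
abbrev Mat : Type := ℤ → ℤ → Coeffs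

/-- Weighted degree of a monomial in the times: `t_n` and `tbar_n` have weight `n`. -/
noncomputable def wt : (Time →₀ ℕ) →+ ℕ :=
  Finsupp.weight (Sum.elim (fun n : ℕ+ => (n : ℕ)) (fun n : ℕ+ => (n : ℕ)))

/-- Coefficientwise sum of a family of power series in which every monomial occurs in only
finitely many members. -/
noncomputable def formalSum {ι : Type} (f : ι → Coeffs) : Coeffs :=
  fun m => ∑ᶠ k, MvPowerSeries.coeff m (f k)

/-- Matrix product, i.e. composition of difference operators. -/
noncomputable def matMul (A B : Mat) : Mat :=
  fun i j => formalSum fun k => A i k * B k j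

noncomputable def matOne : Mat := fun i j => if i = j then 1 else 0

/-- For `ε = 1`: in each weighted degree `d` in the times, only the shifts `exp(n ħ ∂_s)` with
`n ≤ N + d` occur. For `ε = -1`: only the shifts with `n ≥ -N - d` occur. -/
def IsBanded (ε : ℤˣ) (A : Mat) : Prop :=
  ∃ N : ℤ, ∀ (m : Time →₀ ℕ) (i j : ℤ),
    MvPowerSeries.coeff m (A i j) ≠ 0 → (ε : ℤ) * (j - i) ≤ N + wt m

theorem coeff_formalSum {ι : Type} (f : ι → Coeffs) (m : Time →₀ ℕ) :
    MvPowerSeries.coeff m (formalSum f) = ∑ᶠ k, MvPowerSeries.coeff m (f k) := rfl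

theorem coeff_formalSum_mul {ι : Type} (f : ι → Coeffs) (x : Coeffs)
    (hf : ∀ m, (Function.support fun k => MvPowerSeries.coeff m (f k)).Finite)
    (m : Time →₀ ℕ) :
    MvPowerSeries.coeff m (formalSum f * x) =
      ∑ᶠ k, MvPowerSeries.coeff m (f k * x) := by
  simp only [MvPowerSeries.coeff_mul, coeff_formalSum, finsum_mul]
  refine sum_finsum_comm _ _ fun p _ => (hf p.1).subset ?_
  intro k hk h
  simp_all

theorem coeff_mul_formalSum {ι : Type} (f : ι → Coeffs) (x : Coeffs)
    (hf : ∀ m, (Function.support fun k => MvPowerSeries.coeff m (f k)).Finite)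
    (m : Time →₀ ℕ) :
    MvPowerSeries.coeff m (x * formalSum f) =
      ∑ᶠ k, MvPowerSeries.coeff m (x * f k) := by
  simp only [mul_comm x]
  exact coeff_formalSum_mul f x hf m

theorem exists_of_coeff_mul_ne_zero {x y : Coeffs} {m : Time →₀ ℕ}
    (h : MvPowerSeries.coeff m (x * y) ≠ 0) :
    ∃ p q, p + q = m ∧ MvPowerSeries.coeff p x ≠ 0 ∧ MvPowerSeries.coeff q y ≠ 0 := by
  rw [MvPowerSeries.coeff_mul] at h
  obtain ⟨⟨p, q⟩, hp, hne⟩ := Finset.exists_ne_zero_of_sum_ne_zero h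
  exact ⟨p, q, Finset.HasAntidiagonal.mem_antidiagonal.1 hp, left_ne_zero_of_mul hne, right_ne_zero_of_mul hne⟩

theorem IsBanded.mul_bound {ε : ℤˣ} {A B : Mat} {N N' : ℤ}
    (hA : ∀ (m : Time →₀ ℕ) (i j : ℤ),
      MvPowerSeries.coeff m (A i j) ≠ 0 → (ε : ℤ) * (j - i) ≤ N + wt m)
    (hB : ∀ (m : Time →₀ ℕ) (i j : ℤ),
      MvPowerSeries.coeff m (B i j) ≠ 0 → (ε : ℤ) * (j - i) ≤ N' + wt m)
    {m : Time →₀ ℕ} {i j k : ℤ} (h : MvPowerSeries.coeff m (A i k * B k j) ≠ 0) :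
    (ε : ℤ) * (k - i) ≤ N + wt m ∧ (ε : ℤ) * (j - k) ≤ N' + wt m ∧
      (ε : ℤ) * (j - i) ≤ N + N' + wt m := by
  obtain ⟨p, q, rfl, hp, hq⟩ := exists_of_coeff_mul_ne_zero h
  have h1 := hA _ _ _ hp
  have h2 := hB _ _ _ hq
  have e : (ε : ℤ) * (j - i) = (ε : ℤ) * (k - i) + (ε : ℤ) * (j - k) := by ring
  simp only [map_add, Nat.cast_add]
  refine ⟨?_, ?_, ?_⟩ <;> omega

theorem finite_window (ε : ℤˣ) (i j N N' : ℤ) :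
    {k : ℤ | (ε : ℤ) * (k - i) ≤ N ∧ (ε : ℤ) * (j - k) ≤ N'}.Finite := by
  rcases Int.units_eq_one_or ε with rfl | rfl
  · refine (Set.finite_Icc (j - N') (i + N)).subset ?_
    rintro k ⟨h1, h2⟩
    simp only [Units.val_one, one_mul] at h1 h2
    exact ⟨by omega, by omega⟩
  · refine (Set.finite_Icc (i - N) (j + N')).subset ?_
    rintro k ⟨h1, h2⟩
    simp only [Units.val_neg, Units.val_one, neg_mul, one_mul] at h1 h2
    exact ⟨by omega, by omega⟩

theorem IsBanded.finite_support {ε : ℤˣ} {A B : Mat} (hA : IsBanded ε A) (hB : IsBanded ε B)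
    (i j : ℤ) (m : Time →₀ ℕ) :
    (Function.support fun k => MvPowerSeries.coeff m (A i k * B k j)).Finite := by
  obtain ⟨N, hA⟩ := hA
  obtain ⟨N', hB⟩ := hB
  refine (finite_window ε i j (N + wt m) (N' + wt m)).subset ?_
  intro k hk
  have := IsBanded.mul_bound hA hB hk
  exact ⟨this.1, this.2.1⟩

theorem IsBanded.mul {ε : ℤˣ} {A B : Mat} (hA : IsBanded ε A) (hB : IsBanded ε B) :
    IsBanded ε (matMul A B) := by
  obtain ⟨N, hA⟩ := hA
  obtain ⟨N', hB⟩ := hB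
  refine ⟨N + N', fun m i j h => ?_⟩
  obtain ⟨k, hk⟩ : ∃ k, MvPowerSeries.coeff m (A i k * B k j) ≠ 0 := by
    by_contra! hk
    exact h (by simp [matMul, coeff_formalSum, hk])
  exact (IsBanded.mul_bound hA hB hk).2.2

theorem isBanded_one (ε : ℤˣ) : IsBanded ε matOne := by
  refine ⟨0, fun m i j h => ?_⟩
  by_cases hij : i = j
  · subst hij; simp
  · simp [matOne, hij] at h

theorem matMul_assoc {ε : ℤˣ} {A B C : Mat} (hA : IsBanded ε A) (hB : IsBanded ε B)
    (hC : IsBanded ε C) : matMul (matMul A B) C = matMul A (matMul B C) := by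
  funext i l
  ext m
  have hfin : (Function.support fun p : ℤ × ℤ =>
      MvPowerSeries.coeff m (A i p.1 * B p.1 p.2 * C p.2 l)).Finite := by
    obtain ⟨a, hA⟩ := hA
    obtain ⟨b, hB⟩ := hB
    obtain ⟨c, hC⟩ := hC
    refine ((finite_window ε i l (a + wt m) (b + c + wt m)).prod
      (finite_window ε i l (a + b + wt m) (c + wt m))).subset ?_
    rintro ⟨k, j⟩ h
    change MvPowerSeries.coeff m (A i k * B k j * C j l) ≠ 0 at h
    obtain ⟨p, q, hpq, hp, hq⟩ := exists_of_coeff_mul_ne_zero h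
    have h1 := IsBanded.mul_bound hA hB hp
    have h2 := hC _ _ _ hq
    rw [mul_assoc] at h
    obtain ⟨p', q', hpq', hp', hq'⟩ := exists_of_coeff_mul_ne_zero h
    have h3 := IsBanded.mul_bound hB hC hq'
    have h4 := hA _ _ _ hp'
    have e1 : (wt p : ℤ) + wt q = wt m := by rw [← hpq, map_add]; push_cast; ring
    have e2 : (wt p' : ℤ) + wt q' = wt m := by rw [← hpq', map_add]; push_cast; ring
    refine ⟨⟨?_, ?_⟩, ⟨?_, ?_⟩⟩ <;> dsimp only <;> omega
  change ∑ᶠ j, MvPowerSeries.coeff m (matMul A B i j * C j l) =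
    ∑ᶠ k, MvPowerSeries.coeff m (A i k * matMul B C k l)
  have e1 : ∀ j, MvPowerSeries.coeff m (matMul A B i j * C j l) =
      ∑ᶠ k, MvPowerSeries.coeff m (A i k * B k j * C j l) := fun j =>
    coeff_formalSum_mul _ _ (fun m => hA.finite_support hB i j m) m
  have e2 : ∀ k, MvPowerSeries.coeff m (A i k * matMul B C k l) =
      ∑ᶠ j, MvPowerSeries.coeff m (A i k * B k j * C j l) := fun k => by
    simp only [mul_assoc]
    exact coeff_mul_formalSum _ _ (fun m => hB.finite_support hC k l m) m
  simp only [e1, e2]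
  rw [← finsum_curry (fun p : ℤ × ℤ =>
    MvPowerSeries.coeff m (A i p.1 * B p.1 p.2 * C p.2 l)) hfin]
  have hfin' : (Function.support fun p : ℤ × ℤ =>
      MvPowerSeries.coeff m (A i p.2 * B p.2 p.1 * C p.1 l)).Finite := by
    refine (hfin.image Prod.swap).subset ?_
    rintro ⟨j, k⟩ h
    exact ⟨(k, j), h, rfl⟩
  rw [← finsum_curry (fun p : ℤ × ℤ =>
    MvPowerSeries.coeff m (A i p.2 * B p.2 p.1 * C p.1 l)) hfin']
  exact (finsum_comp_equiv (Equiv.prodComm ℤ ℤ)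
    (f := fun p : ℤ × ℤ => MvPowerSeries.coeff m (A i p.1 * B p.1 p.2 * C p.2 l)))

theorem matMul_add {ε : ℤˣ} {A B C : Mat} (hA : IsBanded ε A) (hB : IsBanded ε B)
    (hC : IsBanded ε C) : matMul A (B + C) = matMul A B + matMul A C := by
  funext i j
  ext m
  change ∑ᶠ k, MvPowerSeries.coeff m (A i k * (B k j + C k j)) =
    ∑ᶠ k, MvPowerSeries.coeff m (A i k * B k j) + ∑ᶠ k, MvPowerSeries.coeff m (A i k * C k j)
  simp only [mul_add, map_add]
  exact finsum_add_distrib (hA.finite_support hB i j m) (hA.finite_support hC i j m)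

theorem add_matMul {ε : ℤˣ} {A B C : Mat} (hA : IsBanded ε A) (hB : IsBanded ε B)
    (hC : IsBanded ε C) : matMul (A + B) C = matMul A C + matMul B C := by
  funext i j
  ext m
  change ∑ᶠ k, MvPowerSeries.coeff m ((A i k + B i k) * C k j) =
    ∑ᶠ k, MvPowerSeries.coeff m (A i k * C k j) + ∑ᶠ k, MvPowerSeries.coeff m (B i k * C k j)
  simp only [add_mul, map_add]
  exact finsum_add_distrib (hA.finite_support hC i j m) (hB.finite_support hC i j m)

theorem one_matMul (A : Mat) : matMul matOne A = A := by
  funext i j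
  ext m
  change ∑ᶠ k, MvPowerSeries.coeff m ((if i = k then (1 : Coeffs) else 0) * A k j) = _
  rw [finsum_eq_single _ i]
  · simp
  · intro k hk; simp [Ne.symm hk]

theorem matMul_one (A : Mat) : matMul A matOne = A := by
  funext i j
  ext m
  change ∑ᶠ k, MvPowerSeries.coeff m (A i k * (if k = j then (1 : Coeffs) else 0)) = _
  rw [finsum_eq_single _ j]
  · simp
  · intro k hk; simp [hk]

theorem smul_matMul (c : ℂ) (A B : Mat) : matMul (c • A) B = c • matMul A B := by
  funext i j
  ext m
  change ∑ᶠ k, MvPowerSeries.coeff m ((c • A i k) * B k j) =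
    c • ∑ᶠ k, MvPowerSeries.coeff m (A i k * B k j)
  simp only [smul_mul_assoc, map_smul]
  exact (smul_finsum c _).symm

theorem matMul_smul (c : ℂ) (A B : Mat) : matMul A (c • B) = c • matMul A B := by
  funext i j
  ext m
  change ∑ᶠ k, MvPowerSeries.coeff m (A i k * (c • B k j)) =
    c • ∑ᶠ k, MvPowerSeries.coeff m (A i k * B k j)
  simp only [mul_smul_comm, map_smul]
  exact (smul_finsum c _).symm

/-- The matrices that are banded on one side. -/
noncomputable def bandedSubmodule (ε : ℤˣ) : Submodule ℂ Mat where
  carrier := {A | IsBanded ε A}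
  zero_mem' := ⟨0, fun m i j h => absurd (by simp) h⟩
  add_mem' := by
    rintro A B ⟨N, hA⟩ ⟨N', hB⟩
    refine ⟨max N N', fun m i j h => ?_⟩
    by_cases h1 : MvPowerSeries.coeff m (A i j) = 0
    · have h2 : MvPowerSeries.coeff m (B i j) ≠ 0 := by
        intro h2; apply h; simp [h1, h2]
      have := hB _ _ _ h2
      omega
    · have := hA _ _ _ h1
      omega
  smul_mem' := by
    rintro c A ⟨N, hA⟩
    refine ⟨N, fun m i j h => hA m i j fun h0 => h ?_⟩
    simp [h0]

/-- The algebra of formal difference operators that are banded on one side. -/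
abbrev Op (ε : ℤˣ) : Type := bandedSubmodule ε

noncomputable instance Op.instRing (ε : ℤˣ) : Ring (Op ε) :=
  { (inferInstance : AddCommGroup (Op ε)) with
    mul := fun A B => ⟨matMul A.1 B.1, IsBanded.mul A.2 B.2⟩
    one := ⟨matOne, isBanded_one ε⟩
    mul_assoc := fun A B C => Subtype.ext (matMul_assoc A.2 B.2 C.2)
    one_mul := fun A => Subtype.ext (one_matMul A.1)
    mul_one := fun A => Subtype.ext (matMul_one A.1)
    left_distrib := fun A B C => Subtype.ext (matMul_add A.2 B.2 C.2)
    right_distrib := fun A B C => Subtype.ext (add_matMul A.2 B.2 C.2)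
    zero_mul := fun A => Subtype.ext (by
      have := smul_matMul 0 0 A.1
      rwa [zero_smul, zero_smul] at this)
    mul_zero := fun A => Subtype.ext (by
      have := matMul_smul 0 A.1 0
      rwa [zero_smul, zero_smul] at this) }

noncomputable instance Op.instAlgebra (ε : ℤˣ) : Algebra ℂ (Op ε) :=
  Algebra.ofModule (fun c A B => Subtype.ext (smul_matMul c A.1 B.1))
    (fun c A B => Subtype.ext (matMul_smul c A.1 B.1))

/-- Operators with descending expansions; `L`, `M` and `W` live here. -/
abbrev DescOp : Type := Op 1

/-- Operators with ascending expansions; `Lbar`, `Mbar` and `Wbar` live here. -/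
abbrev AscOp : Type := Op (-1)

/-! ### Lax and Orlov-Shulman operators, the Toda lattice hierarchy -/

/-- The matrix of `exp(n ħ ∂_s)`. -/
noncomputable def shiftMat (n : ℤ) : Mat := fun i j => if j = i + n then 1 else 0

/-- The matrix of multiplication by `s = ħ i`. -/
noncomputable def sMat (ħ : ℂ) : Mat :=
  fun i j => if i = j then MvPowerSeries.C (ħ * (i : ℂ)) else 0

/-- `∑_{n ≥ 1} n x_n Pₙ`, where `x_n` is the time with index `ι n`. -/
noncomputable def timeSum (ι : ℕ+ → Time) (P : ℕ+ → Mat) : Mat :=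
  fun i j => formalSum fun n : ℕ+ => ((n : ℕ) : ℂ) • (MvPowerSeries.X (ι n) * P n i j)

/-- `∑_{n ≥ 1} vₙ(s) Pₙ`. -/
noncomputable def coeffSum (v : ℕ+ → ℤ → Coeffs) (P : ℕ+ → Mat) : Mat :=
  fun i j => formalSum fun n : ℕ+ => v n i * P n i j

/-- The projection `( )_{≥ 0}`. -/
noncomputable def nonnegPart (A : Mat) : Mat := fun i j => if i ≤ j then A i j else 0

/-- The projection `( )_{< 0}`. -/
noncomputable def negPart (A : Mat) : Mat := fun i j => if j < i then A i j else 0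

/-- A quadruple `(L, M, Lbar, Mbar)`; `L` and `Lbar` are invertible. -/
structure TodaOps where
  L : DescOpˣ
  M : DescOp
  Lbar : AscOpˣ
  Mbar : AscOp

/-- Integral powers of `L`. -/
noncomputable def TodaOps.Lpow (T : TodaOps) (n : ℤ) : DescOp := ((T.L ^ n : DescOpˣ) : DescOp)

/-- Integral powers of `Lbar`. -/
noncomputable def TodaOps.Lbarpow (T : TodaOps) (n : ℤ) : AscOp := ((T.Lbar ^ n : AscOpˣ) : AscOp)

/-- The Lax equation `ħ ∂X/∂x = [B, X]` with respect to the time `x`. -/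
def LaxEq (ħ : ℂ) (x : Time) (B X : Mat) : Prop :=
  ∀ i j : ℤ, ħ • MvPowerSeries.pderiv ℂ x (X i j) = matMul B X i j - matMul X B i j

/-- `(L, M, Lbar, Mbar)` is a solution of the `ħ`-dependent Toda lattice hierarchy: the operators
have the form
`L = exp(ħ∂_s) + ∑_{n ≥ 0} u_{n+1} exp(-nħ∂_s)`, `M = ∑ n t_n Lⁿ + s + ∑ vₙ L⁻ⁿ`,
`Lbar = ũ₀ exp(ħ∂_s) + ∑_{n ≥ 0} ũ_{n+1} exp((n+2)ħ∂_s)` with `ũ₀` invertible,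
`Mbar = -∑ n tbar_n Lbar⁻ⁿ + s + ∑ vbarₙ Lbarⁿ`,
satisfy the twisted canonical commutation relations and the Lax equations. -/
structure IsTodaSolution (ħ : ℂ) (T : TodaOps) : Prop where
  L_zero : ∀ i j : ℤ, i + 1 < j → (T.Lpow 1).1 i j = 0
  L_lead : ∀ i : ℤ, (T.Lpow 1).1 i (i + 1) = 1
  Lbar_zero : ∀ i j : ℤ, j < i + 1 → (T.Lbarpow 1).1 i j = 0
  Lbar_lead : ∀ i : ℤ, IsUnit ((T.Lbarpow 1).1 i (i + 1))
  M_form : ∃ v : ℕ+ → ℤ → Coeffs,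
    T.M.1 = timeSum Sum.inl (fun n => (T.Lpow (n : ℕ)).1) + sMat ħ
      + coeffSum v (fun n => (T.Lpow (-((n : ℕ) : ℤ))).1)
  Mbar_form : ∃ v : ℕ+ → ℤ → Coeffs,
    T.Mbar.1 = -timeSum Sum.inr (fun n => (T.Lbarpow (-((n : ℕ) : ℤ))).1) + sMat ħ
      + coeffSum v (fun n => (T.Lbarpow (n : ℕ)).1)
  comm : T.Lpow 1 * T.M - T.M * T.Lpow 1 = ħ • T.Lpow 1
  comm_bar : T.Lbarpow 1 * T.Mbar - T.Mbar * T.Lbarpow 1 = ħ • T.Lbarpow 1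
  lax_t : ∀ n : ℕ+, ∀ X ∈ ({(T.Lpow 1).1, T.M.1, (T.Lbarpow 1).1, T.Mbar.1} : Set Mat),
    LaxEq ħ (Sum.inl n) (nonnegPart (T.Lpow (n : ℕ)).1) X
  lax_tbar : ∀ n : ℕ+, ∀ X ∈ ({(T.Lpow 1).1, T.M.1, (T.Lbarpow 1).1, T.Mbar.1} : Set Mat),
    LaxEq ħ (Sum.inr n) (negPart (T.Lbarpow (-((n : ℕ) : ℤ))).1) X

/-! ### String equations -/

/-- String equations of the `p`-th generalized Kontsevich model:
`L^p = Mbar Lbar⁻¹ + Lbar^p` and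
`Lbar = -(1/p) M L^{-p} + ħ (p-1)/(2p) L^{-p} + L`. -/
def GKMStringEqs (ħ : ℂ) (p : ℤ) (T : TodaOps) : Prop :=
  (T.Lpow p).1 = (T.Mbar * T.Lbarpow (-1) + T.Lbarpow p).1 ∧
  (T.Lbarpow 1).1 = ((-(1 / (p : ℂ))) • (T.M * T.Lpow (-p))
      + (ħ * (((p : ℂ) - 1) / (2 * (p : ℂ)))) • T.Lpow (-p) + T.Lpow 1).1

/-- String equations of the compactified `c = 1` string theory with parameter `β`:
`L^β = (-(1/β) Mbar - ħ (β+1)/(2β) + 1) Lbar^β` and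
`Lbar^{-β} = (-(1/β) M + ħ (β-1)/(2β) + 1) L^{-β}`. -/
def C1StringEqs (ħ : ℂ) (β : ℤ) (T : TodaOps) : Prop :=
  (T.Lpow β).1 = (((-(1 / (β : ℂ))) • T.Mbar
      - (ħ * (((β : ℂ) + 1) / (2 * (β : ℂ)))) • (1 : AscOp) + 1) * T.Lbarpow β).1 ∧
  (T.Lbarpow (-β)).1 = (((-(1 / (β : ℂ))) • T.M
      + (ħ * (((β : ℂ) - 1) / (2 * (β : ℂ)))) • (1 : DescOp) + 1) * T.Lpow (-β)).1

/-! ### The solution determined by a constant matrix `U(0,0)` -/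

/-- The part of the weighted degree that comes from `t`. -/
noncomputable def wtT : (Time →₀ ℕ) →+ ℕ :=
  Finsupp.weight (Sum.elim (fun n : ℕ+ => (n : ℕ)) (fun _ : ℕ+ => 0))

/-- The part of the weighted degree that comes from `tbar`. -/
noncomputable def wtTbar : (Time →₀ ℕ) →+ ℕ :=
  Finsupp.weight (Sum.elim (fun _ : ℕ+ => 0) (fun n : ℕ+ => (n : ℕ)))

/-- `U(t,tbar) = exp(ħ⁻¹ ∑ t_n Λⁿ) U(0,0) exp(-ħ⁻¹ ∑ tbar_n Λ⁻ⁿ)`, i.e.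
`u_{ij}(t,tbar) = ∑_{m,n} S_m(t/ħ) u_{i+m,j+n}(0,0) S_n(-tbar/ħ)` with the Schur functions written
out as sums over monomials. -/
noncomputable def evolve (ħ : ℂ) (u : ℤ → ℤ → ℂ) : Mat := fun i j (m : Time →₀ ℕ) =>
  (m.prod fun x k => (Sum.elim (fun _ => ħ⁻¹) (fun _ => -ħ⁻¹) x : ℂ) ^ k / (k.factorial : ℂ))
    * u (i + (wtT m : ℤ)) (j + (wtTbar m : ℤ))

/-- The quadruple is obtained from the matrix `u = U(0,0)` by the factorization
`W(t,tbar) U(t,tbar) = Wbar(t,tbar)` with `W = 1 + ∑_{n ≥ 1} wₙ exp(-nħ∂_s)`,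
`Wbar = wbar₀ + ∑_{n ≥ 1} wbarₙ exp(nħ∂_s)` (`wbar₀` invertible) and the dressing relations
`L = W Λ W⁻¹`, `M = W (s + ∑ n t_n Λⁿ) W⁻¹`,
`Lbar = Wbar Λ Wbar⁻¹`, `Mbar = Wbar (s - ∑ n tbar_n Λ⁻ⁿ) Wbar⁻¹`.
It is meant for lower triangular `u` (in particular, for diagonal ones), for which all the matrix
products below are well defined. -/
def IsDeterminedBy (ħ : ℂ) (u : ℤ → ℤ → ℂ) (T : TodaOps) : Prop :=
  ∃ (W : DescOpˣ) (Wbar : AscOpˣ),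
    (∀ i j : ℤ, i < j → W.val.1 i j = 0) ∧ (∀ i : ℤ, W.val.1 i i = 1) ∧
    (∀ i j : ℤ, j < i → Wbar.val.1 i j = 0) ∧ (∀ i : ℤ, IsUnit (Wbar.val.1 i i)) ∧
    matMul W.val.1 (evolve ħ u) = Wbar.val.1 ∧
    matMul T.L.val.1 W.val.1 = matMul W.val.1 (shiftMat 1) ∧
    matMul T.M.1 W.val.1 =
      matMul W.val.1 (sMat ħ + timeSum Sum.inl (fun n => shiftMat (n : ℕ))) ∧
    matMul T.Lbar.val.1 Wbar.val.1 = matMul Wbar.val.1 (shiftMat 1) ∧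
    matMul T.Mbar.1 Wbar.val.1 =
      matMul Wbar.val.1 (sMat ħ - timeSum Sum.inr (fun n => shiftMat (-((n : ℕ) : ℤ))))

/-! ### The compactified `c = 1` string theory -/

/-- The diagonal matrix `U(0,0)` of the compactified `c = 1` string theory with parameter `β`. -/
noncomputable def c1Matrix (ħ : ℂ) (β : ℤ) : ℤ → ℤ → ℂ := fun i j =>
  if i = j then
    (-ħ) ^ (((i : ℂ) + 1 / 2) / (β : ℂ)) *
      (Complex.Gamma (1 / 2 - 1 / ħ + ((i : ℂ) + 1 / 2) / (β : ℂ))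
        / Complex.Gamma (1 / 2 - 1 / ħ))
  else 0

/-- None of the Gamma functions in `c1Matrix ħ β` is evaluated at a pole. -/
def C1Regular (ħ : ℂ) (β : ℤ) : Prop :=
  (∀ n : ℕ, 1 / 2 - 1 / ħ ≠ -(n : ℂ)) ∧
  ∀ (i : ℤ) (n : ℕ), 1 / 2 - 1 / ħ + ((i : ℂ) + 1 / 2) / (β : ℂ) ≠ -(n : ℂ)

/-! ### The generalized Kontsevich model at `p = -1` -/

/-- The path of integration `μ = ħ λ (1 + i y)²`, `y ∈ ℝ`. It avoids `0` and joins two points at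
infinity at which `exp(ħ⁻¹ λ⁻¹ μ)` vanishes; for `ħ > 0` it is a deformation of the
steepest descent path through the saddle point `μ = λ` of `λ⁻¹ μ - log μ`. -/
noncomputable def gkmPath (ħ : ℂ) (lam y : ℝ) : ℂ :=
  ħ * (lam : ℂ) * (1 + Complex.I * (y : ℂ)) ^ 2

/-- A continuous branch of `log μ` along the path. -/
noncomputable def gkmPathLog (ħ : ℂ) (lam y : ℝ) : ℂ :=
  Complex.log ħ + (Real.log lam : ℂ) + 2 * Complex.log (1 + Complex.I * (y : ℂ))

/-- The generating functions of the model at `p = -1`,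
`u_j(λ) = c(λ) ∫ dμ μ^{-j-1} exp ħ⁻¹ (λ⁻¹ μ - log μ)` with `c(λ) = λ⁻¹ exp(ħ⁻¹ log λ)`, `λ > 0`. -/
noncomputable def gkmGen (ħ : ℂ) (j : ℤ) (lam : ℝ) : ℂ :=
  (lam : ℂ)⁻¹ * Complex.exp (ħ⁻¹ * (Real.log lam : ℂ)) *
    ∫ y : ℝ, gkmPath ħ lam y ^ (-j - 1) *
      Complex.exp (ħ⁻¹ * ((lam : ℂ)⁻¹ * gkmPath ħ lam y - gkmPathLog ħ lam y)) *
      deriv (gkmPath ħ lam) y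

/-- `u` is the matrix `U(0,0)` of the generalized Kontsevich model at `p = -1`: it is lower
triangular, and `u_j(λ) ~ ∑_{i ≥ j} λ^{-i-1} u_{ij}` as `λ → +∞`. -/
def IsGKMMatrix (ħ : ℂ) (u : ℤ → ℤ → ℂ) : Prop :=
  (∀ i j : ℤ, i < j → u i j = 0) ∧
  ∀ (j : ℤ) (K : ℕ),
    (fun lam : ℝ => gkmGen ħ j lam
        - ∑ k ∈ Finset.range K, (lam : ℂ) ^ (-(j + (k : ℤ)) - 1) * u (j + (k : ℤ)) j)
      =O[Filter.atTop] fun lam : ℝ => lam ^ (-(j + (K : ℤ)) - 1)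

/-! ### Matrix integrals -/

/-- The Hermitian `N × N` matrix with diagonal entries `x i i` and, for `i < j`, with `(i, j)` entry
`x i j + √-1 x j i`. Lebesgue measure in `x` is the measure
`∏ dM_{ii} ∏_{i<j} d(Re M_{ij}) d(Im M_{ij})`. -/
noncomputable def hermMat {N : ℕ} (x : Fin N → Fin N → ℝ) : Matrix (Fin N) (Fin N) ℂ :=
  Matrix.of fun i j =>
    if i = j then (x i i : ℂ)
    else if i < j then (x i j : ℂ) + Complex.I * (x j i : ℂ)
    else (x j i : ℂ) - Complex.I * (x i j : ℂ)

open Classical in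
/-- `Tr log A` for a Hermitian matrix `A` with positive eigenvalues. -/
noncomputable def trLog {N : ℕ} (A : Matrix (Fin N) (Fin N) ℂ) : ℝ :=
  if h : A.IsHermitian then ∑ i, Real.log (h.eigenvalues i) else 0

open scoped ComplexOrder in
/-- The parameters of the positive definite Hermitian matrices. -/
def posDefSet (N : ℕ) : Set (Fin N → Fin N → ℝ) := {x | (hermMat x).PosDef}

open scoped ComplexOrder in
/-- The parameters of the Hermitian matrices `Φ` such that `1 - Φ` is positive definite. -/
def pennerSet (N : ℕ) : Set (Fin N → Fin N → ℝ) := {x | (1 - hermMat x).PosDef}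

/-- The integrand `exp ħ⁻¹ Tr(Λ⁻¹ M - log M)` with `Λ = diag(λ₁, …, λ_N)` and `M = hermMat x`. -/
noncomputable def gkmIntegrand (ħ : ℝ) {N : ℕ} (lam : Fin N → ℝ) (x : Fin N → Fin N → ℝ) : ℝ :=
  Real.exp (ħ⁻¹ * ((Matrix.diagonal (fun i => ((lam i : ℂ))⁻¹) * hermMat x).trace.re
    - trLog (hermMat x)))

/-- The matrix integral `∫ dM exp ħ⁻¹ Tr(Λ⁻¹ M - log M)` over positive definite Hermitian `M`. -/
noncomputable def gkmIntegral (ħ : ℝ) {N : ℕ} (lam : Fin N → ℝ) : ℝ :=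
  ∫ x in posDefSet N, gkmIntegrand ħ lam x

/-- The normalization factor of the model at `p = -1`, for distinct `λᵢ`:
`C(Λ) = ∏_{i>j} (λᵢ⁻¹ - λⱼ⁻¹)/(λᵢ - λⱼ) · (det Λ)⁻¹ · exp(ħ⁻¹ Tr log Λ)`. -/
noncomputable def gkmNorm (ħ : ℝ) {N : ℕ} (lam : Fin N → ℝ) : ℝ :=
  (∏ i, ∏ j ∈ Finset.univ.filter (fun j => j < i), ((lam i)⁻¹ - (lam j)⁻¹) / (lam i - lam j))
    * (∏ i, lam i)⁻¹ * Real.exp (ħ⁻¹ * ∑ i, Real.log (lam i))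

/-- The integrand `exp(g Tr(log(1 - Φ) + Φ)) = exp(-g Tr ∑_{k ≥ 2} Φᵏ/k)` of the Penner model,
with `Φ = hermMat x`. -/
noncomputable def pennerIntegrand (g : ℝ) {N : ℕ} (x : Fin N → Fin N → ℝ) : ℝ :=
  Real.exp (g * ((hermMat x).trace.re + trLog (1 - hermMat x)))

/-- The partition function of the Penner model: the integral over the Hermitian `N × N` matrices `Φ`
with `1 - Φ` positive definite. -/
noncomputable def pennerPartition (g : ℝ) (N : ℕ) : ℝ :=
  ∫ x in pennerSet N, pennerIntegrand g x

end TodaString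

namespace TodaString

/-! ### Matrix products with few terms -/

/-! For `p = -1` and `β = -1` the two systems of string equations have equal coefficients. That no
other `β` is possible is seen from leading coefficients at vanishing times. There the first equation
of either system matches the highest shift of a power of `L`, whose coefficient is `1`, with the
lowest shift of a power of `Lbar` multiplied by an affine function of `s`, because `Mbar` is `s`
plus higher shifts. This determines the leading coefficients of `Lbar` and constrains those of
`Lbar^β`; since the two commute, `ħ² (β + 1) = 0` follows
(`IsTodaSolution.eq_neg_one_of_gkm_of_c1`).

For a diagonal invertible matrix `U(0,0)`, the evolved matrix is that diagonal matrix plus terms of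
positive weighted degree in the times, and a coefficient of degree `d` moves at most `d` places from
the diagonal. The triangular factorization is therefore a fixed point problem, contracting in the
weighted degree (`exists_factorization`); it is unique because a lower unitriangular matrix that is
also upper triangular is `1`. Differentiating `W U = Wbar` and separating the triangular parts gives
the Lax equations (`Factorization.isTodaSolution_ops`). A recursion `d (i + β) = (affine in i) * d
i` for the diagonal entries turns into an intertwining relation between `Λ^β` and `U`, which after
dressing is the pair of `c = 1` string equations (`Factorization.c1StringEqs_ops`); for the matrix
with Gamma functions the recursion is `Γ(z + 1) = z Γ(z)`.

In the Kontsevich model at `p = -1` the substitution `μ = ħ λ w²` shows that `u_j(λ)` is exactly one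
power of `λ` (`gkmGen_eq`), so its matrix is diagonal. Integration by parts gives its entries the
recursion of the `c = 1` entries at `β = -1`, so the two are proportional (`exists_gkmDiag_eq_mul`).
The factor is nonzero because on the imaginary axis the integral is a cosine times a Gamma function
(`hankelIntegral_zero`).

The matrix integral depends on the external field only through its determinant, by `M ↦ Λ^{1/2} M
Λ^{1/2}`, and `M = 1 - Φ` turns the remaining integral into the Penner model. -/

theorem formalSum_eq_single {ι : Type} (f : ι → Coeffs) (k : ι) (h : ∀ l, l ≠ k → f l = 0) :
    formalSum f = f k := by
  ext m
  rw [coeff_formalSum]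
  exact finsum_eq_single _ k fun l hl => by rw [h l hl, map_zero]

/-- The matrix of multiplication by a function of `s`. -/
noncomputable def diagMat (f : ℤ → Coeffs) : Mat := fun i j => if i = j then f i else 0

theorem diagMat_matMul (f : ℤ → Coeffs) (A : Mat) (i j : ℤ) :
    matMul (diagMat f) A i j = f i * A i j := by
  rw [matMul, formalSum_eq_single _ i fun l hl => by simp [diagMat, Ne.symm hl]]
  simp [diagMat]

theorem matMul_diagMat (f : ℤ → Coeffs) (A : Mat) (i j : ℤ) :
    matMul A (diagMat f) i j = A i j * f j := by
  rw [matMul, formalSum_eq_single _ j fun l hl => by simp [diagMat, hl]]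
  simp [diagMat]

theorem shiftMat_matMul (A : Mat) (n i j : ℤ) : matMul (shiftMat n) A i j = A (i + n) j := by
  rw [matMul, formalSum_eq_single _ (i + n) fun l hl => by simp [shiftMat, hl]]
  simp [shiftMat]

theorem matMul_shiftMat (A : Mat) (n i j : ℤ) : matMul A (shiftMat n) i j = A i (j - n) := by
  rw [matMul, formalSum_eq_single _ (j - n) fun l hl => by
    have : j ≠ l + n := by omega
    simp [shiftMat, this]]
  simp [shiftMat]

/-! ### Leading coefficients at vanishing times, and incompatibility of the string equations. -/

/-! ### Orders of difference operators -/

/-- Only the shifts `exp(n ħ ∂_s)` with `ε n ≤ a` occur in `A`. -/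
def Ord (ε : ℤˣ) (a : ℤ) (A : Mat) : Prop := ∀ i j : ℤ, a < ε * (j - i) → A i j = 0

theorem Ord.mono {ε : ℤˣ} {a b : ℤ} {A : Mat} (hA : Ord ε a A) (h : a ≤ b) : Ord ε b A :=
  fun i j hij => hA i j (by omega)

theorem Ord.matMul {ε : ℤˣ} {a b : ℤ} {A B : Mat} (hA : Ord ε a A) (hB : Ord ε b B) :
    Ord ε (a + b) (matMul A B) := by
  intro i j hij
  have : ∀ k, A i k * B k j = 0 := fun k => by
    have e : (ε : ℤ) * (j - i) = ε * (k - i) + ε * (j - k) := by ring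
    by_cases h : a < ε * (k - i)
    · rw [hA i k h, zero_mul]
    · rw [hB k j (by omega), mul_zero]
  rw [TodaString.matMul, formalSum_eq_single _ 0 fun l _ => this l, this]

theorem Ord.matMul_lead {ε : ℤˣ} {a b : ℤ} {A B : Mat} (hA : Ord ε a A) (hB : Ord ε b B)
    (i : ℤ) : TodaString.matMul A B i (i + ε * (a + b)) =
      A i (i + ε * a) * B (i + ε * a) (i + ε * (a + b)) := by
  rw [TodaString.matMul, formalSum_eq_single _ (i + ε * a)]
  intro k hk
  by_cases h : a < ε * (k - i)
  · rw [hA i k h, zero_mul]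
  · rw [hB k _ ?_, mul_zero]
    rcases Int.units_eq_one_or ε with rfl | rfl
    · simp only [Units.val_one, one_mul] at *; omega
    · simp only [Units.val_neg, Units.val_one, neg_mul, one_mul] at *; omega

/-- If the order of `X` exceeded `-a`, the product with `A` would have a nonzero leading coefficient
off the diagonal, because the leading coefficients of `A` are units. So the bound on the order of
`X` drops one step at a time, and finiteness of `N` ends the descent. -/
theorem Ord.of_matMul_eq_one {ε : ℤˣ} {a N : ℤ} {A X : Mat} (hA : Ord ε a A)
    (hu : ∀ i, IsUnit (A i (i + ε * a))) (hX : Ord ε N X) (h : TodaString.matMul X A = matOne) :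
    Ord ε (-a) X := by
  have step : ∀ b, -a ≤ b → Ord ε (b + 1) X → Ord ε b X := by
    intro b hb hb1 i j hij
    by_cases hlt : b + 1 < ε * (j - i)
    · exact hb1 i j hlt
    · have e : j = i + ε * (b + 1) := by
        rcases Int.units_eq_one_or ε with rfl | rfl
        · simp only [Units.val_one, one_mul] at *; omega
        · simp only [Units.val_neg, Units.val_one, neg_mul, one_mul] at *; omega
      have h1 := hb1.matMul_lead hA i
      have hne : i ≠ i + ε * (b + 1 + a) := by
        rcases Int.units_eq_one_or ε with rfl | rfl
        · simp only [Units.val_one, one_mul] at *; omega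
        · simp only [Units.val_neg, Units.val_one, neg_mul, one_mul] at *; omega
      rw [h, matOne, if_neg hne, mul_add (ε : ℤ) (b + 1), ← add_assoc, ← e] at h1
      exact (hu j).mul_left_eq_zero.1 h1.symm
  have key : ∀ n : ℕ, Ord ε (-a + n) X → Ord ε (-a) X := by
    intro n
    induction n with
    | zero => simp
    | succ n ih =>
      intro h
      refine ih (step _ (by omega) ?_)
      push_cast at h
      rwa [← add_assoc] at h
  exact key (N + a).toNat (hX.mono (by omega))

/-! ### Specialization at vanishing times -/

/-- The value at `t = tbar = 0`. -/
noncomputable def atZero (A : Mat) : Mat := fun i j =>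
  MvPowerSeries.C (MvPowerSeries.constantCoeff (A i j))

/-- No bandedness is needed: both sides are the same `finsum` of products of constant coefficients.
-/
theorem atZero_matMul (A B : Mat) : atZero (matMul A B) = matMul (atZero A) (atZero B) := by
  funext i j
  ext m
  simp only [atZero, matMul, coeff_formalSum, ← map_mul, MvPowerSeries.coeff_C]
  split_ifs with h
  · rw [← MvPowerSeries.coeff_zero_eq_constantCoeff_apply, coeff_formalSum]
    simp only [MvPowerSeries.coeff_zero_eq_constantCoeff_apply]
  · simp

theorem atZero_matOne : atZero matOne = matOne := by
  funext i j
  simp only [atZero, matOne]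
  split_ifs <;> simp

/-- The reason for specializing the times: a banded operator may contain ever higher shifts as the
weighted degree grows, but its constant coefficients have bounded order, so leading coefficients
make sense. -/
theorem exists_ord_atZero {ε : ℤˣ} {A : Mat} (hA : IsBanded ε A) : ∃ N, Ord ε N (atZero A) := by
  obtain ⟨N, hN⟩ := hA
  refine ⟨N, fun i j hij => ?_⟩
  by_contra h
  have := hN 0 i j fun h0 => h (by
    simp only [atZero]
    rw [← MvPowerSeries.coeff_zero_eq_constantCoeff_apply, h0, map_zero])
  simp only [map_zero, Nat.cast_zero, add_zero] at this
  omega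

theorem Op.coe_mul {ε : ℤˣ} (A B : Op ε) : (A * B).1 = matMul A.1 B.1 := rfl

theorem Op.coe_one {ε : ℤˣ} : (1 : Op ε).1 = matOne := rfl

theorem ord_one (ε : ℤˣ) : Ord ε 0 matOne := by
  intro i j h
  rw [matOne, if_neg]
  rintro rfl
  simp at h

theorem ord_atZero_pow {ε : ℤˣ} {a : ℤ} {A : Op ε} (hA : Ord ε a (atZero A.1)) (n : ℕ) :
    Ord ε (n * a) (atZero (A ^ n).1) := by
  induction n with
  | zero => simpa [Op.coe_one, atZero_matOne] using ord_one ε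
  | succ n ih =>
    rw [pow_succ, Op.coe_mul, atZero_matMul]
    refine (ih.matMul hA).mono (le_of_eq ?_)
    push_cast; ring

/-- The value at `t = tbar = 0` of the coefficient of `exp(n ħ ∂_s)` in `Aⁿ`. -/
noncomputable def leadCoeff {ε : ℤˣ} (A : (Op ε)ˣ) (n i : ℤ) : ℂ :=
  MvPowerSeries.constantCoeff ((A ^ n : (Op ε)ˣ).val.1 i (i + n))

theorem ord_atZero_zpow {ε : ℤˣ} {A : (Op ε)ˣ} (hA : Ord ε ε (atZero A.val.1))
    (hu : ∀ i, MvPowerSeries.constantCoeff (A.val.1 i (i + 1)) ≠ 0) (n : ℤ) :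
    Ord ε (n * ε) (atZero (A ^ n : (Op ε)ˣ).val.1) := by
  have hinv : Ord ε (-ε) (atZero (A⁻¹ : (Op ε)ˣ).val.1) := by
    obtain ⟨N, hN⟩ := exists_ord_atZero (A⁻¹ : (Op ε)ˣ).val.2
    refine hA.of_matMul_eq_one (fun i => ?_) hN ?_
    · rw [← Units.val_mul, ← sq, Int.units_sq]
      exact (MvPowerSeries.C (σ := Time)).isUnit_map (isUnit_iff_ne_zero.2 (hu i))
    · rw [← atZero_matMul, ← Op.coe_mul, Units.inv_mul, Op.coe_one, atZero_matOne]
  rcases n with n | n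
  · simpa using ord_atZero_pow hA n
  · have := ord_atZero_pow hinv (n + 1)
    rw [zpow_negSucc, ← inv_pow, Units.val_pow_eq_pow_val]
    refine this.mono (le_of_eq ?_)
    rw [Int.negSucc_eq]; push_cast; ring

/-- Cocycle rule: leading coefficients multiply, the second one evaluated at a point moved by the
first shift. It holds for negative powers too, since the inverse also has the expected order. -/
theorem leadCoeff_add {ε : ℤˣ} {A : (Op ε)ˣ} (hA : Ord ε ε (atZero A.val.1))
    (hu : ∀ i, MvPowerSeries.constantCoeff (A.val.1 i (i + 1)) ≠ 0) (a b i : ℤ) :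
    leadCoeff A (a + b) i = leadCoeff A a i * leadCoeff A b (i + a) := by
  have h := (ord_atZero_zpow hA hu a).matMul_lead (ord_atZero_zpow hA hu b) i
  have e : ∀ n : ℤ, (ε : ℤ) * (n * ε) = n := fun n => by
    rw [mul_comm, mul_assoc, ← Units.val_mul, ← sq, Int.units_sq]; simp
  rw [← add_mul, e, e, ← atZero_matMul, ← Op.coe_mul, ← Units.val_mul, ← zpow_add] at h
  simp only [atZero, ← map_mul] at h
  have := congrArg MvPowerSeries.constantCoeff h
  simpa [leadCoeff, add_assoc] using this

theorem leadCoeff_zero {ε : ℤˣ} (A : (Op ε)ˣ) (i : ℤ) : leadCoeff A 0 i = 1 := by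
  simp [leadCoeff, Op.coe_one, matOne]

theorem leadCoeff_one {ε : ℤˣ} (A : (Op ε)ˣ) (i : ℤ) :
    leadCoeff A 1 i = MvPowerSeries.constantCoeff (A.val.1 i (i + 1)) := by
  simp [leadCoeff]

theorem leadCoeff_eq_one {ε : ℤˣ} {A : (Op ε)ˣ} (hA : Ord ε ε (atZero A.val.1))
    (hu : ∀ i, A.val.1 i (i + 1) = 1) (n i : ℤ) : leadCoeff A n i = 1 := by
  have hu' : ∀ i, MvPowerSeries.constantCoeff (A.val.1 i (i + 1)) ≠ 0 := fun i => by simp [hu i]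
  have h1 : ∀ i, leadCoeff A 1 i = 1 := fun i => by simp [leadCoeff_one, hu i]
  induction n using Int.induction_on with
  | zero => exact leadCoeff_zero A i
  | succ n ih => rw [leadCoeff_add hA hu', ih, h1, one_mul]
  | pred n ih =>
    have := leadCoeff_add hA hu' (-n - 1) 1 i
    rwa [h1, mul_one, sub_add_cancel, ih, eq_comm] at this

/-! ### Comparison of the string equations -/

theorem gkmStringEqs_neg_one_iff (ħ : ℂ) (T : TodaOps) : GKMStringEqs ħ (-1) T ↔
    (T.Lpow (-1)).1 = (T.Mbar * T.Lbarpow (-1) + T.Lbarpow (-1)).1 ∧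
    (T.Lbarpow 1).1 = (T.M * T.Lpow 1 + ħ • T.Lpow 1 + T.Lpow 1).1 := by
  have h : ((-1 : ℂ) - 1) / -2 = 1 := by norm_num
  simp [GKMStringEqs, h]

/-- For `β = -1` one has `-1/β = 1`, `(β + 1)/(2β) = 0` and `(β - 1)/(2β) = 1`, so the equations
agree term by term. -/
theorem gkmStringEqs_iff_c1StringEqs (ħ : ℂ) (T : TodaOps) :
    GKMStringEqs ħ (-1) T ↔ C1StringEqs ħ (-1) T := by
  have h : ((-1 : ℂ) - 1) / -2 = 1 := by norm_num
  rw [gkmStringEqs_neg_one_iff]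
  simp [C1StringEqs, h, add_mul]

theorem constantCoeff_formalSum {ι : Type} (f : ι → Coeffs)
    (h : ∀ k, MvPowerSeries.constantCoeff (f k) = 0) :
    MvPowerSeries.constantCoeff (formalSum f) = 0 := by
  rw [← MvPowerSeries.coeff_zero_eq_constantCoeff_apply, coeff_formalSum]
  simp [h]

section
variable {ħ : ℂ} {T : TodaOps}

theorem IsTodaSolution.ord_L (h : IsTodaSolution ħ T) : Ord 1 1 (atZero T.L.val.1) := by
  intro i j hij
  have := h.L_zero i j (by simp at hij; omega)
  simp only [TodaOps.Lpow, zpow_one] at this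
  simp [atZero, this]

theorem IsTodaSolution.ord_Lbar (h : IsTodaSolution ħ T) :
    Ord (-1) (-1) (atZero T.Lbar.val.1) := by
  intro i j hij
  have := h.Lbar_zero i j (by simp at hij; omega)
  simp only [TodaOps.Lbarpow, zpow_one] at this
  simp [atZero, this]

theorem IsTodaSolution.lead_L (h : IsTodaSolution ħ T) (i : ℤ) : T.L.val.1 i (i + 1) = 1 := by
  simpa [TodaOps.Lpow] using h.L_lead i

theorem IsTodaSolution.lead_Lbar (h : IsTodaSolution ħ T) (i : ℤ) :
    MvPowerSeries.constantCoeff (T.Lbar.val.1 i (i + 1)) ≠ 0 := by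
  have := h.Lbar_lead i
  simp only [TodaOps.Lbarpow, zpow_one] at this
  exact ((MvPowerSeries.constantCoeff).isUnit_map this).ne_zero

/-- At vanishing times `Mbar` is `s` plus higher order terms. -/
theorem IsTodaSolution.constantCoeff_Mbar (h : IsTodaSolution ħ T) {i j : ℤ} (hij : j ≤ i) :
    MvPowerSeries.constantCoeff (T.Mbar.1 i j) = if i = j then ħ * i else 0 := by
  obtain ⟨v, hv⟩ := h.Mbar_form
  have h1 : MvPowerSeries.constantCoeff
      (timeSum Sum.inr (fun n => (T.Lbarpow (-((n : ℕ) : ℤ))).1) i j) = 0 :=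
    constantCoeff_formalSum _ fun n => by
      rw [← MvPowerSeries.coeff_zero_eq_constantCoeff_apply, map_smul,
        MvPowerSeries.coeff_zero_eq_constantCoeff_apply]
      simp
  -- At vanishing times `Lbarⁿ` with `n ≥ 1` lives strictly above the diagonal, so these terms do
  -- not reach the entries with `j ≤ i`.
  have h2 : MvPowerSeries.constantCoeff
      (coeffSum v (fun n => (T.Lbarpow (n : ℕ)).1) i j) = 0 :=
    constantCoeff_formalSum _ fun n => by
      have h3 := ord_atZero_zpow h.ord_Lbar h.lead_Lbar (n : ℕ) i j (by
        have := n.pos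
        simp; omega)
      have h4 : MvPowerSeries.constantCoeff ((T.Lbarpow (n : ℕ)).1 i j) = 0 := by
        have := congrArg MvPowerSeries.constantCoeff h3
        simpa [atZero, TodaOps.Lbarpow] using this
      rw [map_mul, h4, mul_zero]
  rw [hv]
  simp only [Pi.add_apply, Pi.neg_apply, map_add, map_neg, h1, h2, sMat]
  split_ifs <;> simp

/-- Lowest order coefficients of `(x Mbar + y) Lbarⁿ` at vanishing times. -/
theorem IsTodaSolution.constantCoeff_mul_Lbarpow (h : IsTodaSolution ħ T) (x y : ℂ) (n i : ℤ) :
    MvPowerSeries.constantCoeff (((x • T.Mbar + y • (1 : AscOp)) * T.Lbarpow n).1 i (i + n)) =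
      (x * (ħ * i) + y) * leadCoeff T.Lbar n i := by
  have hM : ∀ i j : ℤ, j ≤ i → atZero (x • T.Mbar + y • (1 : AscOp)).1 i j =
      if i = j then MvPowerSeries.C (x * (ħ * i) + y) else 0 := by
    intro i j hij
    have : MvPowerSeries.constantCoeff ((x • T.Mbar + y • (1 : AscOp)).1 i j) =
        x * (if i = j then ħ * i else 0) + y * (if i = j then 1 else 0) := by
      rw [← h.constantCoeff_Mbar hij]
      change MvPowerSeries.constantCoeff (x • T.Mbar.1 i j + y • matOne i j) = _
      rw [map_add, MvPowerSeries.smul_eq_C_mul, MvPowerSeries.smul_eq_C_mul]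
      simp only [matOne]
      split_ifs <;> simp
    simp only [atZero, this]
    split_ifs <;> simp
  have hord : Ord (-1) 0 (atZero (x • T.Mbar + y • (1 : AscOp)).1) := by
    intro i j hij
    simp only [Units.val_neg, Units.val_one, neg_mul, one_mul] at hij
    rw [hM i j (by omega), if_neg (by omega)]
  have h1 := hord.matMul_lead (ord_atZero_zpow h.ord_Lbar h.lead_Lbar n) i
  rw [← atZero_matMul, mul_zero, add_zero, hM i i le_rfl, if_pos rfl] at h1
  have h2 := congrArg MvPowerSeries.constantCoeff h1
  have e : i + ((-1 : ℤˣ) : ℤ) * (0 + n * ((-1 : ℤˣ) : ℤ)) = i + n := by simp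
  rw [e] at h2
  simpa [atZero, leadCoeff, TodaOps.Lbarpow, Op.coe_mul] using h2

/-- Entry `(i, i - 1)` of the first equation: it is the top coefficient of the descending operator
`L⁻¹`, namely `1`, and the bottom coefficient of the ascending right-hand side. The `c = 1` case
below compares entry `(i, i + β)` in the same way. -/
theorem IsTodaSolution.leadCoeff_of_gkm (h : IsTodaSolution ħ T) (hG : GKMStringEqs ħ (-1) T)
    (i : ℤ) : (ħ * i + 1) * leadCoeff T.Lbar (-1) i = 1 := by
  have h1 := ((gkmStringEqs_neg_one_iff ħ T).1 hG).1
  have h2 := h.constantCoeff_mul_Lbarpow 1 1 (-1) i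
  have e : ((1 : ℂ) • T.Mbar + (1 : ℂ) • (1 : AscOp)) * T.Lbarpow (-1) =
      T.Mbar * T.Lbarpow (-1) + T.Lbarpow (-1) := by
    rw [one_smul, one_smul, add_mul, one_mul]
  rw [e, ← h1, one_mul] at h2
  rw [← h2]
  exact leadCoeff_eq_one h.ord_L h.lead_L (-1) i

theorem IsTodaSolution.leadCoeff_of_c1 (h : IsTodaSolution ħ T) {β : ℤ}
    (hC : C1StringEqs ħ β T) (i : ℤ) :
    (-(1 / (β : ℂ)) * (ħ * i) + (1 - ħ * (((β : ℂ) + 1) / (2 * (β : ℂ))))) *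
      leadCoeff T.Lbar β i = 1 := by
  rw [← h.constantCoeff_mul_Lbarpow]
  have e : (-(1 / (β : ℂ))) • T.Mbar + (1 - ħ * (((β : ℂ) + 1) / (2 * (β : ℂ)))) • (1 : AscOp) =
      (-(1 / (β : ℂ))) • T.Mbar - (ħ * (((β : ℂ) + 1) / (2 * (β : ℂ)))) • (1 : AscOp) + 1 := by
    rw [sub_smul, one_smul]; abel
  rw [e, ← hC.1]
  exact leadCoeff_eq_one h.ord_L h.lead_L β i

/-- A solution of the Toda lattice hierarchy that satisfies the string equations of the generalized
Kontsevich model at `p = -1` and those of the `c = 1` string theory has `β = -1`. -/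
theorem IsTodaSolution.eq_neg_one_of_gkm_of_c1 (hħ : ħ ≠ 0) (h : IsTodaSolution ħ T) {β : ℤ}
    (hβ : β ≠ 0) (hG : GKMStringEqs ħ (-1) T) (hC : C1StringEqs ħ β T) : β = -1 := by
  set f : ℤ → ℂ := fun i => -(1 / (β : ℂ)) * (ħ * i) + (1 - ħ * (((β : ℂ) + 1) / (2 * (β : ℂ))))
    with hf
  have hfl : ∀ i, f i * leadCoeff T.Lbar β i = 1 := h.leadCoeff_of_c1 hC
  -- The leading coefficient of `Lbar` is the inverse of that of `Lbar⁻¹`, at a point moved by one.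
  have hp : ∀ i : ℤ, leadCoeff T.Lbar 1 i = ħ * (i + 1) + 1 := by
    intro i
    have h1 := h.leadCoeff_of_gkm hG (i + 1)
    have h2 := leadCoeff_add h.ord_Lbar h.lead_Lbar (-1) 1 (i + 1)
    rw [neg_add_cancel, leadCoeff_zero, add_neg_cancel_right] at h2
    push_cast at h1
    have h3 : leadCoeff T.Lbar (-1) (i + 1) ≠ 0 := right_ne_zero_of_mul_eq_one h1
    exact mul_left_cancel₀ h3 (by rw [← h2, mul_comm, h1])
  -- The two ways of splitting `Lbar^(β + 1)`, with the coefficients of `Lbar^β` eliminated through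
  -- `f`.
  have key : ∀ i : ℤ, leadCoeff T.Lbar 1 (i + β) * f (i + 1) = leadCoeff T.Lbar 1 i * f i := by
    intro i
    have h1 := leadCoeff_add h.ord_Lbar h.lead_Lbar β 1 i
    have h2 := leadCoeff_add h.ord_Lbar h.lead_Lbar 1 β i
    rw [add_comm 1 β, h1] at h2
    have h3 := hfl i
    have h4 := hfl (i + 1)
    linear_combination (-leadCoeff T.Lbar 1 (i + β) * f (i + 1)) * h3 + f i * f (i + 1) * h2
      + leadCoeff T.Lbar 1 i * f i * h4
  have k0 := key 0
  have k1 := key 1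
  have hβ' : (β : ℂ) ≠ 0 := Int.cast_ne_zero.2 hβ
  simp only [hp, hf] at k0 k1
  push_cast at k0 k1
  -- In `key` the quadratic terms in `i` cancel; the coefficient of `i` is `-(ħ²/β)(β + 1)`,
  -- isolated by subtracting the cases `i = 0` and `i = 1`.
  have h5 : ħ ^ 2 * ((β : ℂ) + 1) = 0 := by
    field_simp at k0 k1
    have : (2 : ℂ) * (ħ ^ 2 * (β + 1)) = 0 := by linear_combination k0 - k1
    simpa using this
  have h6 : (β : ℂ) + 1 = 0 := by simpa [hħ] using h5
  have h7 : ((β + 1 : ℤ) : ℂ) = 0 := by push_cast; exact h6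
  have := Int.cast_eq_zero.1 h7
  omega

end

/-! ### The triangular factorization and the solution of the hierarchy that it determines. -/

/-! ### Two-sided banded operators -/

/-- The algebra of the difference operators that are banded on both sides. -/
noncomputable def biOp : Subalgebra ℂ DescOp where
  carrier := {A | IsBanded (-1) A.1}
  mul_mem' := fun ha hb => IsBanded.mul ha hb
  add_mem' := fun ha hb => (bandedSubmodule (-1)).add_mem ha hb
  algebraMap_mem' := fun c => by
    rw [Algebra.algebraMap_eq_smul_one]
    exact (bandedSubmodule (-1)).smul_mem c (isBanded_one (-1))

/-- `W` belongs to the descending operators and `Wbar` to the ascending ones, and these algebras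
have no common product. For a diagonal initial matrix everything is banded on both sides, so the
computations take place in this ring and are then transported by `toDesc` and `toAsc`. -/
abbrev BiOp : Type := biOp

namespace BiOp

/-- The underlying matrix. -/
noncomputable def mat (A : BiOp) : Mat := A.1.1

noncomputable def ofMat (A : Mat) (h : ∀ ε, IsBanded ε A) : BiOp := ⟨⟨A, h 1⟩, h (-1)⟩

@[simp] theorem mat_ofMat (A : Mat) (h : ∀ ε, IsBanded ε A) : (ofMat A h).mat = A := rfl

theorem isBanded (A : BiOp) (ε : ℤˣ) : IsBanded ε A.mat := by
  rcases Int.units_eq_one_or ε with rfl | rfl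
  exacts [A.1.2, A.2]

theorem ext {A B : BiOp} (h : A.mat = B.mat) : A = B := Subtype.ext (Subtype.ext h)

@[simp] theorem mat_mul (A B : BiOp) : (A * B).mat = matMul A.mat B.mat := rfl
@[simp] theorem mat_add (A B : BiOp) : (A + B).mat = A.mat + B.mat := rfl
@[simp] theorem mat_sub (A B : BiOp) : (A - B).mat = A.mat - B.mat := rfl
@[simp] theorem mat_neg (A : BiOp) : (-A).mat = -A.mat := rfl
@[simp] theorem mat_one : (1 : BiOp).mat = matOne := rfl
@[simp] theorem mat_zero : (0 : BiOp).mat = 0 := rfl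

noncomputable def toDesc : BiOp →ₐ[ℂ] DescOp := biOp.val

noncomputable def toAsc : BiOp →ₐ[ℂ] AscOp :=
  AlgHom.ofLinearMap
    { toFun := fun A => ⟨A.mat, A.isBanded (-1)⟩
      map_add' := fun _ _ => rfl
      map_smul' := fun _ _ => rfl } rfl fun _ _ => rfl

@[simp] theorem toDesc_val (A : BiOp) : (toDesc A).1 = A.mat := rfl
@[simp] theorem toAsc_val (A : BiOp) : (toAsc A).1 = A.mat := rfl

end BiOp

/-! ### Approximation in the weighted degree -/

/-- The coefficients of weighted degree `d` occur only for the shifts `exp(n ħ ∂_s)` with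
`|n| ≤ d`, and the matrix is supported on `S`. -/
def Tight (S : ℤ → ℤ → Prop) (A : Mat) : Prop :=
  ∀ (m : Time →₀ ℕ) (i j : ℤ), MvPowerSeries.coeff m (A i j) ≠ 0 → |j - i| ≤ wt m ∧ S i j

theorem Tight.mono {S S' : ℤ → ℤ → Prop} {A : Mat} (hA : Tight S A) (h : ∀ i j, S i j → S' i j) :
    Tight S' A := fun m i j hm => ⟨(hA m i j hm).1, h _ _ (hA m i j hm).2⟩

theorem Tight.isBanded {S : ℤ → ℤ → Prop} {A : Mat} (hA : Tight S A) (ε : ℤˣ) :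
    IsBanded ε A := by
  refine ⟨0, fun m i j h => ?_⟩
  have := (hA m i j h).1
  rw [abs_le] at this
  rcases Int.units_eq_one_or ε with rfl | rfl
  · simp only [Units.val_one, one_mul]; omega
  · simp only [Units.val_neg, Units.val_one, neg_mul, one_mul]; omega

theorem Tight.eq_zero {S : ℤ → ℤ → Prop} {A : Mat} (hA : Tight S A) {i j : ℤ} (h : ¬ S i j) :
    A i j = 0 := by
  ext m
  by_contra hm
  exact h (hA m i j hm).2

theorem Tight.add {S : ℤ → ℤ → Prop} {A B : Mat} (hA : Tight S A) (hB : Tight S B) :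
    Tight S (A + B) := by
  intro m i j h
  by_cases h1 : MvPowerSeries.coeff m (A i j) = 0
  · exact hB m i j fun h2 => h (by simp [h1, h2])
  · exact hA m i j h1

theorem Tight.neg {S : ℤ → ℤ → Prop} {A : Mat} (hA : Tight S A) : Tight S (-A) :=
  fun m i j h => hA m i j fun h0 => h (by simp [h0])

theorem Tight.sub {S : ℤ → ℤ → Prop} {A B : Mat} (hA : Tight S A) (hB : Tight S B) :
    Tight S (A - B) := by
  rw [sub_eq_add_neg]
  exact hA.add hB.neg

theorem Tight.negPart {S : ℤ → ℤ → Prop} {A : Mat} (hA : Tight S A) :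
    Tight (fun i j => j < i) (negPart A) := by
  intro m i j h
  by_cases hij : j < i
  · simp only [TodaString.negPart, if_pos hij] at h
    exact ⟨(hA m i j h).1, hij⟩
  · simp [TodaString.negPart, hij] at h

/-- Weights and shifts are both additive under products. Transitivity of `S` is what lets the same
statement serve full, lower and upper triangular matrices. -/
theorem Tight.mul {S : ℤ → ℤ → Prop} (hS : ∀ i j k, S i j → S j k → S i k) {A B : Mat}
    (hA : Tight S A) (hB : Tight S B) : Tight S (matMul A B) := by
  intro m i j h
  obtain ⟨k, hk⟩ : ∃ k, MvPowerSeries.coeff m (A i k * B k j) ≠ 0 := by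
    by_contra! hk
    exact h (by simp [matMul, coeff_formalSum, hk])
  obtain ⟨p, q, rfl, hp, hq⟩ := exists_of_coeff_mul_ne_zero hk
  have h1 := hA _ _ _ hp
  have h2 := hB _ _ _ hq
  refine ⟨?_, hS _ _ _ h1.2 h2.2⟩
  have h3 := h1.1
  have h4 := h2.1
  rw [map_add]
  push_cast
  rw [abs_le] at *
  omega

theorem tight_diagMat (f : ℤ → Coeffs) : Tight Eq (diagMat f) := by
  intro m i j h
  by_cases hij : i = j
  · subst hij; simp
  · simp [diagMat, hij] at h

theorem tight_one : Tight Eq matOne := tight_diagMat 1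

/-- Equality of all the coefficients of weighted degree less than `k`. -/
def EqMod (k : ℕ) (A B : Mat) : Prop :=
  ∀ m : Time →₀ ℕ, wt m < k → ∀ i j : ℤ,
    MvPowerSeries.coeff m (A i j) = MvPowerSeries.coeff m (B i j)

theorem EqMod.refl (k : ℕ) (A : Mat) : EqMod k A A := fun _ _ _ _ => rfl

theorem EqMod.symm {k : ℕ} {A B : Mat} (h : EqMod k A B) : EqMod k B A :=
  fun m hm i j => (h m hm i j).symm

theorem EqMod.trans {k : ℕ} {A B C : Mat} (h : EqMod k A B) (h' : EqMod k B C) : EqMod k A C :=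
  fun m hm i j => (h m hm i j).trans (h' m hm i j)

theorem EqMod.mono {k l : ℕ} {A B : Mat} (h : EqMod k A B) (hl : l ≤ k) : EqMod l A B :=
  fun m hm i j => h m (by omega) i j

theorem EqMod.add {k : ℕ} {A A' B B' : Mat} (h : EqMod k A A') (h' : EqMod k B B') :
    EqMod k (A + B) (A' + B') := fun m hm i j => by
  simp only [Pi.add_apply, map_add, h m hm i j, h' m hm i j]

theorem EqMod.neg {k : ℕ} {A A' : Mat} (h : EqMod k A A') : EqMod k (-A) (-A') :=
  fun m hm i j => by simp only [Pi.neg_apply, map_neg, h m hm i j]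

theorem EqMod.sub {k : ℕ} {A A' B B' : Mat} (h : EqMod k A A') (h' : EqMod k B B') :
    EqMod k (A - B) (A' - B') := by
  rw [sub_eq_add_neg, sub_eq_add_neg]
  exact h.add h'.neg

theorem EqMod.negPart {k : ℕ} {A A' : Mat} (h : EqMod k A A') :
    EqMod k (negPart A) (negPart A') := fun m hm i j => by
  simp only [TodaString.negPart]
  split_ifs
  exacts [h m hm i j, rfl]

theorem EqMod.matMul {k : ℕ} {A A' B B' : Mat} (h : EqMod k A A') (h' : EqMod k B B') :
    EqMod k (matMul A B) (matMul A' B') := by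
  intro m hm i j
  simp only [TodaString.matMul, coeff_formalSum, MvPowerSeries.coeff_mul]
  refine finsum_congr fun l => Finset.sum_congr rfl fun p hp => ?_
  have e : wt p.1 + wt p.2 = wt m := by
    rw [← map_add, Finset.HasAntidiagonal.mem_antidiagonal.1 hp]
  rw [h p.1 (by omega), h' p.2 (by omega)]

/-- A factor without constant term raises the weight by at least one. This is the source of all
contractions below. -/
theorem EqMod.matMul_succ {k : ℕ} {A A' N : Mat} (h : EqMod k A A') (hN : EqMod 1 N 0) :
    EqMod (k + 1) (TodaString.matMul A N) (TodaString.matMul A' N) := by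
  intro m hm i j
  simp only [TodaString.matMul, coeff_formalSum, MvPowerSeries.coeff_mul]
  refine finsum_congr fun l => Finset.sum_congr rfl fun p hp => ?_
  have e : wt p.1 + wt p.2 = wt m := by
    rw [← map_add, Finset.HasAntidiagonal.mem_antidiagonal.1 hp]
  by_cases h0 : wt p.2 < 1
  · simp [hN p.2 h0 l j]
  · rw [h p.1 (by omega)]

theorem EqMod.succ_matMul {k : ℕ} {A A' N : Mat} (h : EqMod k A A') (hN : EqMod 1 N 0) :
    EqMod (k + 1) (TodaString.matMul N A) (TodaString.matMul N A') := by
  intro m hm i j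
  simp only [TodaString.matMul, coeff_formalSum, MvPowerSeries.coeff_mul]
  refine finsum_congr fun l => Finset.sum_congr rfl fun p hp => ?_
  have e : wt p.1 + wt p.2 = wt m := by
    rw [← map_add, Finset.HasAntidiagonal.mem_antidiagonal.1 hp]
  by_cases h0 : wt p.1 < 1
  · simp [hN p.1 h0 i l]
  · rw [h p.2 (by omega)]

theorem eq_of_eqMod {A B : Mat} (h : ∀ k, EqMod k A B) : A = B := by
  funext i j
  ext m
  exact h (wt m + 1) m (Nat.lt_succ_self _) i j

/-- Maps that are contracting with respect to the weighted degree have fixed points. -/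
theorem exists_fixedPoint {S : ℤ → ℤ → Prop} (F : Mat → Mat)
    (hF : ∀ A, Tight S A → Tight S (F A))
    (hc : ∀ k A B, EqMod k A B → EqMod (k + 1) (F A) (F B)) : ∃ A, Tight S A ∧ F A = A := by
  have h1 : ∀ n, EqMod n (F^[n] 0) (F^[n + 1] 0) := by
    intro n
    induction n with
    | zero => intro m hm; omega
    | succ n ih =>
      rw [Function.iterate_succ_apply', Function.iterate_succ_apply' F (n + 1)]
      exact hc n _ _ ih
  have h2 : ∀ n k, EqMod n (F^[n] 0) (F^[n + k] 0) := by
    intro n k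
    induction k with
    | zero => exact EqMod.refl _ _
    | succ k ih => exact ih.trans ((h1 (n + k)).mono (by omega))
  have h3 : ∀ n, Tight S (F^[n] 0) := by
    intro n
    induction n with
    | zero => intro m i j h; simp at h
    | succ n ih => rw [Function.iterate_succ_apply']; exact hF _ ih
  -- Coefficients of weight `d` no longer change after `d + 1` iterations.
  let A : Mat := fun i j m => MvPowerSeries.coeff m (F^[wt m + 1] 0 i j)
  have h4 : ∀ n, EqMod n A (F^[n] 0) := by
    intro n m hm i j
    have := h2 (wt m + 1) (n - (wt m + 1)) m (Nat.lt_succ_self _) i j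
    rwa [Nat.add_sub_cancel' hm] at this
  refine ⟨A, fun m i j h => h3 (wt m + 1) m i j h, eq_of_eqMod fun k => ?_⟩
  refine EqMod.mono (k := k + 1) ?_ (Nat.le_succ k)
  have := hc k _ _ (h4 k)
  rw [← Function.iterate_succ_apply' F k] at this
  exact this.trans (h4 (k + 1)).symm

/-- Neumann series for `1 + N` in the form of the fixed point equations `X = 1 - X N` and `Y = 1 - N
Y`: a left and a right inverse, hence equal. The fixed point has the support `S`, so inverses of
triangular operators are triangular. -/
theorem BiOp.exists_unit_of_eqMod_one {S : ℤ → ℤ → Prop} (hS : ∀ i j k, S i j → S j k → S i k)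
    (hS' : ∀ i, S i i) {A : BiOp} (hA : Tight S A.mat) (h1 : EqMod 1 A.mat matOne) :
    ∃ X : BiOpˣ, X.val = A ∧ Tight S (X⁻¹).val.mat := by
  have hone : Tight S matOne := tight_one.mono fun i j h => h ▸ hS' i
  set N : BiOp := A - 1 with hN
  have hNt : Tight S N.mat := hA.sub hone
  have hN1 : EqMod 1 N.mat 0 := by
    have := h1.sub (EqMod.refl 1 matOne)
    rwa [sub_self] at this
  obtain ⟨X, hX, hXf⟩ := exists_fixedPoint (S := S) (fun X => matOne - matMul X N.mat)
    (fun X hX => hone.sub (hX.mul hS hNt))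
    (fun k X Y h => (EqMod.refl _ _).sub (h.matMul_succ hN1))
  obtain ⟨Y, hY, hYf⟩ := exists_fixedPoint (S := S) (fun X => matOne - matMul N.mat X)
    (fun X hX => hone.sub (hNt.mul hS hX))
    (fun k X Y h => (EqMod.refl _ _).sub (h.succ_matMul hN1))
  have eX : 1 - ofMat X hX.isBanded * N = ofMat X hX.isBanded := ext hXf
  have eY : 1 - N * ofMat Y hY.isBanded = ofMat Y hY.isBanded := ext hYf
  have hAN : A = 1 + N := by rw [hN]; abel
  have hXA : ofMat X hX.isBanded * A = 1 := by
    rw [hAN, mul_add, mul_one]; exact sub_eq_iff_eq_add.1 eX ▸ rfl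
  have hAY : A * ofMat Y hY.isBanded = 1 := by
    rw [hAN, add_mul, one_mul]; exact sub_eq_iff_eq_add.1 eY ▸ rfl
  have hXY : ofMat X hX.isBanded = ofMat Y hY.isBanded := left_inv_eq_right_inv hXA hAY
  exact ⟨⟨A, ofMat X hX.isBanded, hXY ▸ hAY, hXA⟩, rfl, hX⟩

/-! ### The evolution of a diagonal matrix -/

theorem wt_eq (m : Time →₀ ℕ) : wt m = wtT m + wtTbar m := by
  simp only [wt, wtT, wtTbar, Finsupp.weight_apply, Finsupp.sum, ← Finset.sum_add_distrib]
  refine Finset.sum_congr rfl fun x _ => ?_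
  rcases x with n | n <;> simp

theorem eq_zero_of_wt_lt_one {m : Time →₀ ℕ} (h : wt m < 1) : m = 0 := by
  have h0 : wt m = 0 := by omega
  simp only [wt, Finsupp.weight_apply, Finsupp.sum, Finset.sum_eq_zero_iff] at h0
  ext x
  by_contra hx
  have := h0 x (Finsupp.mem_support_iff.2 hx)
  rcases x with n | n <;> simp_all

/-- The diagonal matrix with the given entries. -/
noncomputable def diagFun (d : ℤ → ℂ) : ℤ → ℤ → ℂ := fun i j => if i = j then d i else 0

theorem coeff_evolve (ħ : ℂ) (u : ℤ → ℤ → ℂ) (m : Time →₀ ℕ) (i j : ℤ) :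
    MvPowerSeries.coeff m (evolve ħ u i j) =
      (m.prod fun x k => (Sum.elim (fun _ => ħ⁻¹) (fun _ => -ħ⁻¹) x : ℂ) ^ k / (k.factorial : ℂ))
        * u (i + (wtT m : ℤ)) (j + (wtTbar m : ℤ)) := rfl

/-- A nonzero coefficient of a monomial forces `j - i = wtT m - wtTbar m`, whose absolute value is
at most `wt m`. -/
theorem tight_evolve (ħ : ℂ) (d : ℤ → ℂ) : Tight (fun _ _ => True) (evolve ħ (diagFun d)) := by
  intro m i j h
  have h1 : diagFun d (i + (wtT m : ℤ)) (j + (wtTbar m : ℤ)) ≠ 0 := fun h0 => h (by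
    rw [coeff_evolve, h0, mul_zero])
  simp only [diagFun, ne_eq, ite_eq_right_iff, not_forall] at h1
  obtain ⟨e, -⟩ := h1
  rw [wt_eq, abs_le]
  push_cast
  exact ⟨by omega, trivial⟩

/-- Constant invertible diagonal matrices. -/
noncomputable def diagUnit (d : ℤ → ℂ) (hd : ∀ i, d i ≠ 0) : BiOpˣ where
  val := BiOp.ofMat _ (tight_diagMat fun i => MvPowerSeries.C (d i)).isBanded
  inv := BiOp.ofMat _ (tight_diagMat fun i => MvPowerSeries.C (d i)⁻¹).isBanded
  val_inv := BiOp.ext (by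
    funext i j
    simp only [BiOp.mat_mul, BiOp.mat_ofMat, diagMat_matMul, BiOp.mat_one]
    simp only [diagMat, matOne]
    split_ifs
    · rw [← map_mul, mul_inv_cancel₀ (hd i), map_one]
    · rw [mul_zero])
  inv_val := BiOp.ext (by
    funext i j
    simp only [BiOp.mat_mul, BiOp.mat_ofMat, diagMat_matMul, BiOp.mat_one]
    simp only [diagMat, matOne]
    split_ifs
    · rw [← map_mul, inv_mul_cancel₀ (hd i), map_one]
    · rw [mul_zero])

theorem ord_of_tight_le {A : Mat} (h : Tight (fun i j => j ≤ i) A) : Ord 1 0 A :=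
  fun i j hij => h.eq_zero (by simp at hij; omega)

theorem ord_of_tight_ge {A : Mat} (h : Tight (fun i j => i ≤ j) A) : Ord (-1) 0 A :=
  fun i j hij => h.eq_zero (by simp at hij; omega)

theorem Ord.matMul_diag {ε : ℤˣ} {A B : Mat} (hA : Ord ε 0 A) (hB : Ord ε 0 B) (i : ℤ) :
    TodaString.matMul A B i i = A i i * B i i := by
  have := hA.matMul_lead hB i
  simpa using this

/-- The triangular factorization of the evolution of an invertible diagonal matrix. -/
structure Factorization (ħ : ℂ) (u : ℤ → ℤ → ℂ) where
  U : BiOpˣ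
  W : BiOpˣ
  Wbar : BiOpˣ
  U_mat : U.val.mat = evolve ħ u
  W_mul_U : W * U = Wbar
  W_lower : Ord 1 0 W.val.mat
  W_inv_lower : Ord 1 0 (W⁻¹).val.mat
  W_diag : ∀ i, W.val.mat i i = 1
  Wbar_upper : Ord (-1) 0 Wbar.val.mat
  Wbar_inv_upper : Ord (-1) 0 (Wbar⁻¹).val.mat

theorem exists_factorization (ħ : ℂ) {d : ℤ → ℂ} (hd : ∀ i, d i ≠ 0) :
    Nonempty (Factorization ħ (diagFun d)) := by
  have hU := tight_evolve ħ d
  set D := diagUnit d hd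
  have htr : ∀ i j k : ℤ, True → True → True := fun _ _ _ _ _ => trivial
  -- Normalization by the diagonal value at vanishing times makes `A` equal to `1` plus terms of
  -- positive weight.
  set A : BiOp := BiOp.ofMat _ hU.isBanded * (D⁻¹).val with hA
  have hAt : Tight (fun _ _ => True) A.mat :=
    hU.mul htr ((tight_diagMat fun i => MvPowerSeries.C (d i)⁻¹).mono fun _ _ _ => trivial)
  have hA1 : EqMod 1 A.mat matOne := by
    intro m hm i j
    obtain rfl := eq_zero_of_wt_lt_one hm
    have e : A.mat i j = evolve ħ (diagFun d) i j * MvPowerSeries.C ((d j)⁻¹) :=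
      matMul_diagMat _ _ _ _
    have e2 : MvPowerSeries.constantCoeff (evolve ħ (diagFun d) i j) = diagFun d i j := by
      rw [← MvPowerSeries.coeff_zero_eq_constantCoeff_apply, coeff_evolve]
      simp
    rw [e, MvPowerSeries.coeff_zero_eq_constantCoeff_apply, map_mul, e2,
      MvPowerSeries.constantCoeff_C, MvPowerSeries.coeff_zero_eq_constantCoeff_apply]
    simp only [diagFun, matOne]
    split_ifs with h
    · rw [h, mul_inv_cancel₀ (hd j), map_one]
    · simp
  obtain ⟨A', hA', -⟩ := BiOp.exists_unit_of_eqMod_one htr (fun _ => trivial) hAt hA1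
  set N : BiOp := A - 1 with hN
  have hNt : Tight (fun _ _ => True) N.mat := hAt.sub (tight_one.mono fun _ _ _ => trivial)
  have hN1 : EqMod 1 N.mat 0 := by
    have := hA1.sub (EqMod.refl 1 matOne)
    rwa [sub_self] at this
  -- With `W = 1 + w` and `A = 1 + N`, the negative part of `W A` vanishes exactly when `w = -(N + w
  -- N)_{<0}`; the right-hand side is contracting in `w` because `N` has no constant term.
  obtain ⟨w, hw, hwf⟩ := exists_fixedPoint (S := fun i j => j < i)
    (fun w => -negPart (N.mat + matMul w N.mat))
    (fun w hw => (hNt.add ((hw.mono fun _ _ _ => trivial).mul htr hNt)).negPart.neg)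
    (fun k X Y h => ((EqMod.refl _ _).add (h.matMul_succ hN1)).negPart.neg)
  have hw0 : EqMod 1 w 0 := by
    have h1 : EqMod 1 (matMul w N.mat) 0 := by
      have := EqMod.matMul_succ (k := 0) (A := w) (A' := 0) (fun m hm => by omega) hN1
      have e : matMul 0 N.mat = 0 := by
        rw [← zero_smul ℂ (0 : Mat), smul_matMul, zero_smul, zero_smul]
      rwa [e, zero_add] at this
    have h2 := ((hN1.add h1).negPart).neg
    rw [hwf] at h2
    have e : -negPart (0 + 0 : Mat) = 0 := by
      funext i j; simp [negPart]
    rwa [e] at h2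
  set W : BiOp := 1 + BiOp.ofMat w hw.isBanded with hW
  have hle : ∀ i j k : ℤ, j ≤ i → k ≤ j → k ≤ i := fun i j k h h' => h'.trans h
  have hge : ∀ i j k : ℤ, i ≤ j → j ≤ k → i ≤ k := fun i j k h h' => h.trans h'
  have hWt : Tight (fun i j => j ≤ i) W.mat :=
    (tight_one.mono fun i j h => h.ge).add (hw.mono fun i j h => h.le)
  have hW1 : EqMod 1 W.mat matOne := by
    have := (EqMod.refl 1 matOne).add hw0
    rwa [add_zero] at this
  obtain ⟨W', hW', hWi⟩ := BiOp.exists_unit_of_eqMod_one hle (fun i => le_refl i) hWt hW1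
  have hWA : W * A = 1 + BiOp.ofMat w hw.isBanded + (N + BiOp.ofMat w hw.isBanded * N) := by
    have : A = 1 + N := by rw [hN]; abel
    rw [this, hW]
    noncomm_ring
  have hup : ∀ i j : ℤ, j < i → (W * A).mat i j = 0 := by
    intro i j hij
    have h1 := congrFun (congrFun hwf i) j
    simp only [Pi.neg_apply, negPart, if_pos hij] at h1
    rw [hWA]
    change matOne i j + w i j + (N.mat + matMul w N.mat) i j = 0
    rw [← h1, matOne, if_neg hij.ne']
    ring
  have hWAt : Tight (fun i j => i ≤ j) (W * A).mat := by
    intro m i j h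
    refine ⟨(((hWt.mono fun _ _ _ => trivial).mul htr hAt) m i j h).1, ?_⟩
    by_contra hij
    exact h (by rw [hup i j (by omega), map_zero])
  have hWA1 : EqMod 1 (W * A).mat matOne := by
    have := hW1.matMul hA1
    rwa [one_matMul] at this
  obtain ⟨B, hB, hBi⟩ := BiOp.exists_unit_of_eqMod_one hge (fun i => le_refl i) hWAt hWA1
  have hD : ∀ f : ℤ → ℂ, Tight (fun i j => i ≤ j) (diagMat fun i => MvPowerSeries.C (f i)) :=
    fun f => (tight_diagMat _).mono fun i j h => h.le
  refine ⟨⟨A' * D, W', B * D, ?_, ?_, ?_, ?_, ?_, ?_, ?_⟩⟩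
  · have : (A' * D).val = BiOp.ofMat _ hU.isBanded := by
      rw [Units.val_mul, hA', hA, mul_assoc, Units.inv_mul, mul_one]
    rw [this, BiOp.mat_ofMat]
  · have e : W' * A' = B := Units.ext (by rw [Units.val_mul, hW', hA', hB])
    rw [← mul_assoc, e]
  · rw [hW']; exact ord_of_tight_le hWt
  · exact ord_of_tight_le hWi
  · intro i
    rw [hW']
    change matOne i i + w i i = 1
    rw [hw.eq_zero (lt_irrefl i), matOne, if_pos rfl, add_zero]
  · rw [Units.val_mul, hB]
    exact ord_of_tight_ge (hWAt.mul hge (hD d))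
  · rw [mul_inv_rev, Units.val_mul]
    exact ord_of_tight_ge ((hD fun i => (d i)⁻¹).mul hge hBi)

namespace Factorization
variable {ħ : ℂ} {u : ℤ → ℤ → ℂ} (f : Factorization ħ u)

theorem W_inv_diag (i : ℤ) : (f.W⁻¹).val.mat i i = 1 := by
  have h := f.W_lower.matMul_diag f.W_inv_lower i
  rw [← BiOp.mat_mul, Units.mul_inv, f.W_diag, one_mul, BiOp.mat_one, matOne, if_pos rfl] at h
  exact h.symm

theorem Wbar_diag_mul (i : ℤ) : f.Wbar.val.mat i i * (f.Wbar⁻¹).val.mat i i = 1 := by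
  have h := f.Wbar_upper.matMul_diag f.Wbar_inv_upper i
  rw [← BiOp.mat_mul, Units.mul_inv, BiOp.mat_one, matOne, if_pos rfl] at h
  exact h.symm

/-- Uniqueness of the factorization. -/
theorem eq_of_matMul_evolve {W : DescOp} {Wbar : AscOp} (hW : Ord 1 0 W.1)
    (hW1 : ∀ i, W.1 i i = 1) (hWbar : Ord (-1) 0 Wbar.1) (h : matMul W.1 (evolve ħ u) = Wbar.1) :
    W = BiOp.toDesc f.W.val ∧ Wbar = BiOp.toAsc f.Wbar.val := by
  have hP : (W * BiOp.toDesc f.U.val).1 = Wbar.1 := by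
    rw [Op.coe_mul, BiOp.toDesc_val, f.U_mat, h]
  -- `W` is only known to be descending. The product `W U` equals an ascending operator, hence is
  -- banded on both sides, and so is `W = (W U) U⁻¹`.
  let P : BiOp := ⟨W * BiOp.toDesc f.U.val, by
    change IsBanded (-1) _
    rw [hP]
    exact Wbar.2⟩
  have hPm : P.mat = Wbar.1 := hP
  set Q : BiOp := P * (f.U⁻¹).val with hQdef
  have hQd : BiOp.toDesc Q = W := by
    change W * BiOp.toDesc f.U.val * BiOp.toDesc (f.U⁻¹).val = W
    rw [mul_assoc, ← map_mul, Units.mul_inv, map_one, mul_one]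
  have hQm : Q.mat = W.1 := by rw [← hQd, BiOp.toDesc_val]
  set V : BiOp := Q * (f.W⁻¹).val with hVdef
  have hV : V = P * (f.Wbar⁻¹).val := by
    rw [hVdef, hQdef, ← f.W_mul_U, mul_inv_rev, Units.val_mul, mul_assoc]
  have hQo : Ord 1 0 Q.mat := by rw [hQm]; exact hW
  have hPo : Ord (-1) 0 P.mat := by rw [hPm]; exact hWbar
  have hV1 : Ord 1 0 V.mat := by
    have := hQo.matMul f.W_inv_lower
    rwa [add_zero] at this
  have hV2 : Ord (-1) 0 V.mat := by
    rw [hV]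
    have := hPo.matMul f.Wbar_inv_upper
    rwa [add_zero] at this
  have hVd : ∀ i, V.mat i i = 1 := fun i => by
    have := hQo.matMul_diag f.W_inv_lower i
    rw [f.W_inv_diag, hQm, hW1, one_mul] at this
    rw [hVdef, BiOp.mat_mul, hQm]; exact this
  -- `V` is the quotient of two lower unitriangular factors and also of two upper triangular ones.
  have hVone : V = 1 := by
    refine BiOp.ext ?_
    funext i j
    rw [BiOp.mat_one, matOne]
    rcases lt_trichotomy i j with hij | rfl | hij
    · rw [hV1 i j (by simpa using hij), if_neg hij.ne]
    · rw [hVd, if_pos rfl]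
    · rw [hV2 i j (by simpa using hij), if_neg hij.ne']
  have hQW : Q = f.W.val := by
    have : V * f.W.val = f.W.val := by rw [hVone, one_mul]
    rwa [hVdef, mul_assoc, Units.inv_mul, mul_one] at this
  have hPW : P = f.Wbar.val := by
    have : V * f.Wbar.val = f.Wbar.val := by rw [hVone, one_mul]
    rwa [hV, mul_assoc, Units.inv_mul, mul_one] at this
  exact ⟨by rw [← hQd, hQW], Subtype.ext (by rw [← hPm, hPW, BiOp.toAsc_val])⟩

end Factorization

/-! ### Shifts, multiplication operators and time sums -/

theorem isBanded_shiftMat (n : ℤ) (ε : ℤˣ) : IsBanded ε (shiftMat n) := by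
  refine ⟨|n|, fun m i j h => ?_⟩
  by_cases hij : j = i + n
  · subst hij
    rw [add_sub_cancel_left]
    have : (ε : ℤ) * n ≤ |n| := by
      rcases Int.units_eq_one_or ε with rfl | rfl
      · simpa using le_abs_self n
      · simpa using neg_le_abs n
    omega
  · simp [shiftMat, hij] at h

namespace BiOp

noncomputable def shift (n : ℤ) : BiOp := ofMat (shiftMat n) (isBanded_shiftMat n)

theorem shift_mul_apply (n : ℤ) (A : BiOp) (i j : ℤ) : (shift n * A).mat i j = A.mat (i + n) j :=
  shiftMat_matMul _ _ _ _

theorem mul_shift_apply (n : ℤ) (A : BiOp) (i j : ℤ) : (A * shift n).mat i j = A.mat i (j - n) :=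
  matMul_shiftMat _ _ _ _

theorem shift_add (a b : ℤ) : shift (a + b) = shift a * shift b := by
  refine ext ?_
  funext i j
  rw [shift_mul_apply]
  simp [shift, shiftMat, add_assoc]

theorem shift_zero : shift 0 = 1 := by
  refine ext ?_
  funext i j
  simp [shift, shiftMat, matOne, eq_comm]

noncomputable def shiftUnit (n : ℤ) : BiOpˣ :=
  ⟨shift n, shift (-n), by rw [← shift_add, add_neg_cancel, shift_zero],
    by rw [← shift_add, neg_add_cancel, shift_zero]⟩

@[simp] theorem shiftUnit_val (n : ℤ) : (shiftUnit n).val = shift n := rfl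

theorem shiftUnit_zpow (n : ℤ) : shiftUnit 1 ^ n = shiftUnit n := by
  let φ : Multiplicative ℤ →* BiOpˣ :=
    { toFun := fun a => shiftUnit a.toAdd
      map_one' := Units.ext shift_zero
      map_mul' := fun a b => Units.ext (shift_add _ _) }
  have := map_zpow φ (Multiplicative.ofAdd 1) n
  rw [← ofAdd_zsmul] at this
  simpa [φ] using this.symm

/-- Multiplication by a function of `s`. -/
noncomputable def diag (f : ℤ → Coeffs) : BiOp := ofMat _ (tight_diagMat f).isBanded

theorem diag_mul_apply (f : ℤ → Coeffs) (A : BiOp) (i j : ℤ) :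
    (diag f * A).mat i j = f i * A.mat i j := diagMat_matMul _ _ _ _

theorem mul_diag_apply (f : ℤ → Coeffs) (A : BiOp) (i j : ℤ) :
    (A * diag f).mat i j = A.mat i j * f j := matMul_diagMat _ _ _ _

theorem diag_const_mul_comm (x : Coeffs) (A : BiOp) :
    diag (fun _ => x) * A = A * diag fun _ => x := by
  refine ext ?_
  funext i j
  rw [diag_mul_apply, mul_diag_apply, mul_comm]

/-- Multiplication by `s`. -/
noncomputable def sOp (ħ : ℂ) : BiOp := diag fun i => MvPowerSeries.C (ħ * (i : ℂ))

theorem sOp_mat (ħ : ℂ) : (sOp ħ).mat = sMat ħ := rfl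

theorem shift_mul_sOp (ħ : ℂ) (n : ℤ) :
    shift n * sOp ħ - sOp ħ * shift n = (ħ * n) • shift n := by
  refine ext ?_
  funext i j
  change (shift n * sOp ħ).mat i j - (sOp ħ * shift n).mat i j = (ħ * n) • (shift n).mat i j
  rw [sOp, mul_diag_apply, diag_mul_apply, MvPowerSeries.smul_eq_C_mul]
  simp only [shift, mat_ofMat, shiftMat]
  split_ifs with h
  · subst h
    rw [one_mul, mul_one, mul_one, ← map_sub]
    congr 1
    push_cast; ring
  · simp

end BiOp

/-- The index of a time of weight `n`. -/
def IsTimeIndex (ι : ℕ+ → Time) : Prop := ∀ n, wt (Finsupp.single (ι n) 1) = n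

theorem isTimeIndex_inl : IsTimeIndex Sum.inl := fun n => by
  simp [wt, Finsupp.weight_apply]

theorem isTimeIndex_inr : IsTimeIndex Sum.inr := fun n => by
  simp [wt, Finsupp.weight_apply]

theorem IsTimeIndex.le_of_coeff {ι : ℕ+ → Time} (hι : IsTimeIndex ι) {n : ℕ+} {x : Coeffs}
    {m : Time →₀ ℕ} (h : MvPowerSeries.coeff m (MvPowerSeries.X (ι n) * x) ≠ 0) :
    (n : ℕ) ≤ wt m := by
  classical
  obtain ⟨p, q, rfl, hp, -⟩ := exists_of_coeff_mul_ne_zero h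
  rw [MvPowerSeries.coeff_X] at hp
  have : p = Finsupp.single (ι n) 1 := by
    by_contra hne
    simp [hne] at hp
  rw [map_add, this, hι]
  omega

theorem tight_timeSum_shiftMat {ι : ℕ+ → Time} (hι : IsTimeIndex ι) {f : ℕ+ → ℤ}
    (hf : ∀ n, |f n| ≤ n) : Tight (fun _ _ => True) (timeSum ι fun n => shiftMat (f n)) := by
  intro m i j h
  refine ⟨?_, trivial⟩
  obtain ⟨n, hn⟩ : ∃ n : ℕ+, MvPowerSeries.coeff m
      (((n : ℕ) : ℂ) • (MvPowerSeries.X (ι n) * shiftMat (f n) i j)) ≠ 0 := by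
    by_contra! hk
    exact h (by simp [timeSum, coeff_formalSum, hk])
  rw [map_smul] at hn
  have h1 := right_ne_zero_of_smul hn
  have h2 := hι.le_of_coeff h1
  have h3 : j = i + f n := by
    by_contra hne
    simp [shiftMat, hne] at h1
  have := hf n
  rw [h3, add_sub_cancel_left]
  omega

namespace BiOp

/-- `∑ n x_n exp(f(n) ħ ∂_s)`. -/
noncomputable def timeShift (ι : ℕ+ → Time) (hι : IsTimeIndex ι) (f : ℕ+ → ℤ)
    (hf : ∀ n, |f n| ≤ n) : BiOp := ofMat _ (tight_timeSum_shiftMat hι hf).isBanded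

/-- `∑ n t_n exp(n ħ ∂_s)`. -/
noncomputable def tOp : BiOp := timeShift Sum.inl isTimeIndex_inl (fun n => (n : ℕ)) fun n => by simp

/-- `∑ n tbar_n exp(-n ħ ∂_s)`. -/
noncomputable def tbarOp : BiOp :=
  timeShift Sum.inr isTimeIndex_inr (fun n => -((n : ℕ) : ℤ)) fun n => by simp

theorem shift_mul_timeShift (ι : ℕ+ → Time) (hι : IsTimeIndex ι) (f : ℕ+ → ℤ)
    (hf : ∀ n, |f n| ≤ n) (a : ℤ) :
    shift a * timeShift ι hι f hf = timeShift ι hι f hf * shift a := by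
  refine ext ?_
  funext i j
  rw [shift_mul_apply, mul_shift_apply]
  simp only [timeShift, mat_ofMat, timeSum]
  congr 1
  funext n
  have : shiftMat (f n) (i + a) j = shiftMat (f n) i (j - a) := by
    simp only [shiftMat]
    congr 1
    rw [eq_iff_iff]
    omega
  rw [this]

end BiOp

/-- Finite partial sums approximate time sums. -/
theorem eqMod_timeSum {ι : ℕ+ → Time} (hι : IsTimeIndex ι) (P : ℕ+ → BiOp) (K : ℕ+) :
    EqMod K (timeSum ι fun n => (P n).mat)
      (∑ n ∈ Finset.Icc 1 K,
        ((n : ℕ) : ℂ) • (BiOp.diag (fun _ => MvPowerSeries.X (ι n)) * P n)).mat := by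
  intro m hm i j
  let φ : BiOp →+ ℂ :=
    { toFun := fun A => MvPowerSeries.coeff m (A.mat i j)
      map_zero' := by simp
      map_add' := fun A B => by simp }
  have e : ∀ n : ℕ+, φ (((n : ℕ) : ℂ) • (BiOp.diag (fun _ => MvPowerSeries.X (ι n)) * P n)) =
      MvPowerSeries.coeff m (((n : ℕ) : ℂ) • (MvPowerSeries.X (ι n) * (P n).mat i j)) := by
    intro n
    rw [← BiOp.diag_mul_apply (fun _ => MvPowerSeries.X (ι n))]
    rfl
  change _ = φ _
  rw [map_sum, timeSum, coeff_formalSum]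
  simp only [e]
  refine finsum_eq_sum_of_support_subset _ fun n hn => ?_
  rw [Function.mem_support, map_smul] at hn
  have h1 := hι.le_of_coeff (right_ne_zero_of_smul hn)
  rw [Finset.coe_Icc, Set.mem_Icc]
  exact ⟨one_le, PNat.coe_le_coe _ _ |>.1 (by omega)⟩

/-- Multiplication passes through the infinite sum because, below any given weight, only finitely
many times contribute, and each time is a central scalar. -/
theorem mul_timeSum_mul {ι : ℕ+ → Time} (hι : IsTimeIndex ι) (P : ℕ+ → BiOp) {τ : BiOp}
    (hτ : τ.mat = timeSum ι fun n => (P n).mat) (A B : BiOp) :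
    (A * τ * B).mat = timeSum ι fun n => (A * P n * B).mat := by
  refine eq_of_eqMod fun k => ?_
  have h1 := eqMod_timeSum hι P k.succPNat
  have h2 := eqMod_timeSum hι (fun n => A * P n * B) k.succPNat
  rw [← hτ] at h1
  have h3 := ((EqMod.refl _ A.mat).matMul h1).matMul (EqMod.refl _ B.mat)
  rw [← BiOp.mat_mul, ← BiOp.mat_mul, ← BiOp.mat_mul, ← BiOp.mat_mul] at h3
  refine EqMod.mono (h3.trans (EqMod.trans ?_ h2.symm)) (Nat.le_succ k)
  rw [Finset.mul_sum, Finset.sum_mul]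
  have e : ∀ n : ℕ+, A * (((n : ℕ) : ℂ) • (BiOp.diag (fun _ => MvPowerSeries.X (ι n)) * P n)) * B =
      ((n : ℕ) : ℂ) • (BiOp.diag (fun _ => MvPowerSeries.X (ι n)) * (A * P n * B)) := fun n => by
    rw [mul_smul_comm, smul_mul_assoc, ← mul_assoc A, ← BiOp.diag_const_mul_comm]
    simp only [mul_assoc]
  simp only [e]
  exact EqMod.refl _ _

/-! ### Derivatives with respect to the times -/

theorem pderiv_formalSum {ι : Type} (x : Time) (f : ι → Coeffs) :
    MvPowerSeries.pderiv ℂ x (formalSum f) = formalSum fun k => MvPowerSeries.pderiv ℂ x (f k) := by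
  ext m
  rw [MvPowerSeries.coeff_pderiv, coeff_formalSum, coeff_formalSum, mul_comm]
  simp only [MvPowerSeries.coeff_pderiv]
  rw [← smul_eq_mul, smul_finsum]
  exact finsum_congr fun k => by rw [smul_eq_mul, mul_comm]

theorem isBanded_pderiv (x : Time) {ε : ℤˣ} {A : Mat} (hA : IsBanded ε A) :
    IsBanded ε fun i j => MvPowerSeries.pderiv ℂ x (A i j) := by
  obtain ⟨N, hN⟩ := hA
  refine ⟨N + wt (Finsupp.single x 1), fun m i j h => ?_⟩
  rw [MvPowerSeries.coeff_pderiv] at h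
  have := hN _ _ _ (left_ne_zero_of_mul h)
  rw [map_add] at this
  push_cast at this
  omega

namespace BiOp

/-- The derivative with respect to the time `x`. -/
noncomputable def der (x : Time) (A : BiOp) : BiOp :=
  ofMat (fun i j => MvPowerSeries.pderiv ℂ x (A.mat i j)) fun ε => isBanded_pderiv x (A.isBanded ε)

theorem der_apply (x : Time) (A : BiOp) (i j : ℤ) :
    (der x A).mat i j = MvPowerSeries.pderiv ℂ x (A.mat i j) := rfl

theorem der_add (x : Time) (A B : BiOp) : der x (A + B) = der x A + der x B :=
  ext (by funext i j; simp [der_apply])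

theorem der_sub (x : Time) (A B : BiOp) : der x (A - B) = der x A - der x B :=
  ext (by funext i j; simp [der_apply])

theorem der_mul (x : Time) (A B : BiOp) : der x (A * B) = der x A * B + A * der x B := by
  refine ext ?_
  funext i j
  ext m
  rw [der_apply, mat_mul, matMul, pderiv_formalSum, coeff_formalSum]
  change _ = ∑ᶠ k, MvPowerSeries.coeff m ((der x A).mat i k * B.mat k j) +
    ∑ᶠ k, MvPowerSeries.coeff m (A.mat i k * (der x B).mat k j)
  rw [← finsum_add_distrib (((der x A).isBanded 1).finite_support (B.isBanded 1) i j m)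
    ((A.isBanded 1).finite_support ((der x B).isBanded 1) i j m)]
  refine finsum_congr fun k => ?_
  rw [← map_add, der_apply, der_apply, Derivation.leibniz, smul_eq_mul, smul_eq_mul]
  congr 1
  ring

theorem der_shift (x : Time) (n : ℤ) : der x (shift n) = 0 := by
  refine ext ?_
  funext i j
  rw [der_apply]
  simp only [shift, mat_ofMat, shiftMat]
  split_ifs <;> simp

theorem der_sOp (x : Time) (ħ : ℂ) : der x (sOp ħ) = 0 := by
  refine ext ?_
  funext i j
  rw [der_apply, sOp_mat]
  simp only [sMat]
  split_ifs <;> simp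

theorem der_timeShift (x : Time) (ι : ℕ+ → Time) (hι : IsTimeIndex ι) (f : ℕ+ → ℤ)
    (hf : ∀ n, |f n| ≤ n) (i j : ℤ) : (der x (timeShift ι hι f hf)).mat i j =
      formalSum fun n => if x = ι n then ((n : ℕ) : ℂ) • shiftMat (f n) i j else 0 := by
  classical
  rw [der_apply]
  simp only [timeShift, mat_ofMat, timeSum]
  rw [pderiv_formalSum]
  congr 1
  funext n
  have h : MvPowerSeries.pderiv ℂ x (shiftMat (f n) i j) = 0 := der_apply x (shift (f n)) i j ▸ by
    rw [der_shift]; rfl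
  rw [Derivation.map_smul, Derivation.leibniz, h, smul_zero, zero_add, smul_eq_mul]
  split_ifs with hx
  · rw [hx, MvPowerSeries.pderiv_X_self, mul_one]
  · rw [MvPowerSeries.pderiv_X_of_ne (Ne.symm hx), mul_zero, smul_zero]

theorem der_timeShift_self (ι : ℕ+ → Time) (hι : IsTimeIndex ι) (f : ℕ+ → ℤ)
    (hf : ∀ n, |f n| ≤ n) (n : ℕ+) :
    der (ι n) (timeShift ι hι f hf) = ((n : ℕ) : ℂ) • shift (f n) := by
  have hinj : Function.Injective ι := fun a b h => PNat.coe_injective (by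
    rw [← hι a, ← hι b, h])
  refine ext ?_
  funext i j
  rw [der_timeShift, formalSum_eq_single _ n fun l hl => if_neg (hinj.ne hl.symm), if_pos rfl]
  rfl

theorem der_timeShift_of_ne (x : Time) (ι : ℕ+ → Time) (hι : IsTimeIndex ι) (f : ℕ+ → ℤ)
    (hf : ∀ n, |f n| ≤ n) (hx : ∀ n, x ≠ ι n) : der x (timeShift ι hι f hf) = 0 := by
  refine ext ?_
  funext i j
  rw [der_timeShift, formalSum_eq_single _ 1 fun l _ => if_neg (hx l), if_neg (hx 1)]
  rfl

/-- Derivative of a dressed operator. -/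
theorem der_conj (x : Time) (V : BiOpˣ) (Y : BiOp) :
    der x (V.val * Y * (V⁻¹).val) =
      der x V.val * (V⁻¹).val * (V.val * Y * (V⁻¹).val)
        - V.val * Y * (V⁻¹).val * (der x V.val * (V⁻¹).val)
        + V.val * der x Y * (V⁻¹).val := by
  have h : V.val * Y * (V⁻¹).val * V.val = V.val * Y := by
    rw [mul_assoc, Units.inv_mul, mul_one]
  generalize V.val * Y * (V⁻¹).val = X at h ⊢
  -- The identity `X V = V Y` is differentiated, which avoids the derivative of the inverse of `V`.
  have h1 := congrArg (der x) h
  rw [der_mul, der_mul] at h1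
  have hY : (V⁻¹).val * X = Y * (V⁻¹).val := by
    rw [Units.inv_mul_eq_iff_eq_mul, ← mul_assoc, ← h, mul_assoc, Units.mul_inv, mul_one]
  have h2 : der x X = (der x V.val * Y + V.val * der x Y - X * der x V.val) * (V⁻¹).val := by
    rw [← h1, add_sub_cancel_right, mul_assoc, Units.mul_inv, mul_one]
  rw [h2, mul_assoc (der x V.val), hY]
  simp only [sub_mul, add_mul, mul_assoc]
  abel

end BiOp

/-! ### The evolution of a matrix -/

/-- The products are the coefficients of the exponential of a linear form in the times; this is its
differential equation, coefficientwise `(k + 1) c^(k+1)/(k+1)! = c · c^k/k!`. -/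
theorem coeff_evolve_add_single (ħ : ℂ) (m : Time →₀ ℕ) (x : Time) :
    ((m + Finsupp.single x 1).prod fun x k =>
      (Sum.elim (fun _ => ħ⁻¹) (fun _ => -ħ⁻¹) x : ℂ) ^ k / (k.factorial : ℂ)) * (m x + 1) =
    (Sum.elim (fun _ => ħ⁻¹) (fun _ => -ħ⁻¹) x : ℂ) * (m.prod fun x k =>
      (Sum.elim (fun _ => ħ⁻¹) (fun _ => -ħ⁻¹) x : ℂ) ^ k / (k.factorial : ℂ)) := by
  have h0 : ∀ i : Time, (Sum.elim (fun _ => ħ⁻¹) (fun _ => -ħ⁻¹) i : ℂ) ^ 0 /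
      (Nat.factorial 0 : ℂ) = 1 := by simp
  rw [← Finsupp.mul_prod_erase' _ x _ h0, ← Finsupp.mul_prod_erase' m x _ h0]
  have e : (m + Finsupp.single x 1).erase x = m.erase x := by
    ext y
    by_cases hy : y = x
    · subst hy; simp
    · simp [Finsupp.erase_ne hy]
  rw [e, Finsupp.add_apply, Finsupp.single_eq_same, pow_succ, Nat.factorial_succ]
  have h1 : ((m x : ℂ) + 1) ≠ 0 := by exact_mod_cast Nat.succ_ne_zero (m x)
  have h2 : ((m x).factorial : ℂ) ≠ 0 := by exact_mod_cast Nat.factorial_ne_zero (m x)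
  push_cast
  field_simp

theorem wtT_single_inl (n : ℕ+) : wtT (Finsupp.single (Sum.inl n) 1) = n := by
  simp [wtT, Finsupp.weight_apply]

theorem wtT_single_inr (n : ℕ+) : wtT (Finsupp.single (Sum.inr n) 1) = 0 := by
  simp [wtT, Finsupp.weight_apply]

theorem wtTbar_single_inl (n : ℕ+) : wtTbar (Finsupp.single (Sum.inl n) 1) = 0 := by
  simp [wtTbar, Finsupp.weight_apply]

theorem wtTbar_single_inr (n : ℕ+) : wtTbar (Finsupp.single (Sum.inr n) 1) = n := by
  simp [wtTbar, Finsupp.weight_apply]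

/-- The linear flow `ħ ∂U/∂t_n = Λⁿ U`; the next lemma is `ħ ∂U/∂tbar_n = -U Λ⁻ⁿ`. -/
theorem pderiv_inl_evolve {ħ : ℂ} (hħ : ħ ≠ 0) (u : ℤ → ℤ → ℂ) (n : ℕ+) (i j : ℤ) :
    ħ • MvPowerSeries.pderiv ℂ (Sum.inl n) (evolve ħ u i j) = evolve ħ u (i + (n : ℕ)) j := by
  ext m
  rw [map_smul, MvPowerSeries.coeff_pderiv, coeff_evolve, coeff_evolve, mul_right_comm,
    coeff_evolve_add_single, smul_eq_mul, Sum.elim_inl, ← mul_assoc, ← mul_assoc,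
    mul_inv_cancel₀ hħ, one_mul]
  congr 2
  · rw [map_add, wtT_single_inl]; push_cast; ring
  · rw [map_add, wtTbar_single_inl, add_zero]

theorem pderiv_inr_evolve {ħ : ℂ} (hħ : ħ ≠ 0) (u : ℤ → ℤ → ℂ) (n : ℕ+) (i j : ℤ) :
    ħ • MvPowerSeries.pderiv ℂ (Sum.inr n) (evolve ħ u i j) = -evolve ħ u i (j + (n : ℕ)) := by
  ext m
  rw [map_smul, map_neg, MvPowerSeries.coeff_pderiv, coeff_evolve, coeff_evolve, mul_right_comm,
    coeff_evolve_add_single, smul_eq_mul, Sum.elim_inr, ← mul_assoc, ← mul_assoc, mul_neg,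
    mul_inv_cancel₀ hħ, neg_one_mul, neg_mul]
  congr 3
  · rw [map_add, wtT_single_inr, add_zero]
  · rw [map_add, wtTbar_single_inr]; push_cast; ring

/-- The Euler operator multiplies a monomial by its exponent. Summed over the times with factor `n`,
it counts the weights `wtT` and `wtTbar`, which is how `∑ n t_n Λⁿ` acts on the evolved matrix. -/
theorem coeff_X_mul_pderiv (x : Time) (f : Coeffs) (m : Time →₀ ℕ) :
    MvPowerSeries.coeff m (MvPowerSeries.X x * MvPowerSeries.pderiv ℂ x f) =
      m x * MvPowerSeries.coeff m f := by
  classical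
  rw [MvPowerSeries.X, MvPowerSeries.coeff_monomial_mul]
  split_ifs with h
  · have h1 : 1 ≤ m x := by simpa using h x
    rw [one_mul, MvPowerSeries.coeff_pderiv, tsub_add_cancel_of_le h, mul_comm, Finsupp.tsub_apply,
      Finsupp.single_eq_same]
    push_cast [h1]
    ring
  · have h1 : m x = 0 := by
      by_contra h0
      refine h fun y => ?_
      by_cases hy : y = x
      · subst hy; simp; omega
      · simp [Ne.symm hy]
    simp [h1]

theorem finsum_wtT (m : Time →₀ ℕ) (c : ℂ) :
    ∑ᶠ n : ℕ+, ((n : ℕ) : ℂ) * ((m (Sum.inl n) : ℂ) * c) = wtT m * c := by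
  have hinj : Set.InjOn (Sum.inl : ℕ+ → Time) (Sum.inl ⁻¹' (m.support : Set Time)) :=
    Sum.inl_injective.injOn
  rw [finsum_eq_sum_of_support_subset (s := m.support.preimage Sum.inl hinj)]
  · rw [wtT, Finsupp.weight_apply, Finsupp.sum, Nat.cast_sum, Finset.sum_mul,
      ← Finset.sum_preimage Sum.inl m.support hinj]
    · refine Finset.sum_congr rfl fun n _ => ?_
      simp; ring
    · rintro (x | x) _ hx
      · exact absurd ⟨x, rfl⟩ hx
      · simp
  · intro n hn
    simp only [Function.mem_support] at hn
    rw [Finset.coe_preimage, Set.mem_preimage, Finset.mem_coe, Finsupp.mem_support_iff]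
    intro h0
    simp [h0] at hn

theorem finsum_wtTbar (m : Time →₀ ℕ) (c : ℂ) :
    ∑ᶠ n : ℕ+, ((n : ℕ) : ℂ) * ((m (Sum.inr n) : ℂ) * c) = wtTbar m * c := by
  have hinj : Set.InjOn (Sum.inr : ℕ+ → Time) (Sum.inr ⁻¹' (m.support : Set Time)) :=
    Sum.inr_injective.injOn
  rw [finsum_eq_sum_of_support_subset (s := m.support.preimage Sum.inr hinj)]
  · rw [wtTbar, Finsupp.weight_apply, Finsupp.sum, Nat.cast_sum, Finset.sum_mul,
      ← Finset.sum_preimage Sum.inr m.support hinj]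
    · refine Finset.sum_congr rfl fun n _ => ?_
      simp; ring
    · rintro (x | x) _ hx
      · simp
      · exact absurd ⟨x, rfl⟩ hx
  · intro n hn
    simp only [Function.mem_support] at hn
    rw [Finset.coe_preimage, Set.mem_preimage, Finset.mem_coe, Finsupp.mem_support_iff]
    intro h0
    simp [h0] at hn

namespace BiOp
variable {ħ : ℂ} {u : ℤ → ℤ → ℂ} {U : BiOp}

/-- `(s + ∑ n t_n Λⁿ) U` is the evolution of `s U(0,0)`. -/
theorem coeff_sOp_add_tOp_mul (hħ : ħ ≠ 0) (hU : U.mat = evolve ħ u) (m : Time →₀ ℕ) (i j : ℤ) :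
    MvPowerSeries.coeff m (((sOp ħ + tOp) * U).mat i j) =
      ħ * (i + wtT m) * MvPowerSeries.coeff m (U.mat i j) := by
  have h1 : (tOp * U).mat i j = formalSum fun n : ℕ+ =>
      ((n : ℕ) : ℂ) • (MvPowerSeries.X (Sum.inl n) * U.mat (i + (n : ℕ)) j) := by
    have := mul_timeSum_mul isTimeIndex_inl (fun n => shift (n : ℕ)) (τ := tOp) rfl 1 U
    rw [one_mul] at this
    rw [this]
    simp only [timeSum, one_mul, shift_mul_apply]
  have h2 : ∀ n : ℕ+, MvPowerSeries.coeff m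
      (((n : ℕ) : ℂ) • (MvPowerSeries.X (Sum.inl n) * U.mat (i + (n : ℕ)) j)) =
      ((n : ℕ) : ℂ) * (m (Sum.inl n) * (ħ * MvPowerSeries.coeff m (U.mat i j))) := fun n => by
    rw [hU, ← pderiv_inl_evolve hħ, mul_smul_comm, map_smul, map_smul, coeff_X_mul_pderiv]
    simp only [smul_eq_mul]
    ring
  have h3 : (sOp ħ * U).mat i j = MvPowerSeries.C (ħ * (i : ℂ)) * U.mat i j :=
    diag_mul_apply _ _ _ _
  rw [add_mul, mat_add, Pi.add_apply, Pi.add_apply, map_add, h1, h3, MvPowerSeries.coeff_C_mul,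
    coeff_formalSum]
  simp only [h2]
  rw [finsum_wtT]
  ring

/-- `U (s - ∑ n tbar_n Λ⁻ⁿ)` is the evolution of `U(0,0) s`. -/
theorem coeff_mul_sOp_sub_tbarOp (hħ : ħ ≠ 0) (hU : U.mat = evolve ħ u) (m : Time →₀ ℕ)
    (i j : ℤ) : MvPowerSeries.coeff m ((U * (sOp ħ - tbarOp)).mat i j) =
      ħ * (j + wtTbar m) * MvPowerSeries.coeff m (U.mat i j) := by
  have h1 : (U * tbarOp).mat i j = formalSum fun n : ℕ+ =>
      ((n : ℕ) : ℂ) • (MvPowerSeries.X (Sum.inr n) * U.mat i (j + (n : ℕ))) := by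
    have := mul_timeSum_mul isTimeIndex_inr (fun n => shift (-((n : ℕ) : ℤ))) (τ := tbarOp) rfl U 1
    rw [mul_one] at this
    rw [this]
    simp only [timeSum, mul_one, mul_shift_apply, sub_neg_eq_add]
  have h2 : ∀ n : ℕ+, MvPowerSeries.coeff m
      (((n : ℕ) : ℂ) • (MvPowerSeries.X (Sum.inr n) * U.mat i (j + (n : ℕ)))) =
      ((n : ℕ) : ℂ) * (m (Sum.inr n) * (-ħ * MvPowerSeries.coeff m (U.mat i j))) := fun n => by
    rw [hU, ← neg_neg (evolve ħ u i (j + (n : ℕ))), ← pderiv_inr_evolve hħ, mul_neg, mul_smul_comm,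
      map_smul, map_neg, map_smul, coeff_X_mul_pderiv]
    simp only [smul_eq_mul]
    ring
  have h3 : (U * sOp ħ).mat i j = U.mat i j * MvPowerSeries.C (ħ * (j : ℂ)) :=
    mul_diag_apply _ _ _ _
  rw [mul_sub, mat_sub, Pi.sub_apply, Pi.sub_apply, map_sub, h1, h3, MvPowerSeries.coeff_mul_C,
    coeff_formalSum]
  simp only [h2]
  rw [finsum_wtTbar]
  ring

theorem der_inl_evolve (hħ : ħ ≠ 0) (hU : U.mat = evolve ħ u) (n : ℕ+) :
    ħ • der (Sum.inl n) U = shift (n : ℕ) * U := by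
  refine ext ?_
  funext i j
  rw [shift_mul_apply, hU, ← pderiv_inl_evolve hħ, ← hU]
  rfl

theorem der_inr_evolve (hħ : ħ ≠ 0) (hU : U.mat = evolve ħ u) (n : ℕ+) :
    ħ • der (Sum.inr n) U = -(U * shift (-((n : ℕ) : ℤ))) := by
  refine ext ?_
  funext i j
  rw [mat_neg, Pi.neg_apply, Pi.neg_apply, mul_shift_apply, sub_neg_eq_add, hU,
    ← pderiv_inr_evolve hħ, ← hU]
  rfl

end BiOp

/-! ### Expansions in powers of an operator -/

/-- Forward substitution: finite truncations are solved first. By triangularity with unit diagonal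
entries their solutions are unique, hence compatible, and the diagonal choice `a (n + 1) n` solves
the whole system. -/
theorem exists_triangular_solution (Q : ℕ → ℕ → Coeffs) (hQ : ∀ n, IsUnit (Q n n))
    (y : ℕ → Coeffs) : ∃ a : ℕ → Coeffs, ∀ n, ∑ k ∈ Finset.range (n + 1), a k * Q k n = y n := by
  have h : ∀ n : ℕ, ∃ a : ℕ → Coeffs, ∀ m < n, ∑ k ∈ Finset.range (m + 1), a k * Q k m = y m := by
    intro n
    induction n with
    | zero => exact ⟨0, fun m hm => absurd hm (Nat.not_lt_zero m)⟩
    | succ n ih =>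
      obtain ⟨a, ha⟩ := ih
      obtain ⟨q, hq⟩ := hQ n
      refine ⟨Function.update a n ((y n - ∑ k ∈ Finset.range n, a k * Q k n) * (q⁻¹).val),
        fun m hm => ?_⟩
      rcases Nat.lt_succ_iff_lt_or_eq.1 hm with hm | rfl
      · rw [← ha m hm]
        refine Finset.sum_congr rfl fun k hk => ?_
        rw [Function.update_of_ne (by rw [Finset.mem_range] at hk; omega)]
      · rw [Finset.sum_range_succ, Function.update_self, ← hq, mul_assoc, Units.inv_mul, mul_one,
          Finset.sum_congr rfl fun k hk => by
            rw [Function.update_of_ne (by rw [Finset.mem_range] at hk; omega)]]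
        ring
  choose a ha using h
  -- The solutions agree, since the system is triangular.
  have huniq : ∀ n k m, n < k → n < m → a k n = a m n := by
    intro n
    induction n using Nat.strong_induction_on with
    | _ n ih =>
      intro k m hk hm
      have h1 := ha k n hk
      have e : ∑ l ∈ Finset.range n, a k l * Q l n = ∑ l ∈ Finset.range n, a m l * Q l n :=
        Finset.sum_congr rfl fun l hl => by
          rw [Finset.mem_range] at hl
          rw [ih l hl k m (by omega) (by omega)]
      rw [← ha m n hm, Finset.sum_range_succ, Finset.sum_range_succ, e] at h1
      exact (hQ n).mul_right_cancel (add_left_cancel h1)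
  refine ⟨fun n => a (n + 1) n, fun n => ?_⟩
  rw [← ha (n + 1) n (Nat.lt_succ_self n)]
  refine Finset.sum_congr rfl fun k hk => ?_
  rw [Finset.mem_range] at hk
  exact congrArg (· * Q k n) (huniq k (k + 1) (n + 1) (by omega) (by omega))

theorem formalSum_eq_sum {ι : Type} (f : ι → Coeffs) (s : Finset ι) (h : ∀ k, k ∉ s → f k = 0) :
    formalSum f = ∑ k ∈ s, f k := by
  ext m
  rw [coeff_formalSum, map_sum]
  refine finsum_eq_sum_of_support_subset _ fun k hk => ?_
  by_contra hks
  exact hk (by simp only [h k hks, map_zero])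

/-- An operator of order `-1` has an expansion in a sequence of operators of orders
`-1, -2, …` with invertible leading coefficients. -/
theorem exists_coeffSum_eq {ε : ℤˣ} {X : Mat} (hX : Ord ε (-1) X) {P : ℕ+ → Mat}
    (hP : ∀ n : ℕ+, Ord ε (-(n : ℕ)) (P n))
    (hu : ∀ (n : ℕ+) (i : ℤ), IsUnit (P n i (i - ε * (n : ℕ)))) :
    ∃ v : ℕ+ → ℤ → Coeffs, X = coeffSum v P := by
  -- In a fixed row, the entry at distance `n + 1` from the diagonal involves only the first `n + 1`
  -- operators, so each row is a triangular system.
  have h : ∀ i : ℤ, ∃ a : ℕ → Coeffs, ∀ n : ℕ, ∑ k ∈ Finset.range (n + 1),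
      a k * P k.succPNat i (i - ε * ((n : ℤ) + 1)) = X i (i - ε * ((n : ℤ) + 1)) := by
    intro i
    refine exists_triangular_solution (fun k n => P k.succPNat i (i - ε * ((n : ℤ) + 1)))
      (fun n => ?_) fun n => X i (i - ε * ((n : ℤ) + 1))
    simpa using hu n.succPNat i
  choose a ha using h
  have hε : (ε : ℤ) * ε = 1 := by rw [← Units.val_mul, ← sq, Int.units_sq]; rfl
  refine ⟨fun n i => a i n.natPred, ?_⟩
  funext i j
  have hsum : ∀ s : Finset ℕ, (∀ k, k ∉ s → P k.succPNat i j = 0) →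
      coeffSum (fun n i => a i n.natPred) P i j = ∑ k ∈ s, a i k * P k.succPNat i j := by
    intro s hs
    rw [coeffSum, formalSum_eq_sum _ (s.map Equiv.pnatEquivNat.symm.toEmbedding)]
    · rw [Finset.sum_map]
      refine Finset.sum_congr rfl fun k _ => ?_
      simp [Equiv.pnatEquivNat]
    · intro n hn
      have := hs n.natPred fun h0 => hn (Finset.mem_map.2 ⟨n.natPred, h0, by
        simp [Equiv.pnatEquivNat]⟩)
      rw [PNat.succPNat_natPred] at this
      rw [this, mul_zero]
  by_cases hij : -1 < ε * (j - i)
  · rw [hX i j hij, hsum ∅ fun k _ => hP _ i j (by simp; omega), Finset.sum_empty]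
  · obtain ⟨n, hn⟩ : ∃ n : ℕ, ε * (j - i) = -((n : ℤ) + 1) :=
      ⟨(-(ε * (j - i)) - 1).toNat, by omega⟩
    have hj : j = i - ε * ((n : ℤ) + 1) := by
      have : ε * (ε * (j - i)) = ε * -((n : ℤ) + 1) := by rw [hn]
      rw [← mul_assoc, hε, one_mul, mul_neg] at this
      omega
    rw [hsum (Finset.range (n + 1)) fun k hk => hP _ i j (by
      rw [Finset.mem_range] at hk
      rw [hn]; simp; omega)]
    rw [hj, ha]

/-! ### The solution determined by a factorization -/

theorem BiOp.ord_conj_shift {ε : ℤˣ} {A B : BiOp} (hA : Ord ε 0 A.mat) (hB : Ord ε 0 B.mat)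
    (n : ℤ) : Ord ε (ε * n) (A * shift n * B).mat := by
  have hs : Ord ε (ε * n) (shift n).mat := by
    intro i j hij
    simp only [shift, mat_ofMat, shiftMat]
    rw [if_neg]
    rintro rfl
    simp at hij
  have := (hA.matMul hs).matMul hB
  rwa [add_zero, zero_add] at this

theorem BiOp.conj_shift_lead {ε : ℤˣ} {A B : BiOp} (hA : Ord ε 0 A.mat) (hB : Ord ε 0 B.mat)
    (n i : ℤ) : (A * shift n * B).mat i (i + n) = A.mat i i * B.mat (i + n) (i + n) := by
  have hε : (ε : ℤ) * ε = 1 := by rw [← Units.val_mul, ← sq, Int.units_sq]; rfl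
  have h1 : (shift n * B).mat i (i + n) = B.mat (i + n) (i + n) := shift_mul_apply _ _ _ _
  have hs := ord_conj_shift (ε := ε) (A := 1) (ord_one ε) hB n
  rw [one_mul] at hs
  have := hA.matMul_lead hs i
  rw [mul_zero, add_zero, zero_add, ← mul_assoc, hε, one_mul] at this
  rw [mul_assoc, mat_mul, this, h1]

/-- Conjugation by triangular factors preserves the diagonal of `s`. The remainder has order `-1`
and is the part of `M` or `Mbar` to be expanded with the coefficients `vₙ`. -/
theorem BiOp.ord_conj_sOp_sub {ε : ℤˣ} (ħ : ℂ) {A B : BiOp} (hA : Ord ε 0 A.mat)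
    (hB : Ord ε 0 B.mat) (h1 : ∀ i, A.mat i i * B.mat i i = 1) :
    Ord ε (-1) (A * sOp ħ * B - sOp ħ).mat := by
  have hs : Ord ε 0 (sOp ħ).mat := by
    intro i j hij
    rw [sOp_mat, sMat, if_neg]
    rintro rfl
    simp at hij
  have h2 : Ord ε 0 (A * sOp ħ * B).mat := by
    have := (hA.matMul hs).matMul hB
    rwa [add_zero, add_zero] at this
  intro i j hij
  rw [mat_sub, Pi.sub_apply, Pi.sub_apply]
  by_cases h0 : 0 < ε * (j - i)
  · rw [h2 i j h0, hs i j h0, sub_zero]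
  · have h3 : ε * (j - i) = 0 := by omega
    have h4 : j = i := by
      rcases mul_eq_zero.1 h3 with h | h
      · exact absurd h (Units.ne_zero ε)
      · omega
    subst h4
    have hAs : Ord ε 0 (A * sOp ħ).mat := by
      have := hA.matMul hs
      rwa [add_zero] at this
    rw [mat_mul, hAs.matMul_diag hB]
    rw [sOp, mul_diag_apply, mul_right_comm, h1, one_mul]
    exact sub_eq_zero.2 (by simp [diag, diagMat])

namespace Factorization
variable {ħ : ℂ} {u : ℤ → ℤ → ℂ} (f : Factorization ħ u)

noncomputable def L : BiOpˣ := f.W * BiOp.shiftUnit 1 * f.W⁻¹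
noncomputable def M : BiOp := f.W.val * (BiOp.sOp ħ + BiOp.tOp) * (f.W⁻¹).val
noncomputable def Lbar : BiOpˣ := f.Wbar * BiOp.shiftUnit 1 * f.Wbar⁻¹
noncomputable def Mbar : BiOp := f.Wbar.val * (BiOp.sOp ħ - BiOp.tbarOp) * (f.Wbar⁻¹).val

/-- The quadruple obtained from the factorization. -/
noncomputable def ops : TodaOps where
  L := Units.map BiOp.toDesc.toRingHom.toMonoidHom f.L
  M := BiOp.toDesc f.M
  Lbar := Units.map BiOp.toAsc.toRingHom.toMonoidHom f.Lbar
  Mbar := BiOp.toAsc f.Mbar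

theorem L_zpow (n : ℤ) : (f.L ^ n : BiOpˣ).val = f.W.val * BiOp.shift n * (f.W⁻¹).val := by
  rw [L, conj_zpow, BiOp.shiftUnit_zpow]; rfl

theorem Lbar_zpow (n : ℤ) :
    (f.Lbar ^ n : BiOpˣ).val = f.Wbar.val * BiOp.shift n * (f.Wbar⁻¹).val := by
  rw [Lbar, conj_zpow, BiOp.shiftUnit_zpow]; rfl

theorem ops_Lpow (n : ℤ) :
    f.ops.Lpow n = BiOp.toDesc (f.W.val * BiOp.shift n * (f.W⁻¹).val) := by
  rw [TodaOps.Lpow, ← L_zpow, ops, ← map_zpow]; rfl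

theorem ops_Lbarpow (n : ℤ) :
    f.ops.Lbarpow n = BiOp.toAsc (f.Wbar.val * BiOp.shift n * (f.Wbar⁻¹).val) := by
  rw [TodaOps.Lbarpow, ← Lbar_zpow, ops, ← map_zpow]; rfl

theorem isDeterminedBy_ops : IsDeterminedBy ħ u f.ops := by
  refine ⟨Units.map BiOp.toDesc.toRingHom.toMonoidHom f.W,
    Units.map BiOp.toAsc.toRingHom.toMonoidHom f.Wbar, ?_, f.W_diag, ?_, ?_, ?_, ?_, ?_, ?_, ?_⟩
  · exact fun i j hij => f.W_lower i j (by simpa using hij)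
  · exact fun i j hij => f.Wbar_upper i j (by simpa using hij)
  · exact fun i => IsUnit.of_mul_eq_one _ (f.Wbar_diag_mul i)
  · rw [← f.U_mat]
    exact congrArg (fun A : BiOpˣ => A.val.mat) f.W_mul_U
  · have : f.L.val * f.W.val = f.W.val * BiOp.shift 1 := by
      rw [← Units.val_mul, L, inv_mul_cancel_right]; rfl
    exact congrArg BiOp.mat this
  · have : f.M * f.W.val = f.W.val * (BiOp.sOp ħ + BiOp.tOp) := by
      rw [M, mul_assoc, Units.inv_mul, mul_one]
    exact congrArg BiOp.mat this
  · have : f.Lbar.val * f.Wbar.val = f.Wbar.val * BiOp.shift 1 := by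
      rw [← Units.val_mul, Lbar, inv_mul_cancel_right]; rfl
    exact congrArg BiOp.mat this
  · have : f.Mbar * f.Wbar.val = f.Wbar.val * (BiOp.sOp ħ - BiOp.tbarOp) := by
      rw [Mbar, mul_assoc, Units.inv_mul, mul_one]
    exact congrArg BiOp.mat this

/-- The factors `W` and `Wbar` are unique and invertible, so they can be cancelled from the dressing
relations. -/
theorem eq_ops {T : TodaOps} (hT : IsDeterminedBy ħ u T) : T = f.ops := by
  obtain ⟨W, Wbar, h1, h2, h3, -, h5, h6, h7, h8, h9⟩ := hT
  obtain ⟨hW, hWbar⟩ := f.eq_of_matMul_evolve (W := W.val) (Wbar := Wbar.val)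
    (fun i j hij => h1 i j (by simpa using hij)) h2
    (fun i j hij => h3 i j (by simpa using hij)) h5
  obtain ⟨W', Wbar', k1, k2, k3, -, k5, k6, k7, k8, k9⟩ := f.isDeterminedBy_ops
  obtain ⟨hW', hWbar'⟩ := f.eq_of_matMul_evolve (W := W'.val) (Wbar := Wbar'.val)
    (fun i j hij => k1 i j (by simpa using hij)) k2
    (fun i j hij => k3 i j (by simpa using hij)) k5
  obtain rfl : W = W' := Units.ext (hW.trans hW'.symm)
  obtain rfl : Wbar = Wbar' := Units.ext (hWbar.trans hWbar'.symm)
  have e1 : T.L = f.ops.L := Units.ext (W.isUnit.mul_right_cancel (Subtype.ext (h6.trans k6.symm)))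
  have e2 : T.M = f.ops.M := W.isUnit.mul_right_cancel (Subtype.ext (h7.trans k7.symm))
  have e3 : T.Lbar = f.ops.Lbar :=
    Units.ext (Wbar.isUnit.mul_right_cancel (Subtype.ext (h8.trans k8.symm)))
  have e4 : T.Mbar = f.ops.Mbar := Wbar.isUnit.mul_right_cancel (Subtype.ext (h9.trans k9.symm))
  cases T
  simp only at e1 e2 e3 e4
  subst e1 e2 e3 e4
  rfl

end Factorization

/-! ### The Lax equations -/

namespace BiOp

/-- Here `K` is the generator of the bare flow: a power of `Λ` for the factor directly moved by the
time `x`, and `0` for the other one. Since the bare operator satisfies `ħ ∂Y = [K, Y]`, the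
contributions of `K` cancel after dressing and `B` remains. -/
theorem laxEq_of_dressing {ħ : ℂ} {x : Time} {B K Y : BiOp} {V : BiOpˣ}
    (hB : ħ • der x V.val * (V⁻¹).val = B - V.val * K * (V⁻¹).val)
    (hK : K * Y - Y * K = ħ • der x Y) :
    LaxEq ħ x B.mat (V.val * Y * (V⁻¹).val).mat := by
  have h := der_conj x V Y
  have h1 : ħ • der x (V.val * Y * (V⁻¹).val) =
      B * (V.val * Y * (V⁻¹).val) - V.val * Y * (V⁻¹).val * B := by
    rw [h, smul_add, smul_sub, ← smul_mul_assoc, ← smul_mul_assoc, ← mul_smul_comm,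
      ← smul_mul_assoc ħ (der x V.val), ← smul_mul_assoc ħ (V.val * der x Y), ← mul_smul_comm ħ V.val,
      ← hK, hB]
    have e1 : V.val * K * (V⁻¹).val * (V.val * Y * (V⁻¹).val) = V.val * (K * Y) * (V⁻¹).val := by
      simp only [mul_assoc, Units.inv_mul_cancel_left]
    have e2 : V.val * Y * (V⁻¹).val * (V.val * K * (V⁻¹).val) = V.val * (Y * K) * (V⁻¹).val := by
      simp only [mul_assoc, Units.inv_mul_cancel_left]
    rw [sub_mul, mul_sub, e1, e2, mul_sub, sub_mul]
    abel
  intro i j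
  have := congrArg (fun A : BiOp => A.mat i j) h1
  exact this

theorem ord_der {ε : ℤˣ} {a : ℤ} {A : BiOp} (x : Time) (hA : Ord ε a A.mat) :
    Ord ε a (der x A).mat := fun i j hij => by rw [der_apply, hA i j hij, map_zero]

theorem shift_mul_sOp_add_tOp (ħ : ℂ) (n : ℤ) :
    shift n * (sOp ħ + tOp) - (sOp ħ + tOp) * shift n = (ħ * n) • shift n := by
  have h : shift n * tOp = tOp * shift n := shift_mul_timeShift _ _ _ _ _
  rw [mul_add, add_mul, h, ← shift_mul_sOp]
  abel

theorem shift_mul_sOp_sub_tbarOp (ħ : ℂ) (n : ℤ) :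
    shift n * (sOp ħ - tbarOp) - (sOp ħ - tbarOp) * shift n = (ħ * n) • shift n := by
  have h : shift n * tbarOp = tbarOp * shift n := shift_mul_timeShift _ _ _ _ _
  rw [mul_sub, sub_mul, h, ← shift_mul_sOp]
  abel

theorem der_inl_sOp_add_tOp (ħ : ℂ) (n : ℕ+) :
    der (Sum.inl n) (sOp ħ + tOp) = ((n : ℕ) : ℂ) • shift (n : ℕ) := by
  rw [der_add, der_sOp, zero_add, tOp, der_timeShift_self]

theorem der_inr_sOp_add_tOp (ħ : ℂ) (n : ℕ+) : der (Sum.inr n) (sOp ħ + tOp) = 0 := by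
  rw [der_add, der_sOp, zero_add, tOp, der_timeShift_of_ne _ _ _ _ _ fun k => Sum.inr_ne_inl]

theorem der_inl_sOp_sub_tbarOp (ħ : ℂ) (n : ℕ+) : der (Sum.inl n) (sOp ħ - tbarOp) = 0 := by
  rw [der_sub, der_sOp, zero_sub, tbarOp, der_timeShift_of_ne _ _ _ _ _ fun k => Sum.inl_ne_inr,
    neg_zero]

theorem der_inr_sOp_sub_tbarOp (ħ : ℂ) (n : ℕ+) :
    der (Sum.inr n) (sOp ħ - tbarOp) = -(((n : ℕ) : ℂ) • shift (-((n : ℕ) : ℤ))) := by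
  rw [der_sub, der_sOp, zero_sub, tbarOp, der_timeShift_self]

end BiOp

namespace Factorization
open BiOp
variable {ħ : ℂ} {u : ℤ → ℤ → ℂ} (f : Factorization ħ u)

/-- The logarithmic derivative of `W` is strictly lower triangular. -/
theorem derW_apply (x : Time) {i j : ℤ} (hij : i ≤ j) :
    (ħ • der x f.W.val * (f.W⁻¹).val).mat i j = 0 := by
  have h1 : Ord 1 (-1) (ħ • der x f.W.val).mat := by
    intro i j hij
    change ħ • (der x f.W.val).mat i j = 0
    rw [der_apply]
    rcases eq_or_ne i j with rfl | hne
    · rw [f.W_diag, MvPowerSeries.pderiv_one, smul_zero]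
    · rw [f.W_lower i j (by simp at hij ⊢; omega), map_zero, smul_zero]
  have := h1.matMul f.W_inv_lower
  rw [add_zero] at this
  exact this i j (by simp; omega)

/-- The logarithmic derivative of `Wbar` is upper triangular. -/
theorem derWbar_apply (x : Time) {i j : ℤ} (hij : j < i) :
    (ħ • der x f.Wbar.val * (f.Wbar⁻¹).val).mat i j = 0 := by
  have h1 : Ord (-1) 0 (ħ • der x f.Wbar.val).mat := by
    intro i j hij
    change ħ • (der x f.Wbar.val).mat i j = 0
    rw [ord_der x f.Wbar_upper i j hij, smul_zero]
  have := h1.matMul f.Wbar_inv_upper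
  rw [add_zero] at this
  exact this i j (by simp; omega)

/-- Logarithmic derivative of the product `Wbar = W U`. -/
theorem derWbar_eq (x : Time) : ħ • der x f.Wbar.val * (f.Wbar⁻¹).val =
    ħ • der x f.W.val * (f.W⁻¹).val +
      f.W.val * (ħ • der x f.U.val) * (f.U⁻¹).val * (f.W⁻¹).val := by
  rw [← f.W_mul_U, Units.val_mul, der_mul, mul_inv_rev, Units.val_mul, smul_add, add_mul,
    ← smul_mul_assoc, ← mul_assoc, mul_assoc _ f.U.val, Units.mul_inv, mul_one, ← mul_smul_comm,
    ← mul_assoc]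

theorem derWbar_inl (hħ : ħ ≠ 0) (n : ℕ+) : ħ • der (Sum.inl n) f.W.val * (f.W⁻¹).val =
    ħ • der (Sum.inl n) f.Wbar.val * (f.Wbar⁻¹).val -
      f.W.val * shift (n : ℕ) * (f.W⁻¹).val := by
  rw [derWbar_eq, der_inl_evolve hħ f.U_mat, ← mul_assoc, mul_assoc _ f.U.val, Units.mul_inv,
    mul_one, add_sub_cancel_right]

theorem derWbar_inr (hħ : ħ ≠ 0) (n : ℕ+) : ħ • der (Sum.inr n) f.Wbar.val * (f.Wbar⁻¹).val =
    ħ • der (Sum.inr n) f.W.val * (f.W⁻¹).val -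
      f.Wbar.val * shift (-((n : ℕ) : ℤ)) * (f.Wbar⁻¹).val := by
  have e : (f.Wbar⁻¹).val = (f.U⁻¹).val * (f.W⁻¹).val := by
    rw [← Units.val_mul, ← mul_inv_rev, f.W_mul_U]
  have e' : f.Wbar.val = f.W.val * f.U.val := by rw [← Units.val_mul, f.W_mul_U]
  rw [derWbar_eq, der_inr_evolve hħ f.U_mat, mul_neg, neg_mul, neg_mul, ← sub_eq_add_neg, e, e']
  simp only [mul_assoc]

/-- `Lⁿ` is the logarithmic derivative of `Wbar`, upper triangular, minus that of `W`, strictly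
lower triangular. The splitting into projections is unique. The same argument for `tbar` gives the
negative part of `Lbar⁻ⁿ`. -/
theorem nonnegPart_Lpow (hħ : ħ ≠ 0) (n : ℕ+) : nonnegPart (f.ops.Lpow (n : ℕ)).1 =
    (ħ • der (Sum.inl n) f.Wbar.val * (f.Wbar⁻¹).val).mat := by
  have h := f.derWbar_inl hħ n
  funext i j
  simp only [nonnegPart, ops_Lpow, toDesc_val]
  split_ifs with hij
  · have h1 := congrArg (fun A : BiOp => A.mat i j) h
    change _ = (BiOp.mat _ i j - BiOp.mat _ i j : Coeffs) at h1
    rw [f.derW_apply _ hij] at h1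
    exact (sub_eq_zero.1 h1.symm).symm
  · rw [f.derWbar_apply _ (not_le.1 hij)]

theorem negPart_Lbarpow (hħ : ħ ≠ 0) (n : ℕ+) : negPart (f.ops.Lbarpow (-((n : ℕ) : ℤ))).1 =
    (ħ • der (Sum.inr n) f.W.val * (f.W⁻¹).val).mat := by
  have h := f.derWbar_inr hħ n
  funext i j
  simp only [negPart, ops_Lbarpow, toAsc_val]
  split_ifs with hij
  · have h1 := congrArg (fun A : BiOp => A.mat i j) h
    change _ = (BiOp.mat _ i j - BiOp.mat _ i j : Coeffs) at h1
    rw [f.derWbar_apply _ hij] at h1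
    exact (sub_eq_zero.1 h1.symm).symm
  · rw [f.derW_apply _ (not_lt.1 hij)]

theorem lax_inl (hħ : ħ ≠ 0) (n : ℕ+) {X : Mat}
    (hX : X ∈ ({(f.ops.Lpow 1).1, f.ops.M.1, (f.ops.Lbarpow 1).1, f.ops.Mbar.1} : Set Mat)) :
    LaxEq ħ (Sum.inl n) (nonnegPart (f.ops.Lpow (n : ℕ)).1) X := by
  have h := f.derWbar_inl hħ n
  have hbar : ħ • der (Sum.inl n) f.Wbar.val * (f.Wbar⁻¹).val =
      ħ • der (Sum.inl n) f.Wbar.val * (f.Wbar⁻¹).val - f.Wbar.val * 0 * (f.Wbar⁻¹).val := by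
    rw [mul_zero, zero_mul, sub_zero]
  rw [f.nonnegPart_Lpow hħ, ops_Lpow, ops_Lbarpow] at *
  rcases hX with rfl | rfl | rfl | rfl
  · refine laxEq_of_dressing h ?_
    rw [der_shift, smul_zero, ← shift_add, ← shift_add, add_comm, sub_self]
  · refine laxEq_of_dressing h ?_
    rw [der_inl_sOp_add_tOp, shift_mul_sOp_add_tOp, smul_smul]
    push_cast; rfl
  · refine laxEq_of_dressing hbar ?_
    rw [der_shift, smul_zero, zero_mul, mul_zero, sub_zero]
  · refine laxEq_of_dressing hbar ?_
    rw [der_inl_sOp_sub_tbarOp, smul_zero, zero_mul, mul_zero, sub_zero]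

theorem lax_inr (hħ : ħ ≠ 0) (n : ℕ+) {X : Mat}
    (hX : X ∈ ({(f.ops.Lpow 1).1, f.ops.M.1, (f.ops.Lbarpow 1).1, f.ops.Mbar.1} : Set Mat)) :
    LaxEq ħ (Sum.inr n) (negPart (f.ops.Lbarpow (-((n : ℕ) : ℤ))).1) X := by
  have h := f.derWbar_inr hħ n
  have hW : ħ • der (Sum.inr n) f.W.val * (f.W⁻¹).val =
      ħ • der (Sum.inr n) f.W.val * (f.W⁻¹).val - f.W.val * 0 * (f.W⁻¹).val := by
    rw [mul_zero, zero_mul, sub_zero]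
  rw [f.negPart_Lbarpow hħ, ops_Lpow, ops_Lbarpow] at *
  rcases hX with rfl | rfl | rfl | rfl
  · refine laxEq_of_dressing hW ?_
    rw [der_shift, smul_zero, zero_mul, mul_zero, sub_zero]
  · refine laxEq_of_dressing hW ?_
    rw [der_inr_sOp_add_tOp, smul_zero, zero_mul, mul_zero, sub_zero]
  · refine laxEq_of_dressing h ?_
    rw [der_shift, smul_zero, ← shift_add, ← shift_add, add_comm, sub_self]
  · refine laxEq_of_dressing h ?_
    rw [der_inr_sOp_sub_tbarOp, shift_mul_sOp_sub_tbarOp, ← neg_smul, smul_smul]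
    push_cast; rfl

theorem M_form : ∃ v : ℕ+ → ℤ → Coeffs,
    f.ops.M.1 = timeSum Sum.inl (fun n => (f.ops.Lpow (n : ℕ)).1) + sMat ħ
      + coeffSum v (fun n => (f.ops.Lpow (-((n : ℕ) : ℤ))).1) := by
  obtain ⟨v, hv⟩ := exists_coeffSum_eq
    (ord_conj_sOp_sub ħ f.W_lower f.W_inv_lower fun i => by rw [f.W_diag, f.W_inv_diag, one_mul])
    (P := fun n : ℕ+ => (f.ops.Lpow (-((n : ℕ) : ℤ))).1)
    (fun n => by
      rw [ops_Lpow, toDesc_val]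
      simpa using ord_conj_shift f.W_lower f.W_inv_lower (-((n : ℕ) : ℤ)))
    (fun n i => by
      rw [ops_Lpow, toDesc_val, Units.val_one, one_mul, sub_eq_add_neg,
        conj_shift_lead f.W_lower f.W_inv_lower, f.W_diag, f.W_inv_diag, one_mul]
      exact isUnit_one)
  refine ⟨v, ?_⟩
  simp only [ops_Lpow, toDesc_val] at hv ⊢
  rw [← hv, ← mul_timeSum_mul isTimeIndex_inl (fun n => shift (n : ℕ)) (τ := tOp) rfl, ← sOp_mat,
    ← mat_add, ← mat_add]
  change f.M.mat = _
  rw [M, mul_add, add_mul]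
  congr 1
  abel

theorem Mbar_form : ∃ v : ℕ+ → ℤ → Coeffs,
    f.ops.Mbar.1 = -timeSum Sum.inr (fun n => (f.ops.Lbarpow (-((n : ℕ) : ℤ))).1) + sMat ħ
      + coeffSum v (fun n => (f.ops.Lbarpow (n : ℕ)).1) := by
  obtain ⟨v, hv⟩ := exists_coeffSum_eq
    (ord_conj_sOp_sub ħ f.Wbar_upper f.Wbar_inv_upper f.Wbar_diag_mul)
    (P := fun n : ℕ+ => (f.ops.Lbarpow (n : ℕ)).1)
    (fun n => by
      rw [ops_Lbarpow, toAsc_val]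
      simpa using ord_conj_shift f.Wbar_upper f.Wbar_inv_upper ((n : ℕ) : ℤ))
    (fun n i => by
      rw [ops_Lbarpow, toAsc_val, Units.val_neg, Units.val_one, neg_one_mul, sub_neg_eq_add,
        conj_shift_lead f.Wbar_upper f.Wbar_inv_upper]
      exact (IsUnit.of_mul_eq_one _ (f.Wbar_diag_mul i)).mul
        (IsUnit.of_mul_eq_one _ (by rw [mul_comm, f.Wbar_diag_mul])))
  refine ⟨v, ?_⟩
  simp only [ops_Lbarpow, toAsc_val] at hv ⊢
  rw [← hv, ← mul_timeSum_mul isTimeIndex_inr (fun n => shift (-((n : ℕ) : ℤ))) (τ := tbarOp) rfl,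
    ← sOp_mat, ← mat_neg, ← mat_add, ← mat_add]
  change f.Mbar.mat = _
  rw [Mbar, mul_sub, sub_mul]
  congr 1
  abel

theorem conj_comm (V : BiOpˣ) {Y : BiOp}
    (h : shift 1 * Y - Y * shift 1 = (ħ * (1 : ℤ)) • shift 1) :
    V.val * shift 1 * (V⁻¹).val * (V.val * Y * (V⁻¹).val)
      - V.val * Y * (V⁻¹).val * (V.val * shift 1 * (V⁻¹).val) =
      ħ • (V.val * shift 1 * (V⁻¹).val) := by
  have e : ∀ A B : BiOp, V.val * A * (V⁻¹).val * (V.val * B * (V⁻¹).val) =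
      V.val * (A * B) * (V⁻¹).val := fun A B => by
    simp only [mul_assoc, Units.inv_mul_cancel_left]
  rw [e, e, ← sub_mul, ← mul_sub, h, Int.cast_one, mul_one, mul_smul_comm, smul_mul_assoc]

theorem isTodaSolution_ops (hħ : ħ ≠ 0) : IsTodaSolution ħ f.ops where
  L_zero i j hij := by
    rw [ops_Lpow, toDesc_val]
    exact ord_conj_shift f.W_lower f.W_inv_lower 1 i j (by simp; omega)
  L_lead i := by
    rw [ops_Lpow, toDesc_val, conj_shift_lead f.W_lower f.W_inv_lower, f.W_diag, f.W_inv_diag,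
      one_mul]
  Lbar_zero i j hij := by
    rw [ops_Lbarpow, toAsc_val]
    exact ord_conj_shift f.Wbar_upper f.Wbar_inv_upper 1 i j (by simp; omega)
  Lbar_lead i := by
    rw [ops_Lbarpow, toAsc_val, conj_shift_lead f.Wbar_upper f.Wbar_inv_upper]
    exact (IsUnit.of_mul_eq_one _ (f.Wbar_diag_mul i)).mul
      (IsUnit.of_mul_eq_one _ (by rw [mul_comm, f.Wbar_diag_mul]))
  M_form := f.M_form
  Mbar_form := f.Mbar_form
  comm := by
    rw [ops_Lpow]
    exact congrArg toDesc (conj_comm f.W (shift_mul_sOp_add_tOp ħ 1))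
  comm_bar := by
    rw [ops_Lbarpow]
    exact congrArg toAsc (conj_comm f.Wbar (shift_mul_sOp_sub_tbarOp ħ 1))
  lax_t n _ hX := f.lax_inl hħ n hX
  lax_tbar n _ hX := f.lax_inr hħ n hX

end Factorization

/-! ### String equations from recursions of the diagonal entries, and the `c = 1` matrix. -/

/-! ### The string equations of the determined solution -/

namespace BiOp

theorem coeff_smul_add_smul (x y : ℂ) (A B : BiOp) (m : Time →₀ ℕ) (i j : ℤ) :
    MvPowerSeries.coeff m ((x • A + y • B).mat i j) =
      x * MvPowerSeries.coeff m (A.mat i j) + y * MvPowerSeries.coeff m (B.mat i j) := by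
  change MvPowerSeries.coeff m (x • A.mat i j + y • B.mat i j) = _
  rw [map_add, map_smul, map_smul, smul_eq_mul, smul_eq_mul]

theorem shift_mul_evolve {ħ : ℂ} {u : ℤ → ℤ → ℂ} {U : BiOp} (hU : U.mat = evolve ħ u) (n : ℤ) :
    (shift n * U).mat = evolve ħ fun i j => u (i + n) j := by
  funext i j
  ext m
  rw [shift_mul_apply, hU, coeff_evolve, coeff_evolve, add_right_comm]

end BiOp

namespace Factorization
open BiOp

theorem Wbar_conj {ħ : ℂ} {u : ℤ → ℤ → ℂ} (f : Factorization ħ u) (A : BiOp) :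
    f.Wbar.val * A * (f.Wbar⁻¹).val =
      f.W.val * (f.U.val * A * (f.U⁻¹).val) * (f.W⁻¹).val := by
  rw [← f.W_mul_U, mul_inv_rev, Units.val_mul, Units.val_mul]
  simp only [mul_assoc]

theorem conj_mul_conj (V : BiOpˣ) (A B : BiOp) :
    V.val * A * (V⁻¹).val * (V.val * B * (V⁻¹).val) = V.val * (A * B) * (V⁻¹).val := by
  simp only [mul_assoc, Units.inv_mul_cancel_left]

variable {ħ : ℂ} {d : ℤ → ℂ} (f : Factorization ħ (diagFun d))

/-- In the coefficient of the monomial `m`, the initial matrix is read at column `j + wtTbar m`, so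
this is where the affine factor is evaluated. -/
theorem coeff_U_add {β : ℤ} {x y : ℂ} (hd : ∀ i : ℤ, d (i + β) = (x * (ħ * i) + y) * d i)
    (m : Time →₀ ℕ) (i j : ℤ) : MvPowerSeries.coeff m (f.U.val.mat (i + β) (j + β)) =
      (x * (ħ * (j + wtTbar m)) + y) * MvPowerSeries.coeff m (f.U.val.mat i j) := by
  rw [f.U_mat, coeff_evolve, coeff_evolve, mul_left_comm]
  congr 1
  simp only [diagFun]
  by_cases h : i + (wtT m : ℤ) = j + (wtTbar m : ℤ)
  · have h' : i + β + (wtT m : ℤ) = j + β + (wtTbar m : ℤ) := by omega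
    rw [if_pos h, if_pos h', h', h, add_right_comm j, hd]
    push_cast; ring
  · have h' : ¬ i + β + (wtT m : ℤ) = j + β + (wtTbar m : ℤ) := by omega
    rw [if_neg h, if_neg h', mul_zero]

/-- The factor `ħ (j + wtTbar m)` is the action of `s - ∑ n tbar_n Λ⁻ⁿ` from the right. Conjugation
by `W` turns this relation into the first string equation. -/
theorem shift_mul_U (hħ : ħ ≠ 0) {β : ℤ} {x y : ℂ}
    (hd : ∀ i : ℤ, d (i + β) = (x * (ħ * i) + y) * d i) :
    shift β * f.U.val = f.U.val * (x • (sOp ħ - tbarOp) + y • (1 : BiOp)) * shift β := by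
  refine BiOp.ext ?_
  funext i j
  ext m
  have h := f.coeff_U_add hd m i (j - β)
  rw [sub_add_cancel] at h
  rw [shift_mul_apply, mul_shift_apply, h, mul_add f.U.val, mul_smul_comm, mul_smul_comm, mul_one,
    coeff_smul_add_smul, coeff_mul_sOp_sub_tbarOp hħ f.U_mat]
  ring

/-- The same recursion read on the rows. On the support of `U` the evaluation point is also `i - β +
wtT m`; the displacement by `β` produces the correction `-x ħ β`, which changes the constant of the
first string equation into that of the second. -/
theorem U_mul_shift (hħ : ħ ≠ 0) {β : ℤ} {x y : ℂ}
    (hd : ∀ i : ℤ, d (i + β) = (x * (ħ * i) + y) * d i) :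
    f.U.val * shift (-β) =
      (x • (sOp ħ + tOp) + (y - x * (ħ * β)) • (1 : BiOp)) * shift (-β) * f.U.val := by
  refine BiOp.ext ?_
  funext i j
  ext m
  have h := f.coeff_U_add hd m (i + -β) j
  rw [neg_add_cancel_right] at h
  rw [mul_assoc, mul_shift_apply, sub_neg_eq_add, h, add_mul _ _ (shift (-β) * f.U.val),
    smul_mul_assoc, smul_mul_assoc, one_mul, coeff_smul_add_smul, coeff_sOp_add_tOp_mul hħ (shift_mul_evolve f.U_mat (-β)),
    shift_mul_apply]
  by_cases h : i + -β + (wtT m : ℤ) = j + (wtTbar m : ℤ)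
  · have hc : (i : ℂ) - β + wtT m = j + wtTbar m := by
      have := congrArg (Int.cast : ℤ → ℂ) h
      push_cast at this
      linear_combination this
    rw [← hc]
    ring
  · have : MvPowerSeries.coeff m (f.U.val.mat (i + -β) j) = 0 := by
      rw [f.U_mat, coeff_evolve, diagFun, if_neg h, mul_zero]
    simp only [this, mul_zero, add_zero]

theorem c1StringEqs_ops (hħ : ħ ≠ 0) {β : ℤ} (hβ : β ≠ 0)
    (hd : ∀ i : ℤ, d (i + β) =
      (-(1 / (β : ℂ)) * (ħ * i) + (1 - ħ * (((β : ℂ) + 1) / (2 * (β : ℂ))))) * d i) :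
    C1StringEqs ħ β f.ops := by
  have hβ' : (β : ℂ) ≠ 0 := Int.cast_ne_zero.2 hβ
  constructor
  · have h1 : f.W.val * shift β * (f.W⁻¹).val = f.Wbar.val * ((-(1 / (β : ℂ))) • (sOp ħ - tbarOp) +
        (1 - ħ * (((β : ℂ) + 1) / (2 * (β : ℂ)))) • (1 : BiOp)) * (f.Wbar⁻¹).val *
        (f.Wbar.val * shift β * (f.Wbar⁻¹).val) := by
      rw [conj_mul_conj, Wbar_conj, ← mul_assoc f.U.val, ← f.shift_mul_U hħ hd, mul_assoc (shift β),
        Units.mul_inv, mul_one]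
    have h2 : f.Wbar.val * ((-(1 / (β : ℂ))) • (sOp ħ - tbarOp) +
        (1 - ħ * (((β : ℂ) + 1) / (2 * (β : ℂ)))) • (1 : BiOp)) * (f.Wbar⁻¹).val =
        (-(1 / (β : ℂ))) • f.Mbar - (ħ * (((β : ℂ) + 1) / (2 * (β : ℂ)))) • (1 : BiOp) + 1 := by
      rw [mul_add, mul_smul_comm, mul_smul_comm, mul_one, add_mul, smul_mul_assoc, smul_mul_assoc,
        Units.mul_inv, sub_smul, one_smul, Mbar]
      abel
    have h3 := congrArg BiOp.mat h1
    rw [h2] at h3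
    rw [ops_Lpow, ops_Lbarpow]
    exact h3
  · have h1 : f.Wbar.val * shift (-β) * (f.Wbar⁻¹).val = f.W.val * ((-(1 / (β : ℂ))) • (sOp ħ + tOp)
        + (1 - ħ * (((β : ℂ) + 1) / (2 * (β : ℂ))) - -(1 / (β : ℂ)) * (ħ * β)) • (1 : BiOp)) *
        (f.W⁻¹).val * (f.W.val * shift (-β) * (f.W⁻¹).val) := by
      rw [conj_mul_conj, Wbar_conj, f.U_mul_shift hħ hd, mul_assoc _ f.U.val, Units.mul_inv, mul_one]
    have e : 1 - ħ * (((β : ℂ) + 1) / (2 * (β : ℂ))) - -(1 / (β : ℂ)) * (ħ * β) =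
        ħ * (((β : ℂ) - 1) / (2 * (β : ℂ))) + 1 := by
      field_simp
      ring
    have h2 : f.W.val * ((-(1 / (β : ℂ))) • (sOp ħ + tOp)
        + (ħ * (((β : ℂ) - 1) / (2 * (β : ℂ))) + 1) • (1 : BiOp)) * (f.W⁻¹).val =
        (-(1 / (β : ℂ))) • f.M + (ħ * (((β : ℂ) - 1) / (2 * (β : ℂ)))) • (1 : BiOp) + 1 := by
      rw [mul_add, mul_smul_comm, mul_smul_comm, mul_one, add_mul, smul_mul_assoc, smul_mul_assoc,
        Units.mul_inv, add_smul, one_smul, M, add_assoc]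
    have h3 := congrArg BiOp.mat h1
    rw [e, h2] at h3
    rw [ops_Lpow, ops_Lbarpow]
    exact h3

end Factorization

/-! ### The solutions of the compactified `c = 1` string theory -/

/-- The diagonal entries of `c1Matrix ħ β`. -/
noncomputable def c1Diag (ħ : ℂ) (β i : ℤ) : ℂ :=
  (-ħ) ^ (((i : ℂ) + 1 / 2) / (β : ℂ)) *
    (Complex.Gamma (1 / 2 - 1 / ħ + ((i : ℂ) + 1 / 2) / (β : ℂ))
      / Complex.Gamma (1 / 2 - 1 / ħ))

theorem c1Matrix_eq (ħ : ℂ) (β : ℤ) : c1Matrix ħ β = diagFun (c1Diag ħ β) := rfl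

theorem c1Diag_ne_zero {ħ : ℂ} (hħ : ħ ≠ 0) {β : ℤ} (h : C1Regular ħ β) (i : ℤ) :
    c1Diag ħ β i ≠ 0 := by
  refine mul_ne_zero ?_ (div_ne_zero (Complex.Gamma_ne_zero (h.2 i)) (Complex.Gamma_ne_zero h.1))
  rw [Ne, Complex.cpow_eq_zero_iff]
  exact fun h0 => neg_ne_zero.2 hħ h0.1

/-- The step `i ↦ i + β` raises the Gamma argument `z` by one. It yields the factor `z` from the
functional equation and `-ħ` from the power, and `-ħ z` is the affine factor of the string equation.
-/
theorem c1Diag_add {ħ : ℂ} (hħ : ħ ≠ 0) {β : ℤ} (hβ : β ≠ 0) (h : C1Regular ħ β) (i : ℤ) :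
    c1Diag ħ β (i + β) =
      (-(1 / (β : ℂ)) * (ħ * i) + (1 - ħ * (((β : ℂ) + 1) / (2 * (β : ℂ))))) * c1Diag ħ β i := by
  have hβ' : (β : ℂ) ≠ 0 := Int.cast_ne_zero.2 hβ
  have e : (((i + β : ℤ) : ℂ) + 1 / 2) / (β : ℂ) = ((i : ℂ) + 1 / 2) / (β : ℂ) + 1 := by
    push_cast; field_simp; ring
  have h0 : 1 / 2 - 1 / ħ + ((i : ℂ) + 1 / 2) / (β : ℂ) ≠ 0 := by simpa using h.2 i 0
  rw [c1Diag, c1Diag, e, Complex.cpow_add _ _ (neg_ne_zero.2 hħ), Complex.cpow_one, ← add_assoc,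
    Complex.Gamma_add_one _ h0]
  have e2 : -(1 / (β : ℂ)) * (ħ * i) + (1 - ħ * (((β : ℂ) + 1) / (2 * (β : ℂ)))) =
      -ħ * (1 / 2 - 1 / ħ + ((i : ℂ) + 1 / 2) / (β : ℂ)) := by
    field_simp; ring
  rw [e2]
  ring

theorem existsUnique_isDeterminedBy (ħ : ℂ) {d : ℤ → ℂ} (hd : ∀ i, d i ≠ 0) :
    ∃! T : TodaOps, IsDeterminedBy ħ (diagFun d) T := by
  obtain ⟨f⟩ := exists_factorization ħ hd
  exact ⟨f.ops, f.isDeterminedBy_ops, fun T hT => f.eq_ops hT⟩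

theorem IsDeterminedBy.isTodaSolution {ħ : ℂ} (hħ : ħ ≠ 0) {d : ℤ → ℂ} (hd : ∀ i, d i ≠ 0)
    {T : TodaOps} (hT : IsDeterminedBy ħ (diagFun d) T) : IsTodaSolution ħ T := by
  obtain ⟨f⟩ := exists_factorization ħ hd
  rw [f.eq_ops hT]
  exact f.isTodaSolution_ops hħ

theorem IsDeterminedBy.c1StringEqs {ħ : ℂ} (hħ : ħ ≠ 0) {β : ℤ} (hβ : β ≠ 0)
    (h : C1Regular ħ β) {T : TodaOps} (hT : IsDeterminedBy ħ (c1Matrix ħ β) T) :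
    C1StringEqs ħ β T := by
  obtain ⟨f⟩ := exists_factorization ħ (c1Diag_ne_zero hħ h)
  rw [f.eq_ops hT]
  exact f.c1StringEqs_ops hħ hβ (c1Diag_add hħ hβ h)

/-- The scalar is absorbed by `Wbar`, and conjugation by `Wbar` does not see it. -/
theorem IsDeterminedBy.of_smul {ħ κ : ℂ} (hκ : κ ≠ 0) {u u' : ℤ → ℤ → ℂ}
    (hu : ∀ i j, u i j = κ * u' i j) {T : TodaOps} (hT : IsDeterminedBy ħ u T) :
    IsDeterminedBy ħ u' T := by
  obtain ⟨W, Wbar, h1, h2, h3, h4, h5, h6, h7, h8, h9⟩ := hT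
  have he : evolve ħ u' = κ⁻¹ • evolve ħ u := by
    funext i j
    ext m
    change _ = κ⁻¹ * MvPowerSeries.coeff m (evolve ħ u i j)
    rw [coeff_evolve, coeff_evolve, hu]
    field_simp
  have hv : ∀ ε : ℤˣ, ∀ A : (Op ε)ˣ, (A * Units.map (algebraMap ℂ (Op ε)).toMonoidHom
      (Units.mk0 κ⁻¹ (inv_ne_zero hκ))).val.1 = κ⁻¹ • A.val.1 := by
    intro ε A
    have : A.val * algebraMap ℂ (Op ε) κ⁻¹ = κ⁻¹ • A.val := by
      rw [← Algebra.commutes, ← Algebra.smul_def]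
    exact congrArg Subtype.val this
  refine ⟨W, Wbar * Units.map (algebraMap ℂ AscOp).toMonoidHom
    (Units.mk0 κ⁻¹ (inv_ne_zero hκ)), h1, h2, ?_, ?_, ?_, h6, h7, ?_, ?_⟩
  · intro i j hij
    rw [hv]
    change κ⁻¹ • Wbar.val.1 i j = 0
    rw [h3 i j hij, smul_zero]
  · intro i
    rw [hv]
    change IsUnit (κ⁻¹ • Wbar.val.1 i i)
    rw [MvPowerSeries.smul_eq_C_mul]
    exact ((isUnit_iff_ne_zero.2 (inv_ne_zero hκ)).map _).mul (h4 i)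
  · rw [hv, he, matMul_smul, h5]
  · rw [hv, smul_matMul, matMul_smul, h8]
  · rw [hv, smul_matMul, matMul_smul, h9]


/-! ### The Kontsevich matrix at `p = -1` through contour integrals. -/

/-! ### Integrals of Hankel type -/

section Hankel
open Complex Filter Topology MeasureTheory

/-- The integrand `z^a exp(z²)`. -/
noncomputable def hankelFun (a z : ℂ) : ℂ := z ^ a * exp (z ^ 2)

/-- The integral of `z^a exp(z²)` along the line `Re z = x`, divided by `√-1`. -/
noncomputable def hankelIntegral (x : ℝ) (a : ℂ) : ℂ := ∫ y : ℝ, hankelFun a (x + y * I)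

/-- One Gaussian bound, uniform in the strip, serves both integrability and the vanishing of the
horizontal sides in the contour shift. A negative `Re a` is harmless only on `x = 1`, where `‖z‖ ≥
1`. -/
theorem norm_hankelFun_le {x : ℝ} (hx0 : 0 ≤ x) (hx1 : x ≤ 1) {a : ℂ} {k : ℕ} (hk : a.re ≤ k)
    (h : x = 1 ∨ 0 ≤ a.re) (y : ℝ) : ‖hankelFun a (x + y * I)‖ ≤
      Real.exp (Real.pi * |a.im|) * (2 ^ k * k.factorial) * Real.exp 2 *
        Real.exp (-(1 / 2) * y ^ 2) := by
  set z : ℂ := x + y * I with hz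
  have hre : z.re = x := by simp [hz]
  have him : z.im = y := by simp [hz]
  have hB : (1 : ℝ) ≤ 1 + y ^ 2 := by nlinarith [sq_nonneg y]
  have hzn : ‖z‖ ^ 2 = x ^ 2 + y ^ 2 := by
    rw [← normSq_eq_norm_sq, normSq_apply, hre, him]; ring
  have hzB : ‖z‖ ^ 2 ≤ 1 + y ^ 2 := by nlinarith
  have h1 : ‖z‖ ^ a.re ≤ (1 + y ^ 2) ^ k := by
    by_cases ha : 0 ≤ a.re
    · have hz1 : ‖z‖ ≤ 1 + y ^ 2 := by nlinarith [norm_nonneg z]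
      calc ‖z‖ ^ a.re ≤ (1 + y ^ 2) ^ a.re := Real.rpow_le_rpow (norm_nonneg _) hz1 ha
        _ ≤ (1 + y ^ 2) ^ (k : ℝ) := Real.rpow_le_rpow_of_exponent_le hB hk
        _ = _ := Real.rpow_natCast _ _
    · have hx : x = 1 := h.resolve_right ha
      have hz1 : 1 ≤ ‖z‖ := by
        rw [hx] at hzn
        nlinarith [norm_nonneg z, sq_nonneg y]
      calc ‖z‖ ^ a.re ≤ 1 := Real.rpow_le_one_of_one_le_of_nonpos hz1 (not_le.1 ha).le
        _ ≤ _ := one_le_pow₀ hB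
  have h2 : ‖z ^ a‖ ≤ Real.exp (Real.pi * |a.im|) * (1 + y ^ 2) ^ k := by
    refine (norm_cpow_le z a).trans ?_
    rw [div_eq_mul_inv, ← Real.exp_neg, mul_comm]
    refine mul_le_mul (Real.exp_le_exp.2 ?_) h1 (by positivity) (by positivity)
    rw [← neg_mul]
    calc -arg z * a.im ≤ |-arg z * a.im| := le_abs_self _
      _ = |arg z| * |a.im| := by rw [abs_mul, abs_neg]
      _ ≤ _ := mul_le_mul_of_nonneg_right (abs_arg_le_pi z) (abs_nonneg _)
  have h3 : ‖exp (z ^ 2)‖ ≤ Real.exp 1 * Real.exp (-y ^ 2) := by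
    rw [norm_exp, ← Real.exp_add]
    refine Real.exp_le_exp.2 ?_
    have : (z ^ 2).re = x ^ 2 - y ^ 2 := by
      rw [sq, mul_re, hre, him]; ring
    rw [this]
    nlinarith
  -- The polynomial growth is paid for with half of the Gaussian decay, through `t^k / k! ≤ e^t`.
  have h4 : (1 + y ^ 2) ^ k ≤ 2 ^ k * k.factorial * Real.exp ((1 + y ^ 2) / 2) := by
    have := Real.pow_div_factorial_le_exp ((1 + y ^ 2) / 2) (by positivity) k
    rw [div_pow, div_div, div_le_iff₀ (by positivity)] at this
    linarith
  have h5 : Real.exp ((1 + y ^ 2) / 2) * (Real.exp 1 * Real.exp (-y ^ 2)) ≤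
      Real.exp 2 * Real.exp (-(1 / 2) * y ^ 2) := by
    rw [← Real.exp_add, ← Real.exp_add, ← Real.exp_add]
    refine Real.exp_le_exp.2 ?_
    linarith
  rw [hankelFun, norm_mul]
  calc ‖z ^ a‖ * ‖exp (z ^ 2)‖ ≤ (Real.exp (Real.pi * |a.im|) *
        (2 ^ k * k.factorial * Real.exp ((1 + y ^ 2) / 2))) *
        (Real.exp 1 * Real.exp (-y ^ 2)) := by
        refine mul_le_mul (h2.trans ?_) h3 (norm_nonneg _) (by positivity)
        exact mul_le_mul_of_nonneg_left h4 (by positivity)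
    _ = Real.exp (Real.pi * |a.im|) * (2 ^ k * k.factorial) *
        (Real.exp ((1 + y ^ 2) / 2) * (Real.exp 1 * Real.exp (-y ^ 2))) := by ring
    _ ≤ Real.exp (Real.pi * |a.im|) * (2 ^ k * k.factorial) *
        (Real.exp 2 * Real.exp (-(1 / 2) * y ^ 2)) :=
        mul_le_mul_of_nonneg_left h5 (by positivity)
    _ = _ := by ring

theorem integrable_hankelFun {x : ℝ} (hx0 : 0 ≤ x) (hx1 : x ≤ 1) {a : ℂ}
    (h : x = 1 ∨ 0 < a.re) : Integrable fun y : ℝ => hankelFun a (x + y * I) := by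
  obtain ⟨k, hk⟩ := exists_nat_ge a.re
  have hg : Integrable fun y : ℝ => Real.exp (Real.pi * |a.im|) * (2 ^ k * k.factorial) *
      Real.exp 2 * Real.exp (-(1 / 2) * y ^ 2) :=
    (integrable_exp_neg_mul_sq (by norm_num : (0 : ℝ) < 1 / 2)).const_mul _
  refine hg.mono' ?_ (Eventually.of_forall fun y =>
    norm_hankelFun_le hx0 hx1 hk (h.imp id le_of_lt) y)
  have hz : Continuous fun y : ℝ => (x + y * I : ℂ) := by fun_prop
  refine Continuous.aestronglyMeasurable ?_
  refine Continuous.mul (continuous_iff_continuousAt.2 fun y => ?_) (by fun_prop)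
  rcases h with rfl | h
  · refine ContinuousAt.cpow hz.continuousAt continuousAt_const (Or.inl ?_)
    simp
  · exact ContinuousAt.comp (f := fun y : ℝ => (x + y * I : ℂ)) (g := fun z : ℂ => z ^ a)
      (continuousAt_cpow_const_of_re_pos (Or.inl (by simpa using hx0)) h) hz.continuousAt

/-- Integration by parts. -/
theorem hankelIntegral_rec (a : ℂ) :
    a * hankelIntegral 1 (a - 1) + 2 * hankelIntegral 1 (a + 1) = 0 := by
  have hne : ∀ y : ℝ, ((1 : ℝ) + y * I : ℂ) ≠ 0 := fun y h => by
    have := congrArg re h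
    simp at this
  have hi : ∀ a : ℂ, Integrable fun y : ℝ => hankelFun a ((1 : ℝ) + y * I) := fun a =>
    integrable_hankelFun zero_le_one le_rfl (Or.inl rfl)
  have hd : ∀ y : ℝ, HasDerivAt (fun y : ℝ => hankelFun a ((1 : ℝ) + y * I))
      (I * (a * hankelFun (a - 1) ((1 : ℝ) + y * I) + 2 * hankelFun (a + 1) ((1 : ℝ) + y * I))) y := by
    intro y
    have h1 : HasDerivAt (fun y : ℝ => ((1 : ℝ) + y * I : ℂ)) I y := by
      have := ((hasDerivAt_id y).ofReal_comp.mul_const I).const_add ((1 : ℝ) : ℂ)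
      simpa using this
    have hs : ((1 : ℝ) + y * I : ℂ) ∈ slitPlane := Or.inl (by simp)
    have h2 : HasDerivAt (hankelFun a) (a * ((1 : ℝ) + y * I : ℂ) ^ (a - 1) *
        exp (((1 : ℝ) + y * I : ℂ) ^ 2) + ((1 : ℝ) + y * I : ℂ) ^ a *
        (exp (((1 : ℝ) + y * I : ℂ) ^ 2) * (2 * ((1 : ℝ) + y * I)))) ((1 : ℝ) + y * I) := by
      have e1 := (hasDerivAt_id ((1 : ℝ) + y * I : ℂ)).cpow_const (c := a) hs
      have e2 := ((hasDerivAt_id ((1 : ℝ) + y * I : ℂ)).pow 2).cexp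
      have h3 : HasDerivAt (hankelFun a) _ ((1 : ℝ) + y * I) := e1.mul e2
      exact h3.congr_deriv (by simp)
    have h3 := HasDerivAt.scomp y h2 h1
    refine h3.congr_deriv ?_
    simp only [hankelFun]
    rw [cpow_add _ _ (hne y), cpow_one, smul_eq_mul]
    ring
  have h := integral_eq_zero_of_hasDerivAt_of_integrable hd
    ((((hi (a - 1)).const_mul a).add ((hi (a + 1)).const_mul 2)).const_mul I) (hi a)
  rw [integral_const_mul, integral_add ((hi (a - 1)).const_mul a) ((hi (a + 1)).const_mul 2),
    integral_const_mul, integral_const_mul] at h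
  exact (mul_eq_zero.1 h).resolve_left I_ne_zero

/-- Shift of the contour to the imaginary axis. -/
theorem hankelIntegral_one_eq_zero {a : ℂ} (ha : 0 < a.re) :
    hankelIntegral 1 a = hankelIntegral 0 a := by
  -- Cauchy's theorem needs only continuity on the boundary. The branch point `0` lies there, and
  -- `Re a > 0` makes the integrand continuous at it.
  have hrect : ∀ R : ℝ, (∫ x : ℝ in (0 : ℝ)..1, hankelFun a (x + (-R : ℝ) * I)) -
      (∫ x : ℝ in (0 : ℝ)..1, hankelFun a (x + R * I)) +
      I * (∫ y : ℝ in (-R)..R, hankelFun a ((1 : ℝ) + y * I)) -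
      I * (∫ y : ℝ in (-R)..R, hankelFun a ((0 : ℝ) + y * I)) = 0 := by
    intro R
    have := integral_boundary_rect_eq_zero_of_continuousOn_of_differentiableOn (hankelFun a)
      ⟨0, -R⟩ ⟨1, R⟩ ?_ ?_
    · simpa only [smul_eq_mul] using this
    · intro z hz
      have hz0 : 0 ≤ z.re := by
        have := hz.1
        simp only [Set.mem_preimage, Set.uIcc_of_le zero_le_one] at this
        exact this.1
      refine (ContinuousAt.mul (continuousAt_cpow_const_of_re_pos (Or.inl hz0) ha)
        ?_).continuousWithinAt
      fun_prop
    · intro z hz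
      have hz0 : 0 < z.re := by
        have := hz.1
        simp only [Set.mem_preimage] at this
        simpa using this.1
      refine DifferentiableAt.differentiableWithinAt ?_
      unfold hankelFun
      refine DifferentiableAt.mul ?_ (by fun_prop)
      exact differentiableAt_id.cpow_const (Or.inl hz0)
  obtain ⟨k, hk⟩ := exists_nat_ge a.re
  set C := Real.exp (Real.pi * |a.im|) * (2 ^ k * k.factorial) * Real.exp 2 with hC
  have hC0 : Tendsto (fun R : ℝ => C * Real.exp (-(1 / 2) * R ^ 2)) atTop (𝓝 0) := by
    rw [← mul_zero C]
    refine Tendsto.const_mul C (Real.tendsto_exp_atBot.comp ?_)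
    exact (tendsto_pow_atTop (two_ne_zero)).const_mul_atTop_of_neg (by norm_num)
  have hb : ∀ R : ℝ, ‖∫ x : ℝ in (0 : ℝ)..1, hankelFun a (x + R * I)‖ ≤
      C * Real.exp (-(1 / 2) * R ^ 2) := by
    intro R
    have := intervalIntegral.norm_integral_le_of_norm_le_const (a := (0 : ℝ)) (b := 1)
      (C := C * Real.exp (-(1 / 2) * R ^ 2)) (f := fun x : ℝ => hankelFun a (x + R * I))
      fun x hx => by
        rw [Set.uIoc_of_le zero_le_one] at hx
        exact norm_hankelFun_le hx.1.le hx.2 hk (Or.inr ha.le) R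
    simpa using this
  have t1 : Tendsto (fun R : ℝ => ∫ x : ℝ in (0 : ℝ)..1, hankelFun a (x + R * I)) atTop (𝓝 0) :=
    squeeze_zero_norm hb hC0
  have t2 : Tendsto (fun R : ℝ => ∫ x : ℝ in (0 : ℝ)..1, hankelFun a (x + (-R : ℝ) * I)) atTop
      (𝓝 0) := squeeze_zero_norm (fun R => by simpa using hb (-R)) hC0
  have t3 := intervalIntegral_tendsto_integral
    (integrable_hankelFun (a := a) zero_le_one le_rfl (Or.inl rfl)) tendsto_neg_atTop_atBot tendsto_id
  have t4 := intervalIntegral_tendsto_integral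
    (integrable_hankelFun (a := a) le_rfl zero_le_one (Or.inr ha)) tendsto_neg_atTop_atBot tendsto_id
  have t := ((t2.sub t1).add (t3.const_mul I)).sub (t4.const_mul I)
  simp only [id] at t
  have t0 := tendsto_nhds_unique t (by simp only [hrect]; exact tendsto_const_nhds)
  rw [sub_zero, zero_add, ← mul_sub] at t0
  exact sub_eq_zero.1 ((mul_eq_zero.1 t0).resolve_left I_ne_zero)

/-- On the two halves of the imaginary axis `z^a` has the phases `exp(±iπa/2)`, which add up to the
cosine; the substitution `y ↦ y²` gives the Gamma integral. -/
theorem hankelIntegral_zero {a : ℂ} (ha : 0 < a.re) :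
    hankelIntegral 0 a = cos (Real.pi * a / 2) * Gamma ((a + 1) / 2) := by
  have hi := integrable_hankelFun (a := a) le_rfl zero_le_one (Or.inr ha)
  have hpos : ∀ y : ℝ, 0 < y → hankelFun a ((0 : ℝ) + y * I) =
      exp (Real.pi * a / 2 * I) * ((y : ℂ) ^ a * exp (-(y : ℂ) ^ 2)) := by
    intro y hy
    have hy' : (y : ℂ) ≠ 0 := ofReal_ne_zero.2 hy.ne'
    have e : ((0 : ℝ) + y * I : ℂ) = I * y := by push_cast; ring
    rw [hankelFun, e, cpow_def_of_ne_zero (mul_ne_zero I_ne_zero hy'),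
      log_mul_ofReal y hy I I_ne_zero, log_I, cpow_def_of_ne_zero hy', ← ofReal_log hy.le,
      ← exp_add, ← exp_add, ← exp_add, mul_pow, I_sq]
    congr 1
    ring
  have hneg : ∀ y : ℝ, 0 < y → hankelFun a ((0 : ℝ) + (-y : ℝ) * I) =
      exp (-(Real.pi * a / 2) * I) * ((y : ℂ) ^ a * exp (-(y : ℂ) ^ 2)) := by
    intro y hy
    have hy' : (y : ℂ) ≠ 0 := ofReal_ne_zero.2 hy.ne'
    have e : ((0 : ℝ) + (-y : ℝ) * I : ℂ) = -I * y := by push_cast; ring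
    rw [hankelFun, e, cpow_def_of_ne_zero (mul_ne_zero (neg_ne_zero.2 I_ne_zero) hy'),
      log_mul_ofReal y hy (-I) (neg_ne_zero.2 I_ne_zero), log_neg_I, cpow_def_of_ne_zero hy',
      ← ofReal_log hy.le, ← exp_add, ← exp_add, ← exp_add, mul_pow, neg_sq, I_sq]
    congr 1
    ring
  have hG : ∫ y : ℝ in Set.Ioi 0, (y : ℂ) ^ a * exp (-(y : ℂ) ^ 2) = Gamma ((a + 1) / 2) / 2 := by
    have hs : 0 < ((a + 1) / 2).re := by
      have : ((a + 1) / 2).re = (a.re + 1) / 2 := by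
        rw [show (a + 1) / 2 = (a + 1) * ((1 / 2 : ℝ) : ℂ) by push_cast; ring, re_mul_ofReal]
        simp; ring
      rw [this]; linarith
    rw [Gamma_eq_integral hs, GammaIntegral]
    have h := integral_comp_rpow_Ioi (fun x : ℝ => ((Real.exp (-x) : ℝ) : ℂ) *
      (x : ℂ) ^ ((a + 1) / 2 - 1)) (two_ne_zero (α := ℝ))
    rw [← h, eq_div_iff two_ne_zero, mul_comm, ← integral_const_mul]
    refine setIntegral_congr_fun measurableSet_Ioi fun y hy => ?_
    have hy0 : (0 : ℝ) < y := hy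
    have hy' : (y : ℂ) ≠ 0 := ofReal_ne_zero.2 hy0.ne'
    have e1 : y ^ (2 : ℝ) = y ^ 2 := by norm_cast
    have e2 : y ^ ((2 : ℝ) - 1) = y := by norm_num
    have e3 : ((y ^ 2 : ℝ) : ℂ) ^ ((a + 1) / 2 - 1) = (y : ℂ) ^ (a - 1) := by
      rw [cpow_def_of_ne_zero (ofReal_ne_zero.2 (by positivity)), cpow_def_of_ne_zero hy',
        ← ofReal_log (by positivity), ← ofReal_log hy0.le, Real.log_pow]
      congr 1
      push_cast
      ring
    rw [e1, e2, e3, cpow_sub _ _ hy', cpow_one, real_smul, abs_of_pos two_pos]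
    push_cast
    field_simp
  have hs : hankelIntegral 0 a = (∫ y : ℝ in Set.Iic 0, hankelFun a ((0 : ℝ) + y * I)) +
      ∫ y : ℝ in Set.Ioi 0, hankelFun a ((0 : ℝ) + y * I) :=
    (intervalIntegral.integral_Iic_add_Ioi hi.integrableOn hi.integrableOn).symm
  have hIic : (∫ y : ℝ in Set.Iic 0, hankelFun a ((0 : ℝ) + y * I)) =
      ∫ y : ℝ in Set.Ioi 0, hankelFun a ((0 : ℝ) + (-y : ℝ) * I) := by
    have := integral_comp_neg_Ioi (0 : ℝ) fun y : ℝ => hankelFun a ((0 : ℝ) + y * I)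
    rw [neg_zero] at this
    exact this.symm
  rw [hs, hIic, setIntegral_congr_fun measurableSet_Ioi fun y hy => hneg y hy,
    setIntegral_congr_fun measurableSet_Ioi fun y hy => hpos y hy, integral_const_mul,
    integral_const_mul, hG, Complex.cos]
  ring

end Hankel

/-! ### The matrix of the generalized Kontsevich model at `p = -1` -/

section GKM
open Complex Filter Topology Asymptotics

/-- The diagonal entries of the matrix of the generalized Kontsevich model at `p = -1`. -/
noncomputable def gkmDiag (ħ : ℂ) (j : ℤ) : ℂ :=
  ħ ^ (-j) * (2 * I * exp (-(ħ⁻¹ * log ħ))) * hankelIntegral 1 (-2 * j - 1 - 2 * ħ⁻¹)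

/-- With `μ = ħ λ w²` and `w = 1 + i y`, the powers of `w` from `μ^(-j-1)`, `dμ` and `exp(-ħ⁻¹ log
μ)` combine to the exponent `-2j - 1 - 2/ħ`, and `λ` drops out of `exp(w²)`. Thus the asymptotic
expansion is a single exact term. -/
theorem gkmGen_eq {ħ : ℂ} (hħ : ħ ≠ 0) (j : ℤ) {lam : ℝ} (hlam : 0 < lam) :
    gkmGen ħ j lam = (lam : ℂ) ^ (-j - 1) * gkmDiag ħ j := by
  have hl : (lam : ℂ) ≠ 0 := ofReal_ne_zero.2 hlam.ne'
  have hint : ∀ y : ℝ, gkmPath ħ lam y ^ (-j - 1) *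
      exp (ħ⁻¹ * ((lam : ℂ)⁻¹ * gkmPath ħ lam y - gkmPathLog ħ lam y)) *
      deriv (gkmPath ħ lam) y =
      (lam : ℂ) ^ (-j) * exp (-(ħ⁻¹ * (Real.log lam : ℂ))) *
        (ħ ^ (-j) * (2 * I * exp (-(ħ⁻¹ * log ħ)))) *
        hankelFun (-2 * j - 1 - 2 * ħ⁻¹) ((1 : ℝ) + y * I) := by
    intro y
    set w : ℂ := 1 + I * y with hw
    have hw0 : w ≠ 0 := fun h => by
      have := congrArg re h
      simp [hw] at this
    have e : ((1 : ℝ) + y * I : ℂ) = w := by rw [hw]; push_cast; ring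
    have hder : deriv (gkmPath ħ lam) y = ħ * lam * (2 * w * I) := by
      have h1 : HasDerivAt (fun y : ℝ => (1 + I * y : ℂ)) I y := by
        have := ((hasDerivAt_id y).ofReal_comp.const_mul I).const_add (1 : ℂ)
        simpa using this
      have := (h1.pow 2).const_mul (ħ * (lam : ℂ))
      rw [show gkmPath ħ lam = fun y : ℝ => ħ * (lam : ℂ) * (1 + I * y) ^ 2 from rfl]
      refine this.deriv.trans ?_
      simp [hw]
    have hp : gkmPath ħ lam y = ħ * lam * w ^ 2 := rfl
    have hpl : gkmPathLog ħ lam y = log ħ + (Real.log lam : ℂ) + 2 * log w := rfl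
    have hwn : w = exp (log w) := (exp_log hw0).symm
    have hpow : (w ^ 2) ^ (-j - 1) = exp ((-2 * j - 2) * log w) := by
      rw [← zpow_natCast w 2, ← zpow_mul]
      conv_lhs => rw [hwn]
      rw [← exp_int_mul]
      congr 1
      push_cast; ring
    have hexp : exp (ħ⁻¹ * ((lam : ℂ)⁻¹ * (ħ * lam * w ^ 2) - (log ħ + (Real.log lam : ℂ)
        + 2 * log w))) = exp (w ^ 2) * exp (-(ħ⁻¹ * log ħ)) * exp (-(ħ⁻¹ * (Real.log lam : ℂ))) *
        exp (-2 * ħ⁻¹ * log w) := by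
      rw [← exp_add, ← exp_add, ← exp_add]
      congr 1
      field_simp
      ring
    have hcp : w ^ (-2 * (j : ℂ) - 1 - 2 * ħ⁻¹) =
        exp ((-2 * j - 2) * log w) * w * exp (-2 * ħ⁻¹ * log w) := by
      conv_rhs => rw [hwn, log_exp (by rw [log_im]; exact neg_pi_lt_arg w)
        (by rw [log_im]; exact arg_le_pi w)]
      rw [cpow_def_of_ne_zero hw0, ← exp_add, ← exp_add]
      congr 1
      ring
    rw [hder, hp, hpl, hexp, mul_zpow, mul_zpow, hpow, hankelFun, e, hcp, zpow_sub₀ hħ, zpow_sub₀ hl,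
      zpow_one, zpow_one]
    field_simp
  have he : exp (ħ⁻¹ * (Real.log lam : ℂ)) * exp (-(ħ⁻¹ * (Real.log lam : ℂ))) = 1 := by
    rw [← exp_add, add_neg_cancel, exp_zero]
  rw [gkmGen]
  simp only [hint]
  rw [MeasureTheory.integral_const_mul, gkmDiag, hankelIntegral, zpow_sub₀ hl, zpow_one]
  rw [div_eq_mul_inv]
  linear_combination (lam : ℂ)⁻¹ * (lam : ℂ) ^ (-j) * (ħ ^ (-j) * (2 * I * exp (-(ħ⁻¹ * log ħ)))) *
    (∫ y : ℝ, hankelFun (-2 * j - 1 - 2 * ħ⁻¹) ((1 : ℝ) + y * I)) * he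

theorem isGKMMatrix_diagFun {ħ : ℂ} (hħ : ħ ≠ 0) : IsGKMMatrix ħ (diagFun (gkmDiag ħ)) := by
  refine ⟨fun i j hij => if_neg hij.ne, fun j K => ?_⟩
  -- For `K = 0` nothing is subtracted and the function itself has the required growth; for `K > 0`
  -- the difference is identically zero for positive `λ`.
  rcases Nat.eq_zero_or_pos K with rfl | hK
  · have h : (fun lam : ℝ => gkmGen ħ j lam - ∑ k ∈ Finset.range 0,
        (lam : ℂ) ^ (-(j + (k : ℤ)) - 1) * diagFun (gkmDiag ħ) (j + (k : ℤ)) j) =ᶠ[atTop]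
        fun lam : ℝ => gkmDiag ħ j * ((lam ^ (-(j + ((0 : ℕ) : ℤ)) - 1) : ℝ) : ℂ) := by
      filter_upwards [eventually_gt_atTop 0] with lam hlam
      rw [gkmGen_eq hħ j hlam]
      push_cast
      simp [mul_comm]
    refine h.trans_isBigO ?_
    refine (IsBigO.of_bound 1 (Eventually.of_forall fun lam => ?_)).const_mul_left _
    rw [norm_real, one_mul]
  · have h : (fun lam : ℝ => gkmGen ħ j lam - ∑ k ∈ Finset.range K,
        (lam : ℂ) ^ (-(j + (k : ℤ)) - 1) * diagFun (gkmDiag ħ) (j + (k : ℤ)) j) =ᶠ[atTop]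
        fun _ => 0 := by
      filter_upwards [eventually_gt_atTop 0] with lam hlam
      rw [gkmGen_eq hħ j hlam, Finset.sum_eq_single 0]
      · simp [diagFun]
      · intro k _ hk
        rw [diagFun, if_neg (by omega), mul_zero]
      · intro h0
        exact absurd (Finset.mem_range.2 hK) h0
    exact h.trans_isBigO (isBigO_zero _ _)

/-- After division by `λ^n` the constant `c` is `O(1/λ)`. Applied to the first differing term of two
expansions, this gives their uniqueness. -/
theorem eq_zero_of_isBigO_zpow {c : ℂ} {n : ℤ}
    (h : (fun lam : ℝ => (lam : ℂ) ^ n * c) =O[atTop] fun lam : ℝ => lam ^ (n - 1)) : c = 0 := by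
  have h1 : (fun _ : ℝ => c) =O[atTop] fun lam : ℝ => lam⁻¹ := by
    have h2 : (fun lam : ℝ => (lam : ℂ) ^ (-n)) =O[atTop] fun lam : ℝ => lam ^ (-n) :=
      IsBigO.of_bound 1 (Eventually.of_forall fun lam => by
        rw [norm_zpow, norm_zpow, norm_real, one_mul])
    refine ((h2.mul h).congr' ?_ ?_)
    · filter_upwards [eventually_gt_atTop 0] with lam hlam
      have : (lam : ℂ) ≠ 0 := ofReal_ne_zero.2 hlam.ne'
      rw [← mul_assoc, ← zpow_add₀ this, neg_add_cancel, zpow_zero, one_mul]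
    · filter_upwards [eventually_gt_atTop 0] with lam hlam
      rw [← zpow_add₀ hlam.ne', show -n + (n - 1) = -1 by ring, zpow_neg_one]
  exact tendsto_nhds_unique tendsto_const_nhds (h1.trans_tendsto tendsto_inv_atTop_zero)

theorem IsGKMMatrix.unique {ħ : ℂ} {u u' : ℤ → ℤ → ℂ} (hu : IsGKMMatrix ħ u)
    (hu' : IsGKMMatrix ħ u') : u = u' := by
  have key : ∀ (j : ℤ) (k : ℕ), u (j + (k : ℤ)) j = u' (j + (k : ℤ)) j := by
    intro j k
    induction k using Nat.strong_induction_on with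
    | _ k ih =>
      have h := (hu.2 j (k + 1)).sub (hu'.2 j (k + 1))
      refine sub_eq_zero.1 (eq_zero_of_isBigO_zpow (n := -(j + (k : ℤ)) - 1)
        (c := u (j + (k : ℤ)) j - u' (j + (k : ℤ)) j) ?_)
      have e : -(j + ((k + 1 : ℕ) : ℤ)) - 1 = -(j + (k : ℤ)) - 1 - 1 := by push_cast; ring
      rw [e] at h
      refine (h.neg_left).congr_left fun lam => ?_
      rw [Finset.sum_range_succ, Finset.sum_range_succ, Finset.sum_congr rfl fun l hl => by
        rw [ih l (Finset.mem_range.1 hl)]]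
      ring
  funext i j
  rcases lt_or_ge i j with hij | hij
  · rw [hu.1 i j hij, hu'.1 i j hij]
  · have := key j (i - j).toNat
    rwa [Int.toNat_of_nonneg (by omega), add_sub_cancel] at this

theorem existsUnique_isGKMMatrix {ħ : ℂ} (hħ : ħ ≠ 0) : ∃! u : ℤ → ℤ → ℂ, IsGKMMatrix ħ u :=
  ⟨_, isGKMMatrix_diagFun hħ, fun _ hu => hu.unique (isGKMMatrix_diagFun hħ)⟩

/-- Integration by parts with `a = -2j - 2/ħ`. The result is the recursion of `c1Diag` at `β = -1`.
-/
theorem gkmDiag_rec {ħ : ℂ} (hħ : ħ ≠ 0) (j : ℤ) :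
    gkmDiag ħ (j - 1) = (ħ * j + 1) * gkmDiag ħ j := by
  have h := hankelIntegral_rec (-2 * j - 2 * ħ⁻¹)
  have e1 : -2 * (j : ℂ) - 2 * ħ⁻¹ - 1 = -2 * j - 1 - 2 * ħ⁻¹ := by ring
  have e2 : -2 * (j : ℂ) - 2 * ħ⁻¹ + 1 = -2 * ((j - 1 : ℤ) : ℂ) - 1 - 2 * ħ⁻¹ := by push_cast; ring
  rw [e1, e2] at h
  have h1 : hankelIntegral 1 (-2 * ((j - 1 : ℤ) : ℂ) - 1 - 2 * ħ⁻¹) =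
      (j + ħ⁻¹) * hankelIntegral 1 (-2 * j - 1 - 2 * ħ⁻¹) := by linear_combination h / 2
  have e3 : ħ ^ (-(j - 1)) = ħ ^ (-j) * ħ := by
    rw [show -(j - 1) = -j + 1 by ring, zpow_add_one₀ hħ]
  rw [gkmDiag, gkmDiag, h1, e3]
  field_simp

/-- For `j` sufficiently negative the contour reaches the imaginary axis and the closed formula
applies. The cosine vanishes only if the exponent is an odd integer, which would make `1/ħ` an
integer. -/
theorem exists_gkmDiag_ne_zero {ħ : ℂ} (hħ : ħ ≠ 0) (h : ∀ n : ℤ, ħ⁻¹ ≠ n) :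
    ∃ j, gkmDiag ħ j ≠ 0 := by
  obtain ⟨n, hn⟩ := exists_nat_gt (1 + 2 * (ħ⁻¹).re)
  refine ⟨-n, ?_⟩
  set a : ℂ := -2 * ((-n : ℤ) : ℂ) - 1 - 2 * ħ⁻¹ with ha
  have hre : a.re = 2 * n - 1 - 2 * (ħ⁻¹).re := by
    simp [ha]
  have hpos : 0 < a.re := by
    rw [hre]
    have : (0 : ℝ) ≤ n := n.cast_nonneg
    linarith
  refine mul_ne_zero (mul_ne_zero (zpow_ne_zero _ hħ)
    (mul_ne_zero (mul_ne_zero two_ne_zero I_ne_zero) (exp_ne_zero _))) ?_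
  rw [← ha, hankelIntegral_one_eq_zero hpos, hankelIntegral_zero hpos]
  refine mul_ne_zero ?_ (Gamma_ne_zero_of_re_pos ?_)
  · intro h0
    obtain ⟨k, hk⟩ := cos_eq_zero_iff.1 h0
    have hpi : (Real.pi : ℂ) ≠ 0 := ofReal_ne_zero.2 Real.pi_ne_zero
    have h1 : a = 2 * k + 1 := by
      field_simp at hk
      linear_combination hk
    refine h (n - 1 - k) ?_
    rw [ha] at h1
    push_cast at h1 ⊢
    linear_combination -h1 / 2
  · rw [show (a + 1) / 2 = (a + 1) * ((1 / 2 : ℝ) : ℂ) by push_cast; ring, re_mul_ofReal]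
    simp only [add_re, one_re]
    linarith

/-- The matrix of the generalized Kontsevich model at `p = -1` is proportional to the one of the
`c = 1` string theory at `β = -1`. -/
theorem exists_gkmDiag_eq_mul {ħ : ℂ} (hħ : ħ ≠ 0) (h : C1Regular ħ (-1)) :
    ∃ κ : ℂ, κ ≠ 0 ∧ ∀ j, gkmDiag ħ j = κ * c1Diag ħ (-1) j := by
  have hc : ∀ j : ℤ, c1Diag ħ (-1) (j - 1) = (ħ * j + 1) * c1Diag ħ (-1) j := by
    intro j
    have := c1Diag_add hħ (by norm_num : (-1 : ℤ) ≠ 0) h j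
    rw [← sub_eq_add_neg] at this
    rw [this]
    push_cast
    ring
  have hc0 := c1Diag_ne_zero hħ h
  have hfac : ∀ j : ℤ, ħ * j + 1 ≠ 0 := fun j h0 => hc0 (j - 1) (by rw [hc, h0, zero_mul])
  have hstep : ∀ j : ℤ, gkmDiag ħ (j - 1) / c1Diag ħ (-1) (j - 1) =
      gkmDiag ħ j / c1Diag ħ (-1) j := fun j => by
    rw [hc, gkmDiag_rec hħ, mul_div_mul_left _ _ (hfac j)]
  have hconst : ∀ j : ℤ, gkmDiag ħ j / c1Diag ħ (-1) j = gkmDiag ħ 0 / c1Diag ħ (-1) 0 := by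
    intro j
    induction j using Int.induction_on with
    | zero => rfl
    | succ n ih =>
      have := hstep (n + 1)
      rw [add_sub_cancel_right] at this
      rw [← this, ih]
    | pred n ih => rw [hstep, ih]
  have hall : ∀ j, gkmDiag ħ j = gkmDiag ħ 0 / c1Diag ħ (-1) 0 * c1Diag ħ (-1) j := fun j => by
    rw [← hconst j, div_mul_cancel₀ _ (hc0 j)]
  refine ⟨gkmDiag ħ 0 / c1Diag ħ (-1) 0, fun h0 => ?_, hall⟩
  -- If `1/ħ = n`, the recursion factor `ħ j + 1` would vanish at `j = -n`, against the nonvanishing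
  -- of the `c = 1` entries.
  have hint : ∀ n : ℤ, ħ⁻¹ ≠ n := by
    intro n hn
    refine hfac (-n) ?_
    push_cast
    rw [← hn, mul_neg, mul_inv_cancel₀ hħ, neg_add_cancel]
  obtain ⟨j, hj⟩ := exists_gkmDiag_ne_zero hħ hint
  exact hj (by rw [hall j, h0, zero_mul])

end GKM

/-! ### The matrix integrals and the Penner model. -/

/-! ### Positive definite Hermitian matrices -/

section MatrixIntegrals
open MeasureTheory Filter Topology
open scoped ComplexOrder Matrix

variable {N : ℕ}

theorem hermMat_isHermitian (x : Fin N → Fin N → ℝ) : (hermMat x).IsHermitian := by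
  ext i j
  rw [Matrix.conjTranspose_apply]
  simp only [hermMat, Matrix.of_apply]
  rcases lt_trichotomy i j with h | rfl | h
  · rw [if_neg h.ne', if_neg h.not_gt, if_neg h.ne, if_pos h]
    simp
  · simp
  · rw [if_neg h.ne, if_pos h, if_neg h.ne', if_neg h.not_gt]
    simp; ring

theorem hermMat_diag (x : Fin N → Fin N → ℝ) (i : Fin N) : hermMat x i i = x i i := by
  simp [hermMat]

theorem abs_le_norm_hermMat (x : Fin N → Fin N → ℝ) (i j : Fin N) : |x i j| ≤ ‖hermMat x i j‖ := by
  simp only [hermMat, Matrix.of_apply]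
  rcases lt_trichotomy i j with h | rfl | h
  · rw [if_neg h.ne, if_pos h]
    simpa using Complex.abs_re_le_norm ((x i j : ℂ) + Complex.I * (x j i : ℂ))
  · simp
  · rw [if_neg h.ne', if_neg h.not_gt]
    simpa using Complex.abs_im_le_norm ((x j i : ℂ) - Complex.I * (x i j : ℂ))

theorem trace_hermMat_re (x : Fin N → Fin N → ℝ) : (hermMat x).trace.re = ∑ i, x i i := by
  simp [Matrix.trace, hermMat_diag]

theorem trace_diagonal_mul_hermMat_re (c : Fin N → ℝ) (x : Fin N → Fin N → ℝ) :
    (Matrix.diagonal (fun i => ((c i : ℂ))⁻¹) * hermMat x).trace.re = ∑ i, (c i)⁻¹ * x i i := by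
  rw [Matrix.trace, Complex.re_sum]
  refine Finset.sum_congr rfl fun i _ => ?_
  rw [Matrix.diag_apply, Matrix.diagonal_mul, hermMat_diag, ← Complex.ofReal_inv,
    ← Complex.ofReal_mul, Complex.ofReal_re]

theorem continuous_hermMat : Continuous (hermMat : (Fin N → Fin N → ℝ) → _) := by
  refine continuous_matrix fun i j => ?_
  simp only [hermMat, Matrix.of_apply]
  split_ifs <;> fun_prop

theorem det_eq_ofReal {A : Matrix (Fin N) (Fin N) ℂ} (hA : A.PosDef) :
    A.det = ((∏ i, hA.1.eigenvalues i : ℝ) : ℂ) := by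
  rw [hA.1.det_eq_prod_eigenvalues]
  push_cast
  rfl

theorem trLog_eq_log_det {A : Matrix (Fin N) (Fin N) ℂ} (hA : A.PosDef) :
    trLog A = Real.log A.det.re := by
  rw [trLog, dif_pos hA.1, det_eq_ofReal hA, Complex.ofReal_re,
    Real.log_prod fun i _ => (hA.eigenvalues_pos i).ne']

theorem det_re_pos {A : Matrix (Fin N) (Fin N) ℂ} (hA : A.PosDef) : 0 < A.det.re := by
  rw [det_eq_ofReal hA, Complex.ofReal_re]
  exact Finset.prod_pos fun i _ => hA.eigenvalues_pos i

/-- The eigenvalues are positive, so each one is at most their sum. -/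
theorem det_re_le_trace_pow {A : Matrix (Fin N) (Fin N) ℂ} (hA : A.PosDef) :
    A.det.re ≤ A.trace.re ^ N := by
  have htr : A.trace.re = ∑ i, hA.1.eigenvalues i := by
    rw [hA.1.trace_eq_sum_eigenvalues, Complex.re_sum]
    rfl
  rw [det_eq_ofReal hA, Complex.ofReal_re, htr]
  calc ∏ i, hA.1.eigenvalues i ≤ ∏ _i : Fin N, ∑ j, hA.1.eigenvalues j :=
        Finset.prod_le_prod (fun i _ => (hA.eigenvalues_pos i).le) fun i _ =>
          Finset.single_le_sum (fun j _ => (hA.eigenvalues_pos j).le) (Finset.mem_univ i)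
    _ = _ := by simp

theorem diag_pos_of_mem_posDefSet {x : Fin N → Fin N → ℝ} (hx : x ∈ posDefSet N) (i : Fin N) :
    0 < x i i := by
  have : (0 : ℂ) < hermMat x i i := Matrix.PosDef.diag_pos hx
  rw [hermMat_diag] at this
  exact_mod_cast this

/-- The entries of a positive definite matrix are bounded by the trace. -/
theorem abs_le_trace_of_mem_posDefSet {x : Fin N → Fin N → ℝ} (hx : x ∈ posDefSet N)
    (i j : Fin N) : |x i j| ≤ ∑ k, x k k := by
  have hdiag := diag_pos_of_mem_posDefSet hx
  have hle : ∀ k, x k k ≤ ∑ l, x l l := fun k =>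
    Finset.single_le_sum (f := fun l => x l l) (fun l _ => (hdiag l).le) (Finset.mem_univ k)
  -- Nonnegativity of the `2 × 2` minor gives `|M_ij|² ≤ M_ii M_jj`. Semidefiniteness passes to
  -- submatrices with repeated indices, so `i = j` is included.
  have h1 : 0 ≤ ((hermMat x).submatrix ![i, j] ![i, j]).det :=
    (Matrix.PosDef.posSemidef hx |>.submatrix ![i, j]).det_nonneg
  have h2 : hermMat x j i = star (hermMat x i j) := ((hermMat_isHermitian x).apply j i).symm
  rw [Matrix.det_fin_two] at h1
  simp only [Matrix.submatrix_apply, Matrix.cons_val_zero, Matrix.cons_val_one, hermMat_diag, h2,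
    Complex.star_def, Complex.mul_conj] at h1
  have h3 : 0 ≤ x i i * x j j - Complex.normSq (hermMat x i j) := by exact_mod_cast h1
  rw [Complex.normSq_eq_norm_sq] at h3
  refine (abs_le_norm_hermMat x i j).trans ?_
  have hs : 0 ≤ ∑ l, x l l := (hdiag i).le.trans (hle i)
  refine le_of_sq_le_sq ?_ hs
  calc ‖hermMat x i j‖ ^ 2 ≤ x i i * x j j := by linarith
    _ ≤ (∑ l, x l l) * ∑ l, x l l := mul_le_mul (hle i) (hle j) (hdiag j).le hs
    _ = _ := by ring

/-- Positivity of the quadratic form needs to be checked only on the unit sphere, which is compact,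
and the form is jointly continuous. Openness supplies measurability of the domain and, later, its
positive measure. -/
theorem isOpen_posDefSet (N : ℕ) : IsOpen (posDefSet N) := by
  have hiff : ∀ x : Fin N → Fin N → ℝ, x ∈ posDefSet N ↔ ∀ v ∈ Metric.sphere (0 : Fin N → ℂ) 1,
      0 < (star v ⬝ᵥ (hermMat x *ᵥ v)).re := by
    intro x
    have him : ∀ v : Fin N → ℂ, (star v ⬝ᵥ (hermMat x *ᵥ v)).im = 0 := fun v =>
      (hermMat_isHermitian x).im_star_dotProduct_mulVec_self v
    constructor
    · intro hx v hv
      have hv0 : v ≠ 0 := by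
        rintro rfl
        simp at hv
      exact (Complex.lt_def.1 (Matrix.PosDef.dotProduct_mulVec_pos hx hv0)).1
    · intro h
      refine Matrix.PosDef.of_dotProduct_mulVec_pos (hermMat_isHermitian x) fun v hv => ?_
      have hn : (0 : ℝ) < ‖v‖ := norm_pos_iff.2 hv
      have h1 := h ((‖v‖⁻¹ : ℂ) • v) (by simp [norm_smul, hn.ne'])
      rw [Matrix.mulVec_smul, star_smul, smul_dotProduct, dotProduct_smul] at h1
      refine Complex.lt_def.2 ⟨?_, (him v).symm⟩
      have h2 : star ((‖v‖ : ℂ)⁻¹) = (((‖v‖⁻¹ : ℝ)) : ℂ) := by simp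
      rw [h2, smul_eq_mul, smul_eq_mul, ← Complex.ofReal_inv, Complex.re_ofReal_mul,
        Complex.re_ofReal_mul] at h1
      have h3 : (0 : ℝ) < ‖v‖⁻¹ := inv_pos.2 hn
      exact (pos_iff_pos_of_mul_pos ((pos_iff_pos_of_mul_pos h1).1 h3 |> fun h => h)).1 h3
  have hcont : Continuous fun p : (Fin N → Fin N → ℝ) × (Fin N → ℂ) =>
      (star p.2 ⬝ᵥ (hermMat p.1 *ᵥ p.2)).re := by
    have h1 : Continuous fun p : (Fin N → Fin N → ℝ) × (Fin N → ℂ) => hermMat p.1 :=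
      continuous_hermMat.comp continuous_fst
    exact Complex.continuous_re.comp
      ((continuous_star.comp continuous_snd).dotProduct (h1.matrix_mulVec continuous_snd))
  rw [isOpen_iff_eventually]
  intro x hx
  simp only [hiff] at hx ⊢
  refine (isCompact_sphere (0 : Fin N → ℂ) 1).eventually_forall_of_forall_eventually
    fun v hv => ?_
  exact hcont.continuousAt.eventually (lt_mem_nhds (hx v hv))

/-! ### Convergence -/

theorem gkmIntegrand_eq (r : ℝ) (lam : Fin N → ℝ) {x : Fin N → Fin N → ℝ}
    (hx : x ∈ posDefSet N) : gkmIntegrand r lam x =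
      Real.exp (r⁻¹ * ∑ i, (lam i)⁻¹ * x i i) * (hermMat x).det.re ^ (-r⁻¹) := by
  rw [gkmIntegrand, trace_diagonal_mul_hermMat_re, trLog_eq_log_det hx,
    Real.rpow_def_of_pos (det_re_pos hx), ← Real.exp_add]
  congr 1
  ring

theorem integrable_prod_prod_inv_one_add_sq (N : ℕ) :
    Integrable fun x : Fin N → Fin N → ℝ => ∏ i, ∏ j, (1 + x i j ^ 2)⁻¹ := by
  have h1 : Integrable (fun y : Fin N → ℝ => ∏ j, (1 + y j ^ 2)⁻¹) (volume : Measure (Fin N → ℝ)) :=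
    Integrable.fintype_prod (f := fun (_ : Fin N) (y : ℝ) => (1 + y ^ 2)⁻¹)
      (μ := fun _ => (volume : Measure ℝ)) fun _ => integrable_inv_one_add_sq
  exact Integrable.fintype_prod
    (f := fun (_ : Fin N) (y : Fin N → ℝ) => ∏ j, (1 + y j ^ 2)⁻¹)
    (μ := fun _ => (volume : Measure (Fin N → ℝ))) fun _ => h1

theorem aestronglyMeasurable_gkmIntegrand (r : ℝ) (lam : Fin N → ℝ) :
    AEStronglyMeasurable (gkmIntegrand r lam) (volume.restrict (posDefSet N)) := by
  have h1 : Measurable fun x : Fin N → Fin N → ℝ =>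
      Real.exp (r⁻¹ * ∑ i, (lam i)⁻¹ * x i i) * (hermMat x).det.re ^ (-r⁻¹) := by
    have hd : Measurable fun x : Fin N → Fin N → ℝ => (hermMat x).det.re :=
      (Complex.continuous_re.comp continuous_hermMat.matrix_det).measurable
    refine Measurable.mul ?_ (hd.pow_const _)
    fun_prop
  refine h1.aestronglyMeasurable.congr ?_
  filter_upwards [ae_restrict_mem (isOpen_posDefSet N).measurableSet] with x hx
  exact (gkmIntegrand_eq r lam hx).symm

theorem integrableOn_gkmIntegrand {r : ℝ} (hr : r < 0) {lam : Fin N → ℝ} (hlam : ∀ i, 0 < lam i) :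
    IntegrableOn (gkmIntegrand r lam) (posDefSet N) := by
  have hg : 0 < -r⁻¹ := neg_pos.2 (inv_lt_zero.2 hr)
  have hS : 0 ≤ ∑ i, lam i := Finset.sum_nonneg fun i _ => (hlam i).le
  -- A lower bound for all the `-r⁻¹ / λᵢ` at once; the added `1` keeps it meaningful for `N = 0`.
  set c : ℝ := -r⁻¹ * (1 + ∑ i, lam i)⁻¹ with hc
  have hc0 : 0 < c := mul_pos hg (inv_pos.2 (by linarith))
  obtain ⟨k, hk⟩ := exists_nat_ge (N * -r⁻¹)
  -- The power `k` of `1 + τ`, with `τ` the trace, bounds the determinant factor; the power `2 N²`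
  -- bounds the product of the `1 + x_ij²`. The exponential decay in the trace absorbs both, leaving
  -- a product of integrable functions of single entries.
  set n := k + 2 * (N * N) with hn
  set C : ℝ := n.factorial / c ^ n * Real.exp c with hC
  have hdom : Integrable fun x : Fin N → Fin N → ℝ => C * ∏ i, ∏ j, (1 + x i j ^ 2)⁻¹ :=
    (integrable_prod_prod_inv_one_add_sq N).const_mul C
  refine Integrable.mono' hdom.integrableOn (aestronglyMeasurable_gkmIntegrand r lam) ?_
  filter_upwards [ae_restrict_mem (isOpen_posDefSet N).measurableSet] with x hx
  have hdiag := diag_pos_of_mem_posDefSet hx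
  set τ : ℝ := ∑ i, x i i with hτ
  have hτ0 : 0 ≤ τ := Finset.sum_nonneg fun i _ => (hdiag i).le
  have h1τ : 1 ≤ 1 + τ := by linarith
  have e1 : Real.exp (r⁻¹ * ∑ i, (lam i)⁻¹ * x i i) ≤ Real.exp (-(c * τ)) := by
    refine Real.exp_le_exp.2 ?_
    have : (1 + ∑ i, lam i)⁻¹ * τ ≤ ∑ i, (lam i)⁻¹ * x i i := by
      rw [hτ, Finset.mul_sum]
      refine Finset.sum_le_sum fun i _ => mul_le_mul_of_nonneg_right ?_ (hdiag i).le
      refine inv_anti₀ (hlam i) ?_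
      have := Finset.single_le_sum (f := lam) (fun i _ => (hlam i).le) (Finset.mem_univ i)
      linarith
    have h2 := mul_le_mul_of_nonneg_left this hg.le
    rw [hc]
    linarith
  have e2 : (hermMat x).det.re ^ (-r⁻¹) ≤ (1 + τ) ^ k := by
    have h2 := det_re_le_trace_pow hx
    rw [trace_hermMat_re] at h2
    calc (hermMat x).det.re ^ (-r⁻¹) ≤ ((1 + τ) ^ N) ^ (-r⁻¹) :=
          Real.rpow_le_rpow (det_re_pos hx).le
            (h2.trans (pow_le_pow_left₀ hτ0 (by linarith) N)) hg.le
      _ = (1 + τ) ^ (N * -r⁻¹) := by rw [← Real.rpow_natCast, ← Real.rpow_mul (by linarith)]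
      _ ≤ (1 + τ) ^ (k : ℝ) := Real.rpow_le_rpow_of_exponent_le h1τ hk
      _ = _ := Real.rpow_natCast _ _
  have e3 : (1 + τ) ^ n ≤ C * Real.exp (c * τ) := by
    have := Real.pow_div_factorial_le_exp (c * (1 + τ)) (by positivity) n
    rw [mul_pow, div_le_iff₀ (by positivity), mul_add, mul_one, Real.exp_add] at this
    rw [hC, div_mul_eq_mul_div, div_mul_eq_mul_div, le_div_iff₀ (by positivity)]
    linarith
  have e4 : ∏ i, ∏ j, (1 + x i j ^ 2) ≤ (1 + τ) ^ (2 * (N * N)) := by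
    calc ∏ i, ∏ j, (1 + x i j ^ 2) ≤ ∏ _i : Fin N, ∏ _j : Fin N, (1 + τ) ^ 2 := by
          refine Finset.prod_le_prod (fun i _ => Finset.prod_nonneg fun j _ => by positivity)
            fun i _ => Finset.prod_le_prod (fun j _ => by positivity) fun j _ => ?_
          have h2 := abs_le_trace_of_mem_posDefSet hx i j
          have h3 : x i j ^ 2 ≤ τ ^ 2 := by
            rw [← sq_abs]
            exact pow_le_pow_left₀ (abs_nonneg _) h2 2
          nlinarith
      _ = _ := by
          simp only [Finset.prod_const, Finset.card_univ, Fintype.card_fin]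
          rw [← pow_mul, ← pow_mul]
  have hP : 0 < ∏ i, ∏ j, (1 + x i j ^ 2) :=
    Finset.prod_pos fun i _ => Finset.prod_pos fun j _ => by positivity
  have hinv : ∏ i, ∏ j, (1 + x i j ^ 2)⁻¹ = (∏ i, ∏ j, (1 + x i j ^ 2))⁻¹ := by
    simp only [Finset.prod_inv_distrib]
  rw [gkmIntegrand_eq r lam hx, Real.norm_of_nonneg
    (mul_nonneg (Real.exp_nonneg _) (Real.rpow_nonneg (det_re_pos hx).le _)), hinv,
    ← div_eq_mul_inv, le_div_iff₀ hP]
  calc _ ≤ Real.exp (-(c * τ)) * (1 + τ) ^ k * (1 + τ) ^ (2 * (N * N)) :=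
        mul_le_mul (mul_le_mul e1 e2 (Real.rpow_nonneg (det_re_pos hx).le _) (Real.exp_nonneg _))
          e4 hP.le (by positivity)
    _ = Real.exp (-(c * τ)) * (1 + τ) ^ n := by rw [mul_assoc, ← pow_add]
    _ ≤ Real.exp (-(c * τ)) * (C * Real.exp (c * τ)) :=
        mul_le_mul_of_nonneg_left e3 (Real.exp_nonneg _)
    _ = C := by rw [mul_left_comm, ← Real.exp_add, neg_add_cancel, Real.exp_zero, mul_one]

/-! ### Dependence on the external field -/

/-- Multiplication of the entries by constants. -/
noncomputable def entryScale (c : Fin N → Fin N → ℝ) :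
    (Fin N → Fin N → ℝ) →L[ℝ] (Fin N → Fin N → ℝ) :=
  ContinuousLinearMap.pi fun i =>
    (ContinuousLinearMap.pi fun j => (c i j • ContinuousLinearMap.id ℝ ℝ).comp
      (ContinuousLinearMap.proj j)).comp (ContinuousLinearMap.proj i)

theorem entryScale_apply (c : Fin N → Fin N → ℝ) (x : Fin N → Fin N → ℝ) (i j : Fin N) :
    entryScale c x i j = c i j * x i j := rfl

theorem det_entryScale (c : Fin N → Fin N → ℝ) : (entryScale c).det = ∏ i, ∏ j, c i j := by
  rw [entryScale, ContinuousLinearMap.det_pi]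
  refine Finset.prod_congr rfl fun i _ => ?_
  rw [ContinuousLinearMap.det_pi]
  refine Finset.prod_congr rfl fun j _ => ?_
  simp [ContinuousLinearMap.det]

theorem hermMat_entryScale (d : Fin N → ℝ) (x : Fin N → Fin N → ℝ) :
    hermMat (entryScale (fun i j => d i * d j) x) =
      Matrix.diagonal (fun i => (d i : ℂ)) * hermMat x * Matrix.diagonal (fun i => (d i : ℂ)) := by
  ext i j
  rw [Matrix.mul_diagonal, Matrix.diagonal_mul]
  simp only [hermMat, Matrix.of_apply, entryScale_apply]
  split_ifs with h
  · subst h; push_cast; ring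
  · push_cast; ring
  · push_cast; ring

theorem entryScale_mem_posDefSet {d : Fin N → ℝ} (hd : ∀ i, 0 < d i) (x : Fin N → Fin N → ℝ) :
    entryScale (fun i j => d i * d j) x ∈ posDefSet N ↔ x ∈ posDefSet N := by
  have hU : IsUnit (Matrix.diagonal (fun i => (d i : ℂ))) := by
    rw [Matrix.isUnit_diagonal, Pi.isUnit_iff]
    exact fun i => isUnit_iff_ne_zero.2 (Complex.ofReal_ne_zero.2 (hd i).ne')
  have hs : star (Matrix.diagonal (fun i => (d i : ℂ))) = Matrix.diagonal (fun i => (d i : ℂ)) := by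
    rw [Matrix.star_eq_conjTranspose, Matrix.diagonal_conjTranspose]
    congr 1
    funext i
    simp
  have := Matrix.IsUnit.posDef_star_right_conjugate_iff (x := hermMat x) hU
  rw [hs, ← hermMat_entryScale] at this
  exact this

/-- Substitution `M ↦ Λ^{1/2} M Λ^{1/2}`, which preserves the cone. `Tr Λ⁻¹ M` becomes `Tr M`, the
determinant in the integrand contributes `(det Λ)^{-1/r}`, and the Jacobian contributes `(det Λ)^N`.
-/
theorem gkmIntegral_eq_det_rpow_mul (r : ℝ) {lam : Fin N → ℝ} (hlam : ∀ i, 0 < lam i) :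
    gkmIntegral r lam =
      (∏ i, lam i) ^ ((N : ℝ) - r⁻¹) * gkmIntegral r (fun _ : Fin N => 1) := by
  set d : Fin N → ℝ := fun i => √(lam i) with hd
  have hd0 : ∀ i, 0 < d i := fun i => Real.sqrt_pos.2 (hlam i)
  have hdd : ∀ i, d i * d i = lam i := fun i => Real.mul_self_sqrt (hlam i).le
  have hP : 0 < ∏ i, lam i := Finset.prod_pos fun i _ => hlam i
  set Φ := entryScale (fun i j => d i * d j) with hΦ
  have himage : Φ '' posDefSet N = posDefSet N := by
    ext x
    constructor
    · rintro ⟨y, hy, rfl⟩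
      exact (entryScale_mem_posDefSet hd0 y).2 hy
    · intro hx
      have hx' : Φ (fun i j => (d i * d j)⁻¹ * x i j) = x := by
        funext i j
        rw [hΦ, entryScale_apply, mul_inv_cancel_left₀ (mul_pos (hd0 i) (hd0 j)).ne']
      exact ⟨_, (entryScale_mem_posDefSet hd0 _).1 (by rw [← hΦ, hx']; exact hx), hx'⟩
  have hinj : Function.Injective Φ := fun x y h => by
    funext i j
    have := congrFun (congrFun h i) j
    rw [hΦ, entryScale_apply, entryScale_apply] at this
    exact mul_left_cancel₀ (mul_pos (hd0 i) (hd0 j)).ne' this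
  -- Every one of the `N²` real coordinates `x_ij` is scaled by `√(λᵢ λⱼ)`.
  have hdet : |Φ.det| = (∏ i, lam i) ^ N := by
    have : Φ.det = (∏ i, lam i) ^ N := by
      rw [hΦ, det_entryScale]
      simp only [Finset.prod_mul_distrib, Finset.prod_const, Finset.card_univ, Fintype.card_fin]
      rw [Finset.prod_pow, ← mul_pow, ← Finset.prod_mul_distrib]
      simp only [hdd]
    rw [this, abs_of_pos (pow_pos hP N)]
  have hint : ∀ x ∈ posDefSet N, gkmIntegrand r lam (Φ x) =
      (∏ i, lam i) ^ (-r⁻¹) * gkmIntegrand r (fun _ => 1) x := by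
    intro x hx
    rw [gkmIntegrand_eq r _ hx, gkmIntegrand_eq r _ ((entryScale_mem_posDefSet hd0 x).2 hx),
      hermMat_entryScale, Matrix.det_mul, Matrix.det_mul, Matrix.det_diagonal, mul_right_comm,
      ← Finset.prod_mul_distrib]
    have h1 : ∏ i, ((d i : ℂ) * (d i : ℂ)) = ((∏ i, lam i : ℝ) : ℂ) := by
      push_cast
      exact Finset.prod_congr rfl fun i _ => by rw [← hdd i]; push_cast; rfl
    rw [h1, Complex.re_ofReal_mul, Real.mul_rpow hP.le (det_re_pos hx).le, mul_left_comm]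
    congr 3
    congr 1
    refine Finset.sum_congr rfl fun i _ => ?_
    rw [entryScale_apply, hdd, inv_mul_cancel_left₀ (hlam i).ne', inv_one, one_mul]
  have h := integral_image_eq_integral_abs_det_fderiv_smul volume
    (isOpen_posDefSet N).measurableSet (fun x _ => Φ.hasFDerivAt.hasFDerivWithinAt) hinj.injOn
    (gkmIntegrand r lam)
  rw [himage] at h
  rw [gkmIntegral, h, hdet, gkmIntegral, ← integral_const_mul]
  refine setIntegral_congr_fun (isOpen_posDefSet N).measurableSet fun x hx => ?_
  simp only [smul_eq_mul]
  rw [hint x hx, ← mul_assoc, sub_eq_add_neg, Real.rpow_add hP, Real.rpow_natCast]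

/-! ### The normalization factor -/

/-- Each `λᵢ` occurs `i` times as the larger index, `N - 1 - i` times as the smaller one, and once
in the extra product. -/
theorem prod_prod_lt_mul (lam : Fin N → ℝ) :
    (∏ i, ∏ j ∈ Finset.univ.filter (fun j => j < i), lam i * lam j) * ∏ i, lam i =
      (∏ i, lam i) ^ N := by
  have h1 : ∏ i, ∏ j ∈ Finset.univ.filter (fun j => j < i), lam j =
      ∏ i, ∏ j ∈ Finset.univ.filter (fun j => i < j), lam i := by
    simp only [Finset.prod_filter]
    rw [Finset.prod_comm]
  simp only [Finset.prod_mul_distrib]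
  rw [h1, ← Finset.prod_mul_distrib, ← Finset.prod_mul_distrib, ← Finset.prod_pow]
  refine Finset.prod_congr rfl fun i _ => ?_
  rw [Finset.prod_const, Finset.prod_const, ← pow_add, ← pow_succ]
  congr 1
  have e1 : (Finset.univ.filter (fun j => j < i)).card = (i : ℕ) := by
    rw [Finset.filter_gt_eq_Iio, Fin.card_Iio]
  have e2 : (Finset.univ.filter (fun j => i < j)).card = N - 1 - i := by
    rw [Finset.filter_lt_eq_Ioi, Fin.card_Ioi]
  rw [e1, e2]
  have := i.2
  omega

/-- Each quotient equals `-1/(λᵢ λⱼ)`; the signs number `N.choose 2`. -/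
theorem gkmNorm_eq (r : ℝ) {lam : Fin N → ℝ} (hlam : ∀ i, 0 < lam i)
    (hinj : Function.Injective lam) :
    gkmNorm r lam = (-1) ^ N.choose 2 * (∏ i, lam i) ^ (r⁻¹ - (N : ℝ)) := by
  have hP : 0 < ∏ i, lam i := Finset.prod_pos fun i _ => hlam i
  have h1 : ∏ i, ∏ j ∈ Finset.univ.filter (fun j => j < i), ((lam i)⁻¹ - (lam j)⁻¹) /
      (lam i - lam j) = ∏ i, ∏ j ∈ Finset.univ.filter (fun j => j < i), (-1) * (lam i * lam j)⁻¹ := by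
    refine Finset.prod_congr rfl fun i _ => Finset.prod_congr rfl fun j hj => ?_
    have hne : lam i - lam j ≠ 0 := sub_ne_zero.2 (hinj.ne (Finset.mem_filter.1 hj).2.ne')
    have hi := (hlam i).ne'
    have hj := (hlam j).ne'
    field_simp
    ring
  have h2 : ∏ i : Fin N, ∏ j ∈ Finset.univ.filter (fun j => j < i), (-1 : ℝ) =
      (-1) ^ N.choose 2 := by
    simp only [Finset.prod_const]
    rw [Finset.prod_pow_eq_pow_sum]
    congr 1
    have : ∀ i : Fin N, (Finset.univ.filter (fun j => j < i)).card = (i : ℕ) := fun i => by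
      rw [Finset.filter_gt_eq_Iio, Fin.card_Iio]
    simp only [this]
    rw [Fin.sum_univ_eq_sum_range (fun i => i) N, Finset.sum_range_id, Nat.choose_two_right]
  have h3 : Real.exp (r⁻¹ * ∑ i, Real.log (lam i)) = (∏ i, lam i) ^ r⁻¹ := by
    rw [Real.rpow_def_of_pos hP, Real.log_prod fun i _ => (hlam i).ne', mul_comm]
  rw [gkmNorm, h1, h3]
  simp only [Finset.prod_mul_distrib]
  rw [h2, Real.rpow_sub hP, Real.rpow_natCast, ← prod_prod_lt_mul lam]
  simp only [Finset.prod_inv_distrib]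
  field_simp

/-! ### The Penner model -/

/-- The parameters of the unit matrix. -/
def unitParam (N : ℕ) : Fin N → Fin N → ℝ := fun i j => if i = j then 1 else 0

theorem hermMat_unitParam_sub (x : Fin N → Fin N → ℝ) :
    hermMat (unitParam N - x) = 1 - hermMat x := by
  ext i j
  rw [Matrix.sub_apply, Matrix.one_apply]
  simp only [hermMat, Matrix.of_apply, unitParam, Pi.sub_apply]
  by_cases h : i = j
  · subst h; simp
  · simp only [if_neg h, if_neg (Ne.symm h)]
    split_ifs <;> · push_cast; ring

theorem unitParam_sub_mem_pennerSet (x : Fin N → Fin N → ℝ) :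
    unitParam N - x ∈ pennerSet N ↔ x ∈ posDefSet N := by
  simp only [pennerSet, posDefSet, Set.mem_ofPred_eq]
  rw [hermMat_unitParam_sub, sub_sub_cancel]

theorem unitParam_mem_posDefSet (N : ℕ) : unitParam N ∈ posDefSet N := by
  have h := hermMat_unitParam_sub (0 : Fin N → Fin N → ℝ)
  have h0 : hermMat (0 : Fin N → Fin N → ℝ) = 0 := by
    ext i j
    simp [hermMat]
  rw [h0, sub_zero, sub_zero] at h
  simp only [posDefSet, Set.mem_ofPred_eq, h]
  exact Matrix.PosDef.one

/-- Under `Φ = 1 - M` one has `Tr Φ = N - Tr M`, and the constant `N` yields the prefactor. -/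
theorem pennerIntegrand_unitParam_sub (r : ℝ) (x : Fin N → Fin N → ℝ) :
    pennerIntegrand (-r⁻¹) (unitParam N - x) =
      Real.exp (-(r⁻¹ * N)) * gkmIntegrand r (fun _ => 1) x := by
  rw [pennerIntegrand, gkmIntegrand, trace_diagonal_mul_hermMat_re, hermMat_unitParam_sub,
    sub_sub_cancel, Matrix.trace_sub, Matrix.trace_one, Complex.sub_re, trace_hermMat_re,
    ← Real.exp_add]
  simp only [inv_one, one_mul, Fintype.card_fin, Complex.natCast_re]
  congr 1
  ring

/-- Extension by zero to the whole space, so that invariance of Lebesgue measure under `x ↦ c - x`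
applies. -/
theorem indicator_pennerSet_unitParam_sub (r : ℝ) (x : Fin N → Fin N → ℝ) :
    (pennerSet N).indicator (pennerIntegrand (-r⁻¹)) (unitParam N - x) =
      (posDefSet N).indicator
        (fun x => Real.exp (-(r⁻¹ * N)) * gkmIntegrand r (fun _ => 1) x) x := by
  by_cases hx : x ∈ posDefSet N
  · rw [Set.indicator_of_mem hx, Set.indicator_of_mem ((unitParam_sub_mem_pennerSet x).2 hx),
      pennerIntegrand_unitParam_sub]
  · rw [Set.indicator_of_notMem hx,
      Set.indicator_of_notMem (mt (unitParam_sub_mem_pennerSet x).1 hx)]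

theorem measurableSet_pennerSet (N : ℕ) : MeasurableSet (pennerSet N) := by
  have : pennerSet N = (fun x => unitParam N - x) ⁻¹' posDefSet N := by
    ext x
    have := unitParam_sub_mem_pennerSet (unitParam N - x)
    rw [sub_sub_cancel] at this
    exact this
  rw [this]
  exact ((isOpen_posDefSet N).preimage (by fun_prop)).measurableSet

theorem integrableOn_pennerIntegrand {r : ℝ} (hr : r < 0) (N : ℕ) :
    IntegrableOn (pennerIntegrand (-r⁻¹)) (pennerSet N) := by
  rw [← integrable_indicator_iff (measurableSet_pennerSet N),
    ← integrable_comp_sub_left _ (unitParam N)]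
  simp only [indicator_pennerSet_unitParam_sub]
  rw [integrable_indicator_iff (isOpen_posDefSet N).measurableSet]
  exact (integrableOn_gkmIntegrand hr fun _ => one_pos).const_mul _

theorem pennerPartition_eq (r : ℝ) (N : ℕ) : pennerPartition (-r⁻¹) N =
    Real.exp (-(r⁻¹ * N)) * gkmIntegral r (fun _ : Fin N => 1) := by
  rw [pennerPartition, ← integral_indicator (measurableSet_pennerSet N),
    ← integral_sub_left_eq_self _ _ (unitParam N)]
  simp only [indicator_pennerSet_unitParam_sub]
  rw [integral_indicator (isOpen_posDefSet N).measurableSet, integral_const_mul, gkmIntegral]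

/-- The integrand is an exponential and the domain is open and contains the unit matrix, hence has
positive measure. -/
theorem gkmIntegral_pos {r : ℝ} (hr : r < 0) {lam : Fin N → ℝ} (hlam : ∀ i, 0 < lam i) :
    0 < gkmIntegral r lam := by
  have h0 : 0 ≤ᵐ[volume.restrict (posDefSet N)] gkmIntegrand r lam :=
    Eventually.of_forall fun x => (Real.exp_pos _).le
  rw [gkmIntegral, setIntegral_pos_iff_support_of_nonneg_ae h0 (integrableOn_gkmIntegrand hr hlam)]
  have : Function.support (gkmIntegrand r lam) = Set.univ :=
    Set.eq_univ_of_forall fun x => (Real.exp_pos _).ne'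
  rw [this, Set.univ_inter]
  exact (isOpen_posDefSet N).measure_pos volume ⟨_, unitParam_mem_posDefSet N⟩

end MatrixIntegrals
end TodaString

theorem mainTheorem5 (ħ : ℂ) (hħ : ħ ≠ 0) :
    -- the string equations of the model at `p = -1`, written out
    (∀ T : TodaString.TodaOps, TodaString.GKMStringEqs ħ (-1) T ↔
      (T.Lpow (-1)).1 = (T.Mbar * T.Lbarpow (-1) + T.Lbarpow (-1)).1 ∧
      (T.Lbarpow 1).1 = (T.M * T.Lpow 1 + ħ • T.Lpow 1 + T.Lpow 1).1) ∧
    -- they are incompatible with the `c = 1` string equations for every `β ≥ 1`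
    (∀ β : ℤ, 1 ≤ β → ∀ T : TodaString.TodaOps, TodaString.IsTodaSolution ħ T →
      ¬ (TodaString.GKMStringEqs ħ (-1) T ∧ TodaString.C1StringEqs ħ β T)) ∧
    -- they are the `c = 1` string equations for `β = -1`, and this is the only possible value
    (∀ T : TodaString.TodaOps,
      TodaString.GKMStringEqs ħ (-1) T ↔ TodaString.C1StringEqs ħ (-1) T) ∧
    (∀ β : ℤ, β ≠ 0 → β ≠ -1 → ∀ T : TodaString.TodaOps, TodaString.IsTodaSolution ħ T →
      ¬ (TodaString.GKMStringEqs ħ (-1) T ∧ TodaString.C1StringEqs ħ β T)) ∧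
    -- the `c = 1` solutions
    (∀ β : ℤ, β ≠ 0 → TodaString.C1Regular ħ β →
      (∃! T : TodaString.TodaOps,
        TodaString.IsDeterminedBy ħ (TodaString.c1Matrix ħ β) T) ∧
      ∀ T : TodaString.TodaOps, TodaString.IsDeterminedBy ħ (TodaString.c1Matrix ħ β) T →
        TodaString.IsTodaSolution ħ T ∧ TodaString.C1StringEqs ħ β T ∧
        (TodaString.GKMStringEqs ħ (-1) T ↔ β = -1)) ∧
    -- the generalized Kontsevich model at `p = -1` is the `c = 1` solution at `β = -1`
    (∃! u : ℤ → ℤ → ℂ, TodaString.IsGKMMatrix ħ u) ∧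
    (∀ u : ℤ → ℤ → ℂ, TodaString.IsGKMMatrix ħ u → TodaString.C1Regular ħ (-1) →
      (∃ κ : ℂ, κ ≠ 0 ∧ ∀ i j : ℤ, u i j = κ * TodaString.c1Matrix ħ (-1) i j) ∧
      (∃! T : TodaString.TodaOps, TodaString.IsDeterminedBy ħ u T) ∧
      ∀ T : TodaString.TodaOps, TodaString.IsDeterminedBy ħ u T →
        TodaString.IsTodaSolution ħ T ∧ TodaString.GKMStringEqs ħ (-1) T ∧
        TodaString.IsDeterminedBy ħ (TodaString.c1Matrix ħ (-1)) T ∧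
        ∀ β : ℤ, 1 ≤ β → ¬ TodaString.C1StringEqs ħ β T ∧
          (TodaString.C1Regular ħ β →
            ¬ TodaString.IsDeterminedBy ħ (TodaString.c1Matrix ħ β) T)) ∧
    -- the relation with the Penner model
    (∀ r : ℝ, ħ = (r : ℂ) → r < 0 → ∀ (N : ℕ) (lam : Fin N → ℝ), (∀ i, 0 < lam i) →
      MeasureTheory.IntegrableOn (TodaString.gkmIntegrand r lam)
        (TodaString.posDefSet N) ∧
      MeasureTheory.IntegrableOn (TodaString.pennerIntegrand (-r⁻¹))
        (TodaString.pennerSet N) ∧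
      TodaString.gkmIntegral r lam =
        (∏ i, lam i) ^ ((N : ℝ) - r⁻¹) * TodaString.gkmIntegral r (fun _ : Fin N => 1) ∧
      (Function.Injective lam →
        TodaString.gkmNorm r lam = (-1) ^ N.choose 2 * (∏ i, lam i) ^ (r⁻¹ - (N : ℝ))) ∧
      TodaString.gkmIntegral r (fun _ : Fin N => 1) =
        Real.exp (r⁻¹ * N) * TodaString.pennerPartition (-r⁻¹) N ∧
      0 < TodaString.pennerPartition (-r⁻¹) N) := by
  refine ⟨TodaString.gkmStringEqs_neg_one_iff ħ, ?_, TodaString.gkmStringEqs_iff_c1StringEqs ħ, ?_,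
    ?_, TodaString.existsUnique_isGKMMatrix hħ, ?_, ?_⟩
  · rintro β hβ T hT ⟨hG, hC⟩
    have := hT.eq_neg_one_of_gkm_of_c1 hħ (by omega) hG hC
    omega
  · rintro β hβ hβ' T hT ⟨hG, hC⟩
    exact hβ' (hT.eq_neg_one_of_gkm_of_c1 hħ hβ hG hC)
  · intro β hβ hreg
    refine ⟨TodaString.existsUnique_isDeterminedBy ħ (TodaString.c1Diag_ne_zero hħ hreg), ?_⟩
    intro T hT
    have hsol := TodaString.IsDeterminedBy.isTodaSolution hħ (TodaString.c1Diag_ne_zero hħ hreg) hT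
    have hC := TodaString.IsDeterminedBy.c1StringEqs hħ hβ hreg hT
    refine ⟨hsol, hC, fun hG => hsol.eq_neg_one_of_gkm_of_c1 hħ hβ hG hC, ?_⟩
    rintro rfl
    exact (TodaString.gkmStringEqs_iff_c1StringEqs ħ T).2 hC
  · intro u hu hreg
    obtain ⟨κ, hκ, hκd⟩ := TodaString.exists_gkmDiag_eq_mul hħ hreg
    obtain rfl := TodaString.IsGKMMatrix.unique hu (TodaString.isGKMMatrix_diagFun hħ)
    have hmul : ∀ i j : ℤ, TodaString.diagFun (TodaString.gkmDiag ħ) i j =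
        κ * TodaString.c1Matrix ħ (-1) i j := by
      intro i j
      rw [TodaString.c1Matrix_eq]
      by_cases h : i = j <;> simp [TodaString.diagFun, h, hκd]
    have hd : ∀ i, TodaString.gkmDiag ħ i ≠ 0 := fun i => by
      rw [hκd]
      exact mul_ne_zero hκ (TodaString.c1Diag_ne_zero hħ hreg i)
    refine ⟨⟨κ, hκ, hmul⟩, TodaString.existsUnique_isDeterminedBy ħ hd, ?_⟩
    intro T hT
    have hsol := TodaString.IsDeterminedBy.isTodaSolution hħ hd hT
    have hT' := TodaString.IsDeterminedBy.of_smul hκ hmul hT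
    have hG := (TodaString.gkmStringEqs_iff_c1StringEqs ħ T).2
      (TodaString.IsDeterminedBy.c1StringEqs hħ (by norm_num) hreg hT')
    refine ⟨hsol, hG, hT', fun β hβ => ?_⟩
    -- Both negative claims for `β ≥ 1` rest on the incompatibility: being determined by the `c = 1`
    -- matrix would imply its string equations.
    have hnot : ¬ TodaString.C1StringEqs ħ β T := fun hC => by
      have := hsol.eq_neg_one_of_gkm_of_c1 hħ (by omega) hG hC
      omega
    exact ⟨hnot, fun hregβ hTβ =>
      hnot (TodaString.IsDeterminedBy.c1StringEqs hħ (by omega) hregβ hTβ)⟩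
  · intro r _ hr N lam hlam
    refine ⟨TodaString.integrableOn_gkmIntegrand hr hlam, TodaString.integrableOn_pennerIntegrand hr N,
      TodaString.gkmIntegral_eq_det_rpow_mul r hlam, TodaString.gkmNorm_eq r hlam, ?_, ?_⟩
    · rw [TodaString.pennerPartition_eq, ← mul_assoc, ← Real.exp_add, add_neg_cancel, Real.exp_zero,
        one_mul]
    · rw [TodaString.pennerPartition_eq]
      exact mul_pos (Real.exp_pos _) (TodaString.gkmIntegral_pos hr fun _ => one_pos)
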